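/- **Setting.** Let $\mathbb K$ be an extension field of $\mathbb C$ and let $q\in\mathbb K^\times$ be an element that is not a root of unity, with a chosen square root $q^{1/2}\in\mathbb K^\times$. Let $U_q(\mathfrak u)$ be the Drinfeld–Jimbo algebra $U_q(\mathfrak{sl}_2)$, with generators $E,F,k^{\pm1}$, relations $kE=q^2Ek$, $kF=q^{-2}Fk$, $EF-FE=\frac{k-k^{-1}}{q-q^{-1}}$, and coproduct $\Delta(E)=E\otimes 1+k\otimes E$, $\Delta(F)=F\otimes k^{-1}+1\otimes F$, $\Delta(k)=k\otimes k$. Let $\mathcal O_q(U)$ be the Hopf algebra of matrix coefficients of the finite-dimensional type 1 representations of $U_q(\mathfrak{sl}_2)$ (those that are the sum of the eigenspaces of $k$ for the eigenvalues $q^n$, $n\in\mathbb Z$), and $\langle\cdot,\cdot\rangle$ its pairing with $U_q(\mathfrak u)$; write $y\triangleleft x=\langle y_{(1)},x\rangle y_{(2)}$ for $y\in\mathcal O_q(U)$, $x\in U_q(\mathfrak u)$. Put $$\theta=iq^{-1/2}(E-Fk),\qquad U_q(\mathfrak k)=\mathbb K[\theta]\subset U_q(\mathfrak u),\qquad \mathcal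 O_q(K\backslash U)=\{y\in\mathcal O_q(U): y\triangleleft\theta=0\}.$$ Let $u=\begin{pmatrix}a&b\\c&d\end{pmatrix}$ be the matrix over $\mathcal O_q(U)$ with $\langle u,E\rangle=\begin{pmatrix}0&q^{1/2}\\0&0\end{pmatrix}$, $\langle u,F\rangle=\begin{pmatrix}0&0\\q^{-1/2}&0\end{pmatrix}$, $\langle u,k\rangle=\begin{pmatrix}q&0\\0&q^{-1}\end{pmatrix}$ that is given by the vector representation, let $u^*=\begin{pmatrix}1&0\\0&q\end{pmatrix}\begin{pmatrix}d&-b\\-c&a\end{pmatrix}\begin{pmatrix}1&0\\0&q^{-1}\end{pmatrix}$, and define $X,Y,Z\in\mathcal O_q(K\backslash U)$ by $$u^*\begin{pmatrix}0&-1\\1&0\end{pmatrix}u=\begin{pmatrix}iq^{-1}Z&-Y\\X&-iqZ\end{pmatrix}.$$ Let $U_q(\mathfrak g)$, where $\mathfrak g=\mathfrak{sl}(2,\mathbb R)$, be the subalgebra generated by $U_q(\mathfrak k)$ and $\mathcal O_q(K\backslash U)$ in the Drinfeld double of $U_q(\mathfrak u)^{\mathrm{cop}}$ and $\mathcal O_q(U)$,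 that is, in the universal unital algebra generated by copies of $U_q(\mathfrak u)$ and $\mathcal O_q(U)$ subject to $\langle y_{(1)},x_{(2)}\rangle\,x_{(1)}y_{(2)}=y_{(1)}x_{(2)}\,\langle y_{(2)},x_{(1)}\rangle$ for all $x\in U_q(\mathfrak u)$, $y\in\mathcal O_q(U)$. Let $\mathcal Z_q(\mathfrak g)$ be the center of $U_q(\mathfrak g)$. **Theorem (analogue of the Harish-Chandra isomorphism).** 1. There is a unique unital character $\zeta_0:U_q(\mathfrak k)\to\mathbb K$ with $\zeta_0(\theta)=0$; there is a unique unital algebra morphism $\mathrm{ab}:\mathcal O_q(K\backslash U)\to\mathbb K[t,t^{-1}]$ with $\mathrm{ab}(X)=t$, $\mathrm{ab}(Y)=t^{-1}$, $\mathrm{ab}(Z)=0$; and there is a unique algebra automorphism $\sigma$ of $\mathbb K[t,t^{-1}]$ with $\sigma(t)=q^{-1}t$. 2. There is a unique linear map $\gamma:U_q(\mathfrak g)\to\mathbb K[t,t^{-1}]$ such that $$\gamma(xy)=\zeta_0(x)\,\mathrm{ab}(y)\qquad(x\in U_q(\mathfrak k),\ y\in\mathcal O_q(K\backslash U)).$$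 3. The restriction of $\tilde\gamma=\sigma\circ\gamma$ to $\mathcal Z_q(\mathfrak g)$ is an isomorphism of $\mathbb K$-algebras onto the algebra of Laurent polynomials that are invariant under $t\mapsto t^{-1}$. -/

import Mathlib

open scoped TensorProduct

universe u

noncomputable section

namespace QSL2

/-! Throughout, `r` is an invertible scalar, the chosen square root `q^{1/2}` of `q = r ^ 2`. -/

/-- The deformation parameter `q`, with chosen square root `r`. -/
def q {K : Type u} [Field K] (r : Kˣ) : K := (r : K) ^ 2

/-! ### The Drinfeld-Jimbo algebra `U_q(sl₂)` -/

/-- The generators `E`, `F`, `k`, `k⁻¹` of `U_q(sl₂)`. -/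
inductive Gen : Type
  | E | F | k | kinv

/-- The generators, in the free algebra. -/
abbrev fr (K : Type u) [Field K] (g : Gen) : FreeAlgebra K Gen := FreeAlgebra.ι K g

/-- The defining relations of `U_q(sl₂)`; the last one is
`E F - F E = (k - k⁻¹) / (q - q⁻¹)`, multiplied by `q - q⁻¹`. -/
inductive URel {K : Type u} [Field K] (r : Kˣ) : FreeAlgebra K Gen → FreeAlgebra K Gen → Prop
  | k_kinv : URel r (fr K .k * fr K .kinv) 1
  | kinv_k : URel r (fr K .kinv * fr K .k) 1
  | k_E : URel r (fr K .k * fr K .E) (q r ^ 2 • (fr K .E * fr K .k))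
  | k_F : URel r (q r ^ 2 • (fr K .k * fr K .F)) (fr K .F * fr K .k)
  | E_F : URel r ((q r - (q r)⁻¹) • (fr K .E * fr K .F - fr K .F * fr K .E))
      (fr K .k - fr K .kinv)

/-- The Drinfeld-Jimbo algebra `U_q(sl₂)`. -/
def Uq {K : Type u} [Field K] (r : Kˣ) : Type u := RingQuot (URel r)

instance {K : Type u} [Field K] (r : Kˣ) : Ring (Uq r) := inferInstanceAs (Ring (RingQuot (URel r)))

instance {K : Type u} [Field K] (r : Kˣ) : Algebra K (Uq r) :=
  inferInstanceAs (Algebra K (RingQuot (URel r)))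

namespace Uq

/-- The quotient map from the free algebra. -/
def mk {K : Type u} [Field K] (r : Kˣ) : FreeAlgebra K Gen →ₐ[K] Uq r :=
  RingQuot.mkAlgHom K (URel r)

/-- The generators of `U_q(sl₂)`. -/
def gen {K : Type u} [Field K] (r : Kˣ) (g : Gen) : Uq r := mk r (fr K g)

lemma mk_rel {K : Type u} [Field K] {r : Kˣ} {a b : FreeAlgebra K Gen} (h : URel r a b) :
    mk r a = mk r b := RingQuot.mkAlgHom_rel K h

section rels
variable {K : Type u} [Field K] (r : Kˣ)

lemma k_kinv : gen r .k * gen r .kinv = 1 := by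
  simpa [gen] using mk_rel (URel.k_kinv (r := r))
lemma kinv_k : gen r .kinv * gen r .k = 1 := by
  simpa [gen] using mk_rel (URel.kinv_k (r := r))
lemma k_E : gen r .k * gen r .E = q r ^ 2 • (gen r .E * gen r .k) := by
  simpa [gen] using mk_rel (URel.k_E (r := r))
lemma k_F : q r ^ 2 • (gen r .k * gen r .F) = gen r .F * gen r .k := by
  simpa [gen] using mk_rel (URel.k_F (r := r))
lemma E_F : (q r - (q r)⁻¹) • (gen r .E * gen r .F - gen r .F * gen r .E)
    = gen r .k - gen r .kinv := by
  simpa [gen] using mk_rel (URel.E_F (r := r))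

end rels

/-- The universal property of `U_q(sl₂)`. -/
def lift {K : Type u} [Field K] (r : Kˣ) {A : Type*} [Ring A] [Algebra K A] (f : Gen → A)
    (h1 : f .k * f .kinv = 1) (h2 : f .kinv * f .k = 1)
    (h3 : f .k * f .E = q r ^ 2 • (f .E * f .k))
    (h4 : q r ^ 2 • (f .k * f .F) = f .F * f .k)
    (h5 : (q r - (q r)⁻¹) • (f .E * f .F - f .F * f .E) = f .k - f .kinv) :
    Uq r →ₐ[K] A :=
  RingQuot.liftAlgHom K ⟨FreeAlgebra.lift K f, by
    intro a b h
    cases h <;> simpa⟩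

lemma lift_gen {K : Type u} [Field K] (r : Kˣ) {A : Type*} [Ring A] [Algebra K A] (f : Gen → A)
    (h1 h2 h3 h4 h5) (g : Gen) :
    lift r f h1 h2 h3 h4 h5 (gen r g) = f g := by
  unfold lift gen mk
  erw [RingQuot.liftAlgHom_mkAlgHom_apply]
  simp

lemma algHom_ext {K : Type u} [Field K] {r : Kˣ} {A : Type*} [Ring A] [Algebra K A]
    {f g : Uq r →ₐ[K] A} (h : ∀ x, f (gen r x) = g (gen r x)) : f = g := by
  apply RingQuot.ringQuot_ext'
  apply FreeAlgebra.hom_ext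
  funext x
  exact h x

/-- `Δ` on generators: `ΔE = E ⊗ 1 + k ⊗ E`, `ΔF = F ⊗ k⁻¹ + 1 ⊗ F`, `Δk = k ⊗ k`. -/
def comulGen {K : Type u} [Field K] (r : Kˣ) : Gen → Uq r ⊗[K] Uq r
  | .E => gen r .E ⊗ₜ 1 + gen r .k ⊗ₜ gen r .E
  | .F => gen r .F ⊗ₜ gen r .kinv + 1 ⊗ₜ gen r .F
  | .k => gen r .k ⊗ₜ gen r .k
  | .kinv => gen r .kinv ⊗ₜ gen r .kinv

lemma E_kinv {K : Type u} [Field K] (r : Kˣ) :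
    gen r .E * gen r .kinv = q r ^ 2 • (gen r .kinv * gen r .E) := by
  calc gen r .E * gen r .kinv
      = gen r .kinv * (gen r .k * gen r .E) * gen r .kinv := by
        rw [← mul_assoc, kinv_k, one_mul]
    _ = _ := by
        rw [k_E, mul_smul_comm, smul_mul_assoc, ← mul_assoc, mul_assoc, k_kinv, mul_one]

lemma comulGen_E_F {K : Type u} [Field K] (r : Kˣ) :
    (q r - (q r)⁻¹) • (comulGen r .E * comulGen r .F - comulGen r .F * comulGen r .E)
      = comulGen r .k - comulGen r .kinv := by
  have h1 : (gen r .k * gen r .F) ⊗ₜ[K] (gen r .E * gen r .kinv)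
      = (gen r .F * gen r .k) ⊗ₜ[K] (gen r .kinv * gen r .E) := by
    rw [E_kinv, ← k_F, TensorProduct.tmul_smul, TensorProduct.smul_tmul']
  have h2 : comulGen r .E * comulGen r .F - comulGen r .F * comulGen r .E
      = (gen r .E * gen r .F - gen r .F * gen r .E) ⊗ₜ[K] gen r .kinv
        + gen r .k ⊗ₜ[K] (gen r .E * gen r .F - gen r .F * gen r .E) := by
    simp only [comulGen, mul_add, add_mul, Algebra.TensorProduct.tmul_mul_tmul, one_mul, mul_one,
      h1, TensorProduct.sub_tmul, TensorProduct.tmul_sub]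
    abel
  rw [h2, smul_add, TensorProduct.smul_tmul', ← TensorProduct.tmul_smul, E_F]
  simp only [comulGen, TensorProduct.sub_tmul, TensorProduct.tmul_sub]
  abel

/-- The coproduct. -/
def comulHom {K : Type u} [Field K] (r : Kˣ) : Uq r →ₐ[K] Uq r ⊗[K] Uq r :=
  lift r (comulGen r)
    (by simp [comulGen, k_kinv, Algebra.TensorProduct.one_def])
    (by simp [comulGen, kinv_k, Algebra.TensorProduct.one_def])
    (by simp [comulGen, mul_add, add_mul, k_E, TensorProduct.smul_tmul'])
    (by simp [comulGen, mul_add, add_mul, ← k_F, k_kinv, kinv_k, TensorProduct.smul_tmul'])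
    (comulGen_E_F r)

/-- `ε` on generators. -/
def counitGen {K : Type u} [Field K] : Gen → K
  | .E => 0
  | .F => 0
  | .k => 1
  | .kinv => 1

/-- The counit. -/
def counitHom {K : Type u} [Field K] (r : Kˣ) : Uq r →ₐ[K] K :=
  lift r counitGen (by simp [counitGen]) (by simp [counitGen]) (by simp [counitGen])
    (by simp [counitGen]) (by simp [counitGen])

instance {K : Type u} [Field K] (r : Kˣ) : Bialgebra K (Uq r) :=
  Bialgebra.ofAlgHom (comulHom r) (counitHom r)
    (by
      apply algHom_ext
      rintro (_ | _ | _ | _) <;>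
      simp [comulHom, lift_gen, comulGen, Algebra.TensorProduct.one_def, TensorProduct.tmul_add,
        TensorProduct.add_tmul, add_assoc])
    (by
      apply algHom_ext
      rintro (_ | _ | _ | _) <;>
      simp [comulHom, counitHom, lift_gen, comulGen, counitGen])
    (by
      apply algHom_ext
      rintro (_ | _ | _ | _) <;>
      simp [comulHom, counitHom, lift_gen, comulGen, counitGen])

lemma comul_apply {K : Type u} [Field K] (r : Kˣ) (x : Uq r) :
    Coalgebra.comul (R := K) x = comulHom r x := rfl

lemma counit_apply {K : Type u} [Field K] (r : Kˣ) (x : Uq r) :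
    Coalgebra.counit (R := K) x = counitHom r x := rfl

end Uq

/-! ### The quantized coordinate algebra `O_q(SU(2))` -/

/-- A finite dimensional representation of `U_q(sl₂)` is of type 1 if it is the sum of the
eigenspaces of `k` for the eigenvalues `q ^ n`, `n ∈ ℤ`. -/
def IsTypeOne {K : Type u} [Field K] (r : Kˣ) {V : Type u} [AddCommGroup V] [Module K V]
    (ρ : Uq r →ₐ[K] Module.End K V) : Prop :=
  ⨆ n : ℤ, Module.End.eigenspace (ρ (Uq.gen r .k)) (q r ^ n) = ⊤

/-- `f` is a matrix coefficient of a finite dimensional type 1 representation. -/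
def IsMatrixCoeff {K : Type u} [Field K] (r : Kˣ) (f : Uq r →ₗ[K] K) : Prop :=
  ∃ (V : Type u) (_ : AddCommGroup V) (_ : Module K V) (_ : FiniteDimensional K V)
    (ρ : Uq r →ₐ[K] Module.End K V), IsTypeOne r ρ ∧
    ∃ (ξ : Module.Dual K V) (v : V), ∀ x, f x = ξ (ρ x v)

lemma isMatrixCoeff_smul_counit {K : Type u} [Field K] (r : Kˣ) (c : K) :
    IsMatrixCoeff r (c • (Uq.counitHom r).toLinearMap) := by
  refine ⟨K, inferInstance, inferInstance, inferInstance,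
    (Algebra.ofId K (Module.End K K)).comp (Uq.counitHom r), ?_, c • LinearMap.id, 1, ?_⟩
  · rw [IsTypeOne, eq_top_iff]
    intro v _
    refine Submodule.mem_iSup_of_mem 0 ?_
    simp [Uq.counitHom, Uq.lift_gen, Uq.counitGen]
  · intro x
    simp [Algebra.ofId_apply, Module.algebraMap_end_apply]

lemma IsMatrixCoeff.add {K : Type u} [Field K] {r : Kˣ} {f g : Uq r →ₗ[K] K}
    (hf : IsMatrixCoeff r f) (hg : IsMatrixCoeff r g) : IsMatrixCoeff r (f + g) := by
  obtain ⟨V, _, _, _, ρ, hρ, ξ, v, hf⟩ := hf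
  obtain ⟨W, _, _, _, ρ', hρ', ξ', w, hg⟩ := hg
  refine ⟨V × W, inferInstance, inferInstance, inferInstance,
    (LinearMap.prodMapAlgHom K V W).comp (ρ.prod ρ'), ?_, ξ.coprod ξ', (v, w), ?_⟩
  · rw [IsTypeOne, eq_top_iff]
    have h1 : Submodule.map (LinearMap.inl K V W) ⊤ ≤ ⨆ n : ℤ, Module.End.eigenspace
        (((LinearMap.prodMapAlgHom K V W).comp (ρ.prod ρ')) (Uq.gen r .k)) (q r ^ n) := by
      rw [← hρ, Submodule.map_iSup]
      refine iSup_mono fun n => ?_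
      rintro _ ⟨x, hx, rfl⟩
      simpa [Module.End.mem_eigenspace_iff] using hx
    have h2 : Submodule.map (LinearMap.inr K V W) ⊤ ≤ ⨆ n : ℤ, Module.End.eigenspace
        (((LinearMap.prodMapAlgHom K V W).comp (ρ.prod ρ')) (Uq.gen r .k)) (q r ^ n) := by
      rw [← hρ', Submodule.map_iSup]
      refine iSup_mono fun n => ?_
      rintro _ ⟨x, hx, rfl⟩
      simpa [Module.End.mem_eigenspace_iff] using hx
    rintro ⟨a, b⟩ _
    have := add_mem (h1 ⟨a, trivial, rfl⟩) (h2 ⟨b, trivial, rfl⟩)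
    simpa using this
  · intro x
    simp [hf, hg]

lemma IsMatrixCoeff.mul {K : Type u} [Field K] {r : Kˣ} {f g : WithConv (Uq r →ₗ[K] K)}
    (hf : IsMatrixCoeff r f.ofConv) (hg : IsMatrixCoeff r g.ofConv) :
    IsMatrixCoeff r (f * g).ofConv := by
  obtain ⟨V, _, _, _, ρ, hρ, ξ, v, hf⟩ := hf
  obtain ⟨W, _, _, _, ρ', hρ', ξ', w, hg⟩ := hg
  refine ⟨V ⊗[K] W, inferInstance, inferInstance, inferInstance,
    ((Module.endTensorEndAlgHom (R := K) (S := K) (A := K) (M := V) (N := W)).comp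
      (Algebra.TensorProduct.map ρ ρ')).comp (Uq.comulHom r), ?_,
    LinearMap.mul' K K ∘ₗ TensorProduct.map ξ ξ', v ⊗ₜ w, ?_⟩
  · rw [IsTypeOne, eq_top_iff]
    set S := ⨆ n : ℤ, Module.End.eigenspace
      ((((Module.endTensorEndAlgHom (R := K) (S := K) (A := K) (M := V) (N := W)).comp
      (Algebra.TensorProduct.map ρ ρ')).comp (Uq.comulHom r)) (Uq.gen r .k)) (q r ^ n) with hS
    have key : ∀ a b, a ⊗ₜ[K] b ∈ S := by
      intro a b
      have ha : a ∈ ⨆ n : ℤ, Module.End.eigenspace (ρ (Uq.gen r .k)) (q r ^ n) := by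
        rw [hρ]; trivial
      have hb : b ∈ ⨆ n : ℤ, Module.End.eigenspace (ρ' (Uq.gen r .k)) (q r ^ n) := by
        rw [hρ']; trivial
      induction ha using Submodule.iSup_induction' with
      | zero => simp
      | add x y _ _ hx hy => rw [TensorProduct.add_tmul]; exact add_mem hx hy
      | mem n x hx =>
        induction hb using Submodule.iSup_induction' with
        | zero => simp
        | add y z _ _ hy hz => rw [TensorProduct.tmul_add]; exact add_mem hy hz
        | mem m y hy =>
          refine Submodule.mem_iSup_of_mem (n + m) ?_
          rw [Module.End.mem_eigenspace_iff] at hx hy ⊢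
          have hq : q r ≠ 0 := by simp [q]
          simp [Uq.comulHom, Uq.lift_gen, Uq.comulGen, Module.endTensorEndAlgHom_apply, hx, hy,
            TensorProduct.smul_tmul', TensorProduct.tmul_smul, smul_smul, zpow_add₀ hq, mul_comm]
    intro t _
    induction t using TensorProduct.induction_on with
    | zero => simp
    | add x y hx hy => exact add_mem (hx trivial) (hy trivial)
    | tmul a b => exact key a b
  · intro x
    change (f * g) x = _
    rw [LinearMap.convMul_apply, Uq.comul_apply]
    simp only [AlgHom.comp_apply]
    generalize Uq.comulHom r x = t
    induction t using TensorProduct.induction_on with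
    | zero => simp
    | add x y hx hy => simp only [map_add, hx, hy, LinearMap.add_apply]
    | tmul a b => simp [hf, hg, Module.endTensorEndAlgHom_apply]

/-- The algebra dual to the coalgebra `U_q(sl₂)`, with the product
`⟨y y', x⟩ = ⟨y, x₍₁₎⟩ ⟨y', x₍₂₎⟩` and the unit `ε`. -/
def UDual {K : Type u} [Field K] (r : Kˣ) : Type u := WithConv (Uq r →ₗ[K] K)

instance {K : Type u} [Field K] (r : Kˣ) : Ring (UDual r) :=
  inferInstanceAs (Ring (WithConv (Uq r →ₗ[K] K)))

instance {K : Type u} [Field K] (r : Kˣ) : Algebra K (UDual r) :=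
  inferInstanceAs (Algebra K (WithConv (Uq r →ₗ[K] K)))

/-- The linear form on `U_q(sl₂)` underlying an element of the dual algebra. -/
def UDual.form {K : Type u} [Field K] {r : Kˣ} (f : UDual r) : Uq r →ₗ[K] K := f.ofConv

/-- The matrix coefficients of finite dimensional type 1 representations of `U_q(sl₂)`, as a
subalgebra of the dual of `U_q(sl₂)`. -/
def coeffs {K : Type u} [Field K] (r : Kˣ) : Subalgebra K (UDual r) where
  carrier := {f | IsMatrixCoeff r f.form}
  mul_mem' hf hg := IsMatrixCoeff.mul hf hg
  add_mem' hf hg := IsMatrixCoeff.add hf hg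
  algebraMap_mem' c := isMatrixCoeff_smul_counit r c

/-- `O_q(SU(2))`: the algebra of matrix coefficients of finite dimensional type 1 representations
of `U_q(sl₂)`. -/
def Oq {K : Type u} [Field K] (r : Kˣ) : Type u := coeffs r

instance {K : Type u} [Field K] (r : Kˣ) : Ring (Oq r) := inferInstanceAs (Ring (coeffs r))

instance {K : Type u} [Field K] (r : Kˣ) : Algebra K (Oq r) :=
  inferInstanceAs (Algebra K (coeffs r))

/-- The linear form `⟨y, ·⟩` on `U_q(sl₂)` given by `y ∈ O_q(SU(2))`. -/
def Oq.form {K : Type u} [Field K] {r : Kˣ} (y : Oq r) : Uq r →ₗ[K] K := UDual.form y.1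

lemma Oq.isMatrixCoeff {K : Type u} [Field K] {r : Kˣ} (y : Oq r) : IsMatrixCoeff r y.form := y.2

/-- The element of `O_q(SU(2))` given by a matrix coefficient. -/
def Oq.of {K : Type u} [Field K] {r : Kˣ} (f : Uq r →ₗ[K] K) (h : IsMatrixCoeff r f) : Oq r :=
  ⟨(WithConv.toConv f : WithConv (Uq r →ₗ[K] K)), h⟩

/-- The pairing `⟨y, x⟩` between `O_q(SU(2))` and `U_q(sl₂)`. -/
def pair {K : Type u} [Field K] {r : Kˣ} (y : Oq r) (x : Uq r) : K := y.form x

/-- The right action `y ◁ x = ⟨y₍₁₎, x⟩ y₍₂₎`, that is `⟨y ◁ x, w⟩ = ⟨y, x w⟩`. -/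
def actR {K : Type u} [Field K] {r : Kˣ} (y : Oq r) (x : Uq r) : Oq r :=
  Oq.of (y.form ∘ₗ LinearMap.mulLeft K x) (by
    obtain ⟨V, _, _, _, ρ, hρ, ξ, v, h⟩ := y.isMatrixCoeff
    refine ⟨V, _, _, inferInstance, ρ, hρ, ξ ∘ₗ ρ x, v, fun w => ?_⟩
    simp [h])

/-- The left action `x ▷ y = y₍₁₎ ⟨y₍₂₎, x⟩`, that is `⟨x ▷ y, w⟩ = ⟨y, w x⟩`. -/
def actL {K : Type u} [Field K] {r : Kˣ} (x : Uq r) (y : Oq r) : Oq r :=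
  Oq.of (y.form ∘ₗ LinearMap.mulRight K x) (by
    obtain ⟨V, _, _, _, ρ, hρ, ξ, v, h⟩ := y.isMatrixCoeff
    refine ⟨V, _, _, inferInstance, ρ, hρ, ξ, ρ x v, fun w => ?_⟩
    simp [h])

@[simp] lemma pair_actR {K : Type u} [Field K] {r : Kˣ} (y : Oq r) (x w : Uq r) :
    pair (actR y x) w = pair y (x * w) := rfl

@[simp] lemma pair_actL {K : Type u} [Field K] {r : Kˣ} (y : Oq r) (x w : Uq r) :
    pair (actL x y) w = pair y (w * x) := rfl

@[ext] lemma Oq_ext {K : Type u} [Field K] {r : Kˣ} {y z : Oq r}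
    (h : ∀ w, pair y w = pair z w) : y = z :=
  Subtype.ext (WithConv.ext (LinearMap.ext h) : (y.1 : WithConv (Uq r →ₗ[K] K)) = z.1)

/-- The images of the generators in the vector representation. -/
def vecGen {K : Type u} [Field K] (r : Kˣ) : Gen → Matrix (Fin 2) (Fin 2) K
  | .E => !![0, (r : K); 0, 0]
  | .F => !![0, 0; (r : K)⁻¹, 0]
  | .k => !![q r, 0; 0, (q r)⁻¹]
  | .kinv => !![(q r)⁻¹, 0; 0, q r]

/-- The vector representation `x ↦ ⟨u, x⟩`. -/
def vecRep {K : Type u} [Field K] (r : Kˣ) : Uq r →ₐ[K] Matrix (Fin 2) (Fin 2) K :=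
  have hq : q r ≠ 0 := by simp [q]
  Uq.lift r (vecGen r)
    (by simp [vecGen, hq, Matrix.one_fin_two])
    (by simp [vecGen, hq, Matrix.one_fin_two])
    (by ext i j; fin_cases i <;> fin_cases j <;> simp [vecGen]; field_simp)
    (by ext i j; fin_cases i <;> fin_cases j <;> simp [vecGen]; field_simp)
    (by ext i j; fin_cases i <;> fin_cases j <;> simp [vecGen])

/-- The matrix entries `u_{ij}` of the vector representation. -/
def uEntry {K : Type u} [Field K] (r : Kˣ) (i j : Fin 2) : Oq r :=
  Oq.of (Matrix.entryLinearMap K K i j ∘ₗ (vecRep r).toLinearMap) (by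
    refine ⟨Fin 2 → K, inferInstance, inferInstance, inferInstance,
      (Matrix.toLinAlgEquiv' : _ ≃ₐ[K] _).toAlgHom.comp (vecRep r), ?_,
      LinearMap.proj i, Pi.single j 1, fun x => by simp⟩
    rw [IsTypeOne, eq_top_iff]
    intro v _
    have h1 : (Pi.single 0 (v 0) : Fin 2 → K) ∈ Module.End.eigenspace
      (((Matrix.toLinAlgEquiv' : _ ≃ₐ[K] _).toAlgHom.comp (vecRep r)) (Uq.gen r .k))
        (q r ^ (1 : ℤ)) := by
      rw [Module.End.mem_eigenspace_iff]
      ext i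
      fin_cases i <;> simp [vecRep, Uq.lift_gen, vecGen, Matrix.mulVec, dotProduct]
    have h2 : (Pi.single 1 (v 1) : Fin 2 → K) ∈ Module.End.eigenspace
      (((Matrix.toLinAlgEquiv' : _ ≃ₐ[K] _).toAlgHom.comp (vecRep r)) (Uq.gen r .k))
        (q r ^ (-1 : ℤ)) := by
      rw [Module.End.mem_eigenspace_iff]
      ext i
      fin_cases i <;> simp [vecRep, Uq.lift_gen, vecGen, Matrix.mulVec, dotProduct]
    have hv : v = Pi.single 0 (v 0) + Pi.single 1 (v 1) := by
      ext i
      fin_cases i <;> simp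
    rw [hv]
    exact add_mem (Submodule.mem_iSup_of_mem 1 h1) (Submodule.mem_iSup_of_mem (-1) h2))

/-- The matrix `u` over `O_q(SU(2))`. -/
def uMat {K : Type u} [Field K] (r : Kˣ) : Matrix (Fin 2) (Fin 2) (Oq r) :=
  Matrix.of (uEntry r)

/-- The matrix `u* = diag(1, q) adj(u) diag(1, q⁻¹)`. -/
def uStar {K : Type u} [Field K] (r : Kˣ) : Matrix (Fin 2) (Fin 2) (Oq r) :=
  !![1, 0; 0, algebraMap K (Oq r) (q r)]
    * !![uEntry r 1 1, - uEntry r 0 1; - uEntry r 1 0, uEntry r 0 0]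
    * !![1, 0; 0, algebraMap K (Oq r) (q r)⁻¹]

/-- The matrix `u* J u`, with `J = (0, -1; 1, 0)`; its entries are
`(i q⁻¹ Z, -Y; X, -i q Z)`. -/
def uJu {K : Type u} [Field K] (r : Kˣ) : Matrix (Fin 2) (Fin 2) (Oq r) :=
  uStar r * !![0, -1; 1, 0] * uMat r

/-! ### The coideal subalgebras `U_q(𝔨)` and `O_q(K\U)` -/

/-- The imaginary unit of `ℂ`, in `K`. -/
def imag (K : Type u) [Field K] [Algebra ℂ K] : K := algebraMap ℂ K Complex.I

/-- `θ = i q^{-1/2} (E - F k)`. -/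
def theta {K : Type u} [Field K] [Algebra ℂ K] (r : Kˣ) : Uq r :=
  (imag K * (r : K)⁻¹) • (Uq.gen r .E - Uq.gen r .F * Uq.gen r .k)

/-- `U_q(𝔨)`, the unital subalgebra of `U_q(sl₂)` generated by `θ`. -/
def Uk {K : Type u} [Field K] [Algebra ℂ K] (r : Kˣ) : Subalgebra K (Uq r) :=
  Algebra.adjoin K {theta r}

/-- `θ` as an element of `U_q(𝔨)`. -/
def thetaK {K : Type u} [Field K] [Algebra ℂ K] (r : Kˣ) : Uk r :=
  ⟨theta r, Algebra.subset_adjoin rfl⟩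

lemma comul_theta {K : Type u} [Field K] [Algebra ℂ K] (r : Kˣ) :
    Uq.comulHom r (theta r) = theta r ⊗ₜ 1 + Uq.gen r .k ⊗ₜ theta r := by
  have h : Uq.comulHom r (Uq.gen r .E - Uq.gen r .F * Uq.gen r .k)
      = (Uq.gen r .E - Uq.gen r .F * Uq.gen r .k) ⊗ₜ 1
        + Uq.gen r .k ⊗ₜ (Uq.gen r .E - Uq.gen r .F * Uq.gen r .k) := by
    simp only [Uq.comulHom, map_sub, map_mul, Uq.lift_gen, Uq.comulGen, add_mul,
      Algebra.TensorProduct.tmul_mul_tmul, Uq.kinv_k, one_mul, TensorProduct.sub_tmul,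
      TensorProduct.tmul_sub]
    abel
  rw [theta, map_smul, h, smul_add, TensorProduct.smul_tmul', TensorProduct.tmul_smul]

lemma pair_mul {K : Type u} [Field K] {r : Kˣ} (y z : Oq r) (x : Uq r) :
    pair (y * z) x =
      LinearMap.mul' K K (TensorProduct.map y.form z.form (Uq.comulHom r x)) := rfl

/-- `(y z) ◁ θ = (y ◁ θ) z + (y ◁ k) (z ◁ θ)`. -/
lemma mul_actR_theta {K : Type u} [Field K] [Algebra ℂ K] {r : Kˣ} (y z : Oq r) :
    actR (y * z) (theta r)
      = actR y (theta r) * z + actR y (Uq.gen r .k) * actR z (theta r) := by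
  ext w
  have hadd : ∀ a b : Oq r, pair (a + b) w = pair a w + pair b w := fun _ _ => rfl
  rw [hadd, pair_actR, pair_mul, pair_mul, pair_mul, map_mul, comul_theta]
  generalize Uq.comulHom r w = t
  induction t using TensorProduct.induction_on with
  | zero => simp
  | add a b ha hb =>
    simp only [map_add, mul_add, ha, hb]
    ring
  | tmul a b => simp [add_mul, actR, Oq.of, Oq.form, UDual.form]

lemma actR_add {K : Type u} [Field K] {r : Kˣ} (y z : Oq r) (x : Uq r) :
    actR (y + z) x = actR y x + actR z x := rfl

lemma actR_smul {K : Type u} [Field K] {r : Kˣ} (c : K) (y : Oq r) (x : Uq r) :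
    actR (c • y) x = c • actR y x := rfl

lemma pair_algebraMap {K : Type u} [Field K] {r : Kˣ} (c : K) (x : Uq r) :
    pair (algebraMap K (Oq r) c) x = c * Uq.counitHom r x := rfl

/-- `O_q(K\U)`, the algebra of all `y ∈ O_q(SU(2))` with `y ◁ θ = 0`. -/
def OKU {K : Type u} [Field K] [Algebra ℂ K] (r : Kˣ) : Subalgebra K (Oq r) where
  carrier := {y | actR y (theta r) = 0}
  mul_mem' {y z} hy hz := by
    simp only [Set.mem_ofPred_eq] at *
    rw [mul_actR_theta, hy, hz, zero_mul, mul_zero, add_zero]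
  add_mem' {y z} hy hz := by
    simp only [Set.mem_ofPred_eq] at *
    rw [actR_add, hy, hz, add_zero]
  algebraMap_mem' c := by
    ext w
    rw [pair_actR, pair_algebraMap, map_mul]
    have : Uq.counitHom r (theta r) = 0 := by
      simp [theta, Uq.counitHom, Uq.lift_gen, Uq.counitGen]
    rw [this, zero_mul, mul_zero]
    rfl

/-- `u_{ij} ◁ x = ∑ l, ⟨u_{il}, x⟩ u_{lj}`. -/
lemma uEntry_actR {K : Type u} [Field K] {r : Kˣ} (x : Uq r) (i j : Fin 2) :
    actR (uEntry r i j) x = vecRep r x i 0 • uEntry r 0 j + vecRep r x i 1 • uEntry r 1 j := by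
  ext w
  change vecRep r (x * w) i j = vecRep r x i 0 * vecRep r w 0 j + vecRep r x i 1 * vecRep r w 1 j
  rw [map_mul, Matrix.mul_apply, Fin.sum_univ_two]

lemma vecRep_k {K : Type u} [Field K] (r : Kˣ) :
    vecRep r (Uq.gen r .k) = !![q r, 0; 0, (q r)⁻¹] := by
  simp [vecRep, Uq.lift_gen, vecGen]

lemma vecRep_theta {K : Type u} [Field K] [Algebra ℂ K] (r : Kˣ) :
    vecRep r (theta r) = !![0, imag K; -imag K, 0] := by
  rw [theta, map_smul, map_sub, map_mul]
  ext i j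
  fin_cases i <;> fin_cases j <;>
    simp [vecRep, Uq.lift_gen, vecGen, q]
  field_simp

/-- The element `X` of `O_q(SU(2))`. -/
def X₀ {K : Type u} [Field K] (r : Kˣ) : Oq r := uJu r 1 0

/-- The element `Y` of `O_q(SU(2))`. -/
def Y₀ {K : Type u} [Field K] (r : Kˣ) : Oq r := -uJu r 0 1

/-- The element `Z` of `O_q(SU(2))`, determined by `(u* J u)₁₁ = i q⁻¹ Z`. -/
def Z₀ {K : Type u} [Field K] [Algebra ℂ K] (r : Kˣ) : Oq r :=
  (imag K * (q r)⁻¹)⁻¹ • uJu r 0 0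

lemma uStar_eq {K : Type u} [Field K] (r : Kˣ) :
    uStar r = !![uEntry r 1 1, -((q r)⁻¹ • uEntry r 0 1); -(q r • uEntry r 1 0), uEntry r 0 0] := by
  have hq : q r ≠ 0 := by simp [q]
  have h : ∀ (c : K) (y : Oq r), y * algebraMap K (Oq r) c = c • y := fun c y => by
    rw [← Algebra.commutes, Algebra.smul_def]
  rw [uStar, Matrix.mul_fin_two, Matrix.mul_fin_two]
  simp [h, ← Algebra.smul_def, smul_smul, hq]

lemma uJu_eq {K : Type u} [Field K] (r : Kˣ) :
    uJu r = !![-(uEntry r 1 1 * uEntry r 1 0) - (q r)⁻¹ • (uEntry r 0 1 * uEntry r 0 0),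
      -(uEntry r 1 1 * uEntry r 1 1) - (q r)⁻¹ • (uEntry r 0 1 * uEntry r 0 1);
      uEntry r 0 0 * uEntry r 0 0 + q r • (uEntry r 1 0 * uEntry r 1 0),
      q r • (uEntry r 1 0 * uEntry r 1 1) + uEntry r 0 0 * uEntry r 0 1] := by
  have h : uMat r = !![uEntry r 0 0, uEntry r 0 1; uEntry r 1 0, uEntry r 1 1] := by
    ext i j
    fin_cases i <;> fin_cases j <;> rfl
  rw [uJu, uStar_eq, h, Matrix.mul_fin_two, Matrix.mul_fin_two]
  refine Matrix.ext fun i j => ?_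
  fin_cases i <;> fin_cases j <;> simp <;> abel

lemma actR_neg {K : Type u} [Field K] {r : Kˣ} (y : Oq r) (x : Uq r) :
    actR (-y) x = -actR y x := rfl

lemma actR_sub {K : Type u} [Field K] {r : Kˣ} (y z : Oq r) (x : Uq r) :
    actR (y - z) x = actR y x - actR z x := rfl

lemma X₀_mem {K : Type u} [Field K] [Algebra ℂ K] (r : Kˣ) : X₀ r ∈ OKU r := by
  have hq : q r ≠ 0 := by simp [q]
  change actR (X₀ r) (theta r) = 0
  simp only [X₀, uJu_eq, Matrix.cons_val', Matrix.cons_val_zero, Matrix.cons_val_one,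
    Matrix.of_apply, Matrix.cons_val_fin_one, actR_add, actR_smul,
    mul_actR_theta, uEntry_actR, vecRep_theta, vecRep_k, zero_smul, zero_add, add_zero,
    smul_mul_assoc, mul_smul_comm]
  match_scalars <;> field_simp <;> ring

lemma Y₀_mem {K : Type u} [Field K] [Algebra ℂ K] (r : Kˣ) : Y₀ r ∈ OKU r := by
  have hq : q r ≠ 0 := by simp [q]
  change actR (Y₀ r) (theta r) = 0
  simp only [Y₀, uJu_eq, Matrix.cons_val', Matrix.cons_val_zero, Matrix.cons_val_one,
    Matrix.of_apply, Matrix.cons_val_fin_one, actR_neg, actR_sub, actR_smul,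
    mul_actR_theta, uEntry_actR, vecRep_theta, vecRep_k, zero_smul, zero_add, add_zero,
    smul_mul_assoc, mul_smul_comm]
  match_scalars <;> field_simp <;> ring

lemma Z₀_mem {K : Type u} [Field K] [Algebra ℂ K] (r : Kˣ) : Z₀ r ∈ OKU r := by
  have hq : q r ≠ 0 := by simp [q]
  change actR (Z₀ r) (theta r) = 0
  simp only [Z₀, uJu_eq, Matrix.cons_val', Matrix.cons_val_zero, Matrix.cons_val_one,
    Matrix.of_apply, Matrix.cons_val_fin_one, actR_neg, actR_sub, actR_smul,
    mul_actR_theta, uEntry_actR, vecRep_theta, vecRep_k, zero_smul, zero_add, add_zero,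
    smul_mul_assoc, mul_smul_comm]
  match_scalars <;> field_simp <;> ring

/-- `X` as an element of `O_q(K\U)`. -/
def X {K : Type u} [Field K] [Algebra ℂ K] (r : Kˣ) : OKU r := ⟨X₀ r, X₀_mem r⟩

/-- `Y` as an element of `O_q(K\U)`. -/
def Y {K : Type u} [Field K] [Algebra ℂ K] (r : Kˣ) : OKU r := ⟨Y₀ r, Y₀_mem r⟩

/-- `Z` as an element of `O_q(K\U)`. -/
def Z {K : Type u} [Field K] [Algebra ℂ K] (r : Kˣ) : OKU r := ⟨Z₀ r, Z₀_mem r⟩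

/-! ### The Drinfeld double and `U_q(𝔤)` -/

/-- A formal copy of `x ∈ U_q(sl₂)`. -/
abbrev frU {K : Type u} [Field K] {r : Kˣ} (x : Uq r) : FreeAlgebra K (Uq r ⊕ Oq r) :=
  FreeAlgebra.ι K (Sum.inl x)

/-- A formal copy of `y ∈ O_q(SU(2))`. -/
abbrev frO {K : Type u} [Field K] {r : Kˣ} (y : Oq r) : FreeAlgebra K (Uq r ⊕ Oq r) :=
  FreeAlgebra.ι K (Sum.inr y)

/-- The relations of the Drinfeld double: `U_q(sl₂)` and `O_q(SU(2))` map to it by unital algebra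
morphisms, and `⟨y₍₁₎, x₍₂₎⟩ x₍₁₎ y₍₂₎ = y₍₁₎ x₍₂₎ ⟨y₍₂₎, x₍₁₎⟩`, i.e.
`x₍₁₎ (y ◁ x₍₂₎) = (x₍₁₎ ▷ y) x₍₂₎`, for all `x ∈ U_q(sl₂)` and `y ∈ O_q(SU(2))`
(these are the exchange relations for the opposite coproduct on `U_q(sl₂)`). -/
inductive DoubleRel {K : Type u} [Field K] (r : Kˣ) :
    FreeAlgebra K (Uq r ⊕ Oq r) → FreeAlgebra K (Uq r ⊕ Oq r) → Prop
  | U_add (x x' : Uq r) : DoubleRel r (frU (x + x')) (frU x + frU x')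
  | U_mul (x x' : Uq r) : DoubleRel r (frU (x * x')) (frU x * frU x')
  | U_scalar (c : K) : DoubleRel r (frU (algebraMap K (Uq r) c)) (algebraMap K _ c)
  | O_add (y y' : Oq r) : DoubleRel r (frO (y + y')) (frO y + frO y')
  | O_mul (y y' : Oq r) : DoubleRel r (frO (y * y')) (frO y * frO y')
  | O_scalar (c : K) : DoubleRel r (frO (algebraMap K (Oq r) c)) (algebraMap K _ c)
  | exchange (x : Uq r) (y : Oq r) (s : Coalgebra.Repr K x ℕ) :
      DoubleRel r (∑ n ∈ s.index, frU (s.left n) * frO (actR y (s.right n)))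
        (∑ n ∈ s.index, frO (actL (s.left n) y) * frU (s.right n))

/-- The Drinfeld double of `U_q(sl₂)` (with the opposite coproduct) and `O_q(SU(2))`. -/
def Double {K : Type u} [Field K] (r : Kˣ) : Type u := RingQuot (DoubleRel r)

instance {K : Type u} [Field K] (r : Kˣ) : Ring (Double r) :=
  inferInstanceAs (Ring (RingQuot (DoubleRel r)))

instance {K : Type u} [Field K] (r : Kˣ) : Algebra K (Double r) :=
  inferInstanceAs (Algebra K (RingQuot (DoubleRel r)))

/-- The quotient map. -/
def Double.mk {K : Type u} [Field K] (r : Kˣ) :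
    FreeAlgebra K (Uq r ⊕ Oq r) →ₐ[K] Double r :=
  RingQuot.mkAlgHom K (DoubleRel r)

lemma Double.mk_rel {K : Type u} [Field K] {r : Kˣ} {a b : FreeAlgebra K (Uq r ⊕ Oq r)}
    (h : DoubleRel r a b) : Double.mk r a = Double.mk r b := RingQuot.mkAlgHom_rel K h

/-- The embedding of `U_q(sl₂)` in the double. -/
def Double.ofU {K : Type u} [Field K] (r : Kˣ) : Uq r →ₐ[K] Double r where
  toFun x := Double.mk r (frU x)
  map_one' := by
    have := Double.mk_rel (DoubleRel.U_scalar (r := r) 1)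
    simpa using this
  map_mul' x x' := by
    rw [Double.mk_rel (DoubleRel.U_mul x x'), map_mul]
  map_zero' := by
    have := Double.mk_rel (DoubleRel.U_scalar (r := r) 0)
    simpa using this
  map_add' x x' := by
    rw [Double.mk_rel (DoubleRel.U_add x x'), map_add]
  commutes' c := by
    rw [Double.mk_rel (DoubleRel.U_scalar c), AlgHom.commutes]

/-- The embedding of `O_q(SU(2))` in the double. -/
def Double.ofO {K : Type u} [Field K] (r : Kˣ) : Oq r →ₐ[K] Double r where
  toFun y := Double.mk r (frO y)
  map_one' := by
    have := Double.mk_rel (DoubleRel.O_scalar (r := r) 1)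
    simpa using this
  map_mul' y y' := by
    rw [Double.mk_rel (DoubleRel.O_mul y y'), map_mul]
  map_zero' := by
    have := Double.mk_rel (DoubleRel.O_scalar (r := r) 0)
    simpa using this
  map_add' y y' := by
    rw [Double.mk_rel (DoubleRel.O_add y y'), map_add]
  commutes' c := by
    rw [Double.mk_rel (DoubleRel.O_scalar c), AlgHom.commutes]

/-- `U_q(𝔤)`, for `𝔤 = sl(2, ℝ)`: the subalgebra of the double generated by `U_q(𝔨)` and
`O_q(K\U)`. -/
def Ug {K : Type u} [Field K] [Algebra ℂ K] (r : Kˣ) : Subalgebra K (Double r) :=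
  (Uk r).map (Double.ofU r) ⊔ (OKU r).map (Double.ofO r)

/-- The inclusion of `U_q(𝔨)` in `U_q(𝔤)`. -/
def inclK {K : Type u} [Field K] [Algebra ℂ K] (r : Kˣ) : Uk r →ₐ[K] Ug r :=
  ((Double.ofU r).comp (Uk r).val).codRestrict (Ug r) fun x =>
    (le_sup_left : _ ≤ Ug r) ⟨x, x.2, rfl⟩

/-- The inclusion of `O_q(K\U)` in `U_q(𝔤)`. -/
def inclO {K : Type u} [Field K] [Algebra ℂ K] (r : Kˣ) : OKU r →ₐ[K] Ug r :=
  ((Double.ofO r).comp (OKU r).val).codRestrict (Ug r) fun y =>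
    (le_sup_right : _ ≤ Ug r) ⟨y, y.2, rfl⟩

/-- The center `Z_q(𝔤)` of `U_q(𝔤)`. -/
abbrev Zg {K : Type u} [Field K] [Algebra ℂ K] (r : Kˣ) : Subalgebra K (Ug r) :=
  Subalgebra.center K (Ug r)

/-- The algebra of Laurent polynomials that are invariant under `t ↦ t⁻¹`. -/
def invariants (K : Type u) [Field K] : Subalgebra K (LaurentPolynomial K) :=
  AlgHom.equalizer (LaurentPolynomial.invert : LaurentPolynomial K ≃ₐ[K] _).toAlgHom
    (AlgHom.id K (LaurentPolynomial K))

end QSL2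

end

/-!
The proof follows the classical pattern for a Harish-Chandra isomorphism of rank one: the center is
shown to be the polynomial algebra in a single Casimir element `Ω`, whose image under `σ ∘ γ` is
`t + t⁻¹`, the generator of the algebra of invariant Laurent polynomials.

*The algebra `O_q(K\U)`.* It is stable under the left action of `U_q(sl₂)`, so it is graded by the
weights of `k`. Since `U_q(sl₂)` is spanned by the right ideal `θ U_q(sl₂)` and the elements
`E ^ i k ^ j`, a weight vector of `O_q(K\U)` is determined by its values at the powers of
`E` (`eq_zero_of_pair_E`), and likewise at the powers of `F`. In these coordinates multiplication by
`X` is diagonal and multiplication by `Z` is a weighted shift. This gives the relations between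
`X`, `Y` and `Z`, the fact that they generate (`OKU_le_adjoin`; a weight vector of odd weight would
generate an infinite dimensional module, and in even weights `Z ^ N X ^ m` or `Z ^ N Y ^ m` give the
unit vectors), and a characterization of the multiples of `Z ^ n` by commutation with `Z` and `X`
(`eq_smul_Z₀_pow`).

*Triangular decomposition.* The exchange relation with `θ` moves powers of `θ` to the left, so every
element of `U_q(𝔤)` has the form `∑ θ ^ i aᵢ` with `aᵢ ∈ O_q(K\U)`. That the `aᵢ` are unique is seen
in a representation of the Drinfeld double (`doubleRep`): it acts on sequences in `O_q`, with `O_q`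
acting by left multiplication, and `U_q(sl₂)` acting by its adjoint-type action on `O_q` twisted by
an infinite dimensional module in which `θ` moves the unit vector `δ n` to a nonzero multiple of
`δ (n + 1)` plus a multiple of `δ (n - 1)`. Hence `γ`, which applies `ab` to `a₀`, exists.

*The center.* `Ω = (q - q⁻¹) θ Z + q X + q⁻¹ Y` is central, and `Ω ^ n` has the leading term
`(q - q⁻¹) ^ n θ ^ n Z ^ n`. If `θ ^ n a + ⋯` is central, then comparing leading terms in the
commutators with `Z` and `X` shows that `a` commutes with `Z`, and with `X` up to the scalar
`q ^ (-2n)`; so `a` is a multiple of `Z ^ n`, and a multiple of `Ω ^ n` can be subtracted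
(`exists_aeval_dCasimir`). On the center `γ` is multiplicative, because `x y z = x z y` for central
`z`.

*The character `ab`.* The values of `y ∈ O_q(K\U)` at the powers of the group-like element `k`
depend multiplicatively on `y`; they are those of a Laurent polynomial at the powers of `q²`, and
that Laurent polynomial is `ab y`.
-/

noncomputable section

namespace QSL2

/-! ### The two actions of `U_q(sl₂)` on its coordinate algebra -/

section Actions

variable {K : Type u} [Field K] {r : Kˣ}

lemma q_ne_zero (r : Kˣ) : q r ≠ 0 := by simp [q]

/-- If `q` is not a root of unity, its integer powers are distinct. -/
lemma q_zpow_injective (hq : ∀ n : ℕ, 0 < n → q r ^ n ≠ 1) :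
    Function.Injective fun n : ℤ => q r ^ n := by
  have key : ∀ m n : ℤ, m < n → q r ^ m ≠ q r ^ n := by
    intro m n hmn h
    obtain ⟨k, hk⟩ := Int.eq_ofNat_of_zero_le (sub_nonneg.2 hmn.le)
    refine hq k (by omega) ?_
    rw [← zpow_natCast, ← hk, zpow_sub₀ (q_ne_zero r), h,
      div_self (zpow_ne_zero _ (q_ne_zero r))]
  intro m n h
  rcases lt_trichotomy m n with h' | h' | h'
  · exact (key m n h' h).elim
  · exact h'
  · exact (key n m h' h.symm).elim

@[simp] lemma pair_add (y z : Oq r) (x : Uq r) : pair (y + z) x = pair y x + pair z x := rfl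

@[simp] lemma pair_sub (y z : Oq r) (x : Uq r) : pair (y - z) x = pair y x - pair z x := rfl

@[simp] lemma pair_zero (x : Uq r) : pair (0 : Oq r) x = 0 := rfl

@[simp] lemma pair_smul (c : K) (y : Oq r) (x : Uq r) : pair (c • y) x = c * pair y x := rfl

lemma pair_one (x : Uq r) : pair (1 : Oq r) x = Uq.counitHom r x := by
  have := pair_algebraMap (r := r) 1 x
  simpa using this

@[simp] lemma pair_map_add (y : Oq r) (x x' : Uq r) : pair y (x + x') = pair y x + pair y x' :=
  y.form.map_add x x'

@[simp] lemma pair_map_sub (y : Oq r) (x x' : Uq r) : pair y (x - x') = pair y x - pair y x' :=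
  y.form.map_sub x x'

@[simp] lemma pair_map_zero (y : Oq r) : pair y 0 = 0 := y.form.map_zero

@[simp] lemma pair_map_smul (y : Oq r) (c : K) (x : Uq r) : pair y (c • x) = c * pair y x :=
  y.form.map_smul c x

/-- The left action `▷`, as a representation of `U_q(sl₂)`. -/
def actLHom (r : Kˣ) : Uq r →ₐ[K] Module.End K (Oq r) where
  toFun x :=
    { toFun := actL x
      map_add' := fun _ _ => rfl
      map_smul' := fun _ _ => rfl }
  map_one' := by
    refine LinearMap.ext fun y => Oq_ext fun w => ?_
    change pair (actL 1 y) w = pair y w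
    rw [pair_actL, mul_one]
  map_mul' x x' := by
    refine LinearMap.ext fun y => Oq_ext fun w => ?_
    change pair (actL (x * x') y) w = pair (actL x (actL x' y)) w
    rw [pair_actL, pair_actL, pair_actL, mul_assoc]
  map_zero' := by
    refine LinearMap.ext fun y => Oq_ext fun w => ?_
    change pair (actL 0 y) w = 0
    rw [pair_actL, mul_zero, pair_map_zero]
  map_add' x x' := by
    refine LinearMap.ext fun y => Oq_ext fun w => ?_
    change pair (actL (x + x') y) w = pair (actL x y) w + pair (actL x' y) w
    simp [mul_add]
  commutes' c := by
    refine LinearMap.ext fun y => Oq_ext fun w => ?_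
    change pair (actL (algebraMap K _ c) y) w = pair (c • y) w
    rw [pair_actL, ← Algebra.commutes, ← Algebra.smul_def, pair_map_smul, pair_smul]

lemma actLHom_apply (x : Uq r) (y : Oq r) : actLHom r x y = actL x y := rfl

@[simp] lemma actL_one (y : Oq r) : actL 1 y = y := by
  rw [← actLHom_apply, map_one]; rfl

lemma actL_mul (x x' : Uq r) (y : Oq r) : actL (x * x') y = actL x (actL x' y) := by
  simp only [← actLHom_apply, map_mul]; rfl

lemma actL_smul_left (c : K) (x : Uq r) (y : Oq r) : actL (c • x) y = c • actL x y := by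
  simp only [← actLHom_apply, map_smul]; rfl

lemma actL_add_left (x x' : Uq r) (y : Oq r) : actL (x + x') y = actL x y + actL x' y := by
  simp only [← actLHom_apply, map_add]; rfl

lemma actL_sub_left (x x' : Uq r) (y : Oq r) : actL (x - x') y = actL x y - actL x' y := by
  simp only [← actLHom_apply, map_sub]; rfl

@[simp] lemma actL_zero_left (y : Oq r) : actL 0 y = 0 := by
  simp only [← actLHom_apply, map_zero]; rfl

lemma actL_add (x : Uq r) (y z : Oq r) : actL x (y + z) = actL x y + actL x z := rfl

lemma actL_sub (x : Uq r) (y z : Oq r) : actL x (y - z) = actL x y - actL x z := rfl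

lemma actL_smul (x : Uq r) (c : K) (y : Oq r) : actL x (c • y) = c • actL x y := rfl

@[simp] lemma actL_zero (x : Uq r) : actL x (0 : Oq r) = 0 := rfl

lemma actL_pow_succ (x : Uq r) (n : ℕ) (y : Oq r) :
    actL (x ^ (n + 1)) y = actL x (actL (x ^ n) y) := by
  rw [pow_succ', actL_mul]

/-- Values of `y` are values at `1` of its translates. -/
lemma pair_eq_actL_one (y : Oq r) (x : Uq r) : pair y x = pair (actL x y) 1 := by
  rw [pair_actL, one_mul]

/-- The right action `◁`, as a linear map in both arguments. -/
def actRLin (r : Kˣ) : Uq r →ₗ[K] Module.End K (Oq r) where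
  toFun x :=
    { toFun := fun y => actR y x
      map_add' := fun _ _ => rfl
      map_smul' := fun _ _ => rfl }
  map_add' x x' := by
    refine LinearMap.ext fun y => Oq_ext fun w => ?_
    change pair (actR y (x + x')) w = pair (actR y x) w + pair (actR y x') w
    simp [add_mul]
  map_smul' c x := by
    refine LinearMap.ext fun y => Oq_ext fun w => ?_
    change pair (actR y (c • x)) w = pair (c • actR y x) w
    simp

lemma actRLin_apply (x : Uq r) (y : Oq r) : actRLin r x y = actR y x := rfl

@[simp] lemma actR_one (y : Oq r) : actR y 1 = y :=
  Oq_ext fun w => by rw [pair_actR, one_mul]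

lemma actR_mul (y : Oq r) (x x' : Uq r) : actR y (x * x') = actR (actR y x) x' :=
  Oq_ext fun w => by rw [pair_actR, pair_actR, pair_actR, mul_assoc]

lemma actR_neg_right (y : Oq r) (x : Uq r) : actR y (-x) = -actR y x := by
  simp only [← actRLin_apply, map_neg]; rfl

lemma actR_smul_right (y : Oq r) (c : K) (x : Uq r) : actR y (c • x) = c • actR y x := by
  simp only [← actRLin_apply, map_smul]; rfl

@[simp] lemma actR_zero_right (y : Oq r) : actR y 0 = 0 := by
  simp only [← actRLin_apply, map_zero]; rfl

@[simp] lemma actR_zero_left (x : Uq r) : actR (0 : Oq r) x = 0 := rfl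

/-- The two actions commute. -/
lemma actL_actR (x x' : Uq r) (y : Oq r) : actL x (actR y x') = actR (actL x y) x' :=
  Oq_ext fun w => by simp [mul_assoc]

lemma actL_on_one (x : Uq r) : actL x (1 : Oq r) = Uq.counitHom r x • 1 :=
  Oq_ext fun w => by simp [pair_one, mul_comm]

lemma actR_on_one (x : Uq r) : actR (1 : Oq r) x = Uq.counitHom r x • 1 :=
  Oq_ext fun w => by simp [pair_one]

@[simp] lemma counit_E : Uq.counitHom r (Uq.gen r .E) = 0 := by
  simp [Uq.counitHom, Uq.lift_gen, Uq.counitGen]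
@[simp] lemma counit_F : Uq.counitHom r (Uq.gen r .F) = 0 := by
  simp [Uq.counitHom, Uq.lift_gen, Uq.counitGen]
@[simp] lemma counit_k : Uq.counitHom r (Uq.gen r .k) = 1 := by
  simp [Uq.counitHom, Uq.lift_gen, Uq.counitGen]
@[simp] lemma counit_kinv : Uq.counitHom r (Uq.gen r .kinv) = 1 := by
  simp [Uq.counitHom, Uq.lift_gen, Uq.counitGen]

lemma comul_E : Uq.comulHom r (Uq.gen r .E)
    = Uq.gen r .E ⊗ₜ 1 + Uq.gen r .k ⊗ₜ Uq.gen r .E := by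
  simp [Uq.comulHom, Uq.lift_gen, Uq.comulGen]
lemma comul_F : Uq.comulHom r (Uq.gen r .F)
    = Uq.gen r .F ⊗ₜ Uq.gen r .kinv + 1 ⊗ₜ Uq.gen r .F := by
  simp [Uq.comulHom, Uq.lift_gen, Uq.comulGen]
lemma comul_k : Uq.comulHom r (Uq.gen r .k) = Uq.gen r .k ⊗ₜ Uq.gen r .k := by
  simp [Uq.comulHom, Uq.lift_gen, Uq.comulGen]
lemma comul_kinv : Uq.comulHom r (Uq.gen r .kinv) = Uq.gen r .kinv ⊗ₜ Uq.gen r .kinv := by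
  simp [Uq.comulHom, Uq.lift_gen, Uq.comulGen]

/-- The left action makes `O_q` a module algebra; this is the case of a coproduct with two terms. -/
lemma actL_mul_of_comul {x a b c d : Uq r} (h : Uq.comulHom r x = a ⊗ₜ b + c ⊗ₜ d) (y z : Oq r) :
    actL x (y * z) = actL a y * actL b z + actL c y * actL d z := by
  ext w
  rw [pair_add, pair_actL, pair_mul, pair_mul, pair_mul, map_mul, h]
  generalize Uq.comulHom r w = t
  induction t using TensorProduct.induction_on with
  | zero => simp
  | add s t hs ht =>
    simp only [map_add, add_mul, hs, ht]
    ring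
  | tmul s t => simp [mul_add, actL, Oq.of, Oq.form, UDual.form]

/-- The right action makes `O_q` a module algebra; this is the case of a coproduct with two
terms. -/
lemma mul_actR_of_comul {x a b c d : Uq r} (h : Uq.comulHom r x = a ⊗ₜ b + c ⊗ₜ d) (y z : Oq r) :
    actR (y * z) x = actR y a * actR z b + actR y c * actR z d := by
  ext w
  rw [pair_add, pair_actR, pair_mul, pair_mul, pair_mul, map_mul, h]
  generalize Uq.comulHom r w = t
  induction t using TensorProduct.induction_on with
  | zero => simp
  | add s t hs ht =>
    simp only [map_add, mul_add, hs, ht]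
    ring
  | tmul s t => simp [add_mul, actR, Oq.of, Oq.form, UDual.form]

lemma actL_E_mul (y z : Oq r) : actL (Uq.gen r .E) (y * z)
    = actL (Uq.gen r .E) y * z + actL (Uq.gen r .k) y * actL (Uq.gen r .E) z := by
  rw [actL_mul_of_comul comul_E, actL_one]

lemma actL_F_mul (y z : Oq r) : actL (Uq.gen r .F) (y * z)
    = actL (Uq.gen r .F) y * actL (Uq.gen r .kinv) z + y * actL (Uq.gen r .F) z := by
  rw [actL_mul_of_comul comul_F, actL_one]

lemma actL_k_mul (y z : Oq r) : actL (Uq.gen r .k) (y * z)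
    = actL (Uq.gen r .k) y * actL (Uq.gen r .k) z := by
  rw [actL_mul_of_comul (a := Uq.gen r .k) (b := Uq.gen r .k) (c := 0) (d := 0)
    (by rw [comul_k]; simp)]
  simp

lemma actL_kinv_mul (y z : Oq r) : actL (Uq.gen r .kinv) (y * z)
    = actL (Uq.gen r .kinv) y * actL (Uq.gen r .kinv) z := by
  rw [actL_mul_of_comul (a := Uq.gen r .kinv) (b := Uq.gen r .kinv) (c := 0) (d := 0)
    (by rw [comul_kinv]; simp)]
  simp

lemma mul_actR_E (y z : Oq r) : actR (y * z) (Uq.gen r .E)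
    = actR y (Uq.gen r .E) * z + actR y (Uq.gen r .k) * actR z (Uq.gen r .E) := by
  rw [mul_actR_of_comul comul_E, actR_one]

lemma mul_actR_F (y z : Oq r) : actR (y * z) (Uq.gen r .F)
    = actR y (Uq.gen r .F) * actR z (Uq.gen r .kinv) + y * actR z (Uq.gen r .F) := by
  rw [mul_actR_of_comul comul_F, actR_one]

lemma mul_actR_k (y z : Oq r) : actR (y * z) (Uq.gen r .k)
    = actR y (Uq.gen r .k) * actR z (Uq.gen r .k) := by
  rw [mul_actR_of_comul (a := Uq.gen r .k) (b := Uq.gen r .k) (c := 0) (d := 0)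
    (by rw [comul_k]; simp)]
  simp

lemma mul_actR_kinv (y z : Oq r) : actR (y * z) (Uq.gen r .kinv)
    = actR y (Uq.gen r .kinv) * actR z (Uq.gen r .kinv) := by
  rw [mul_actR_of_comul (a := Uq.gen r .kinv) (b := Uq.gen r .kinv) (c := 0) (d := 0)
    (by rw [comul_kinv]; simp)]
  simp

lemma actL_k_kinv (y : Oq r) : actL (Uq.gen r .k) (actL (Uq.gen r .kinv) y) = y := by
  rw [← actL_mul, Uq.k_kinv, actL_one]

lemma actL_kinv_k (y : Oq r) : actL (Uq.gen r .kinv) (actL (Uq.gen r .k) y) = y := by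
  rw [← actL_mul, Uq.kinv_k, actL_one]

lemma actL_k_E (y : Oq r) : actL (Uq.gen r .k) (actL (Uq.gen r .E) y)
    = q r ^ 2 • actL (Uq.gen r .E) (actL (Uq.gen r .k) y) := by
  rw [← actL_mul, Uq.k_E, actL_smul_left, actL_mul]

lemma actL_F_k (y : Oq r) : actL (Uq.gen r .F) (actL (Uq.gen r .k) y)
    = q r ^ 2 • actL (Uq.gen r .k) (actL (Uq.gen r .F) y) := by
  rw [← actL_mul, ← Uq.k_F, actL_smul_left, actL_mul]

/-- Evaluation at `1` is the counit of `O_q`, hence multiplicative. -/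
lemma pair_mul_one (y z : Oq r) : pair (y * z) 1 = pair y 1 * pair z 1 := by
  rw [pair_mul, map_one, Algebra.TensorProduct.one_def]
  simp only [TensorProduct.map_tmul, LinearMap.mul'_apply]
  rfl

/-- Evaluation at a group-like element is multiplicative. -/
lemma pair_mul_of_grouplike (y z : Oq r) (x : Uq r) (h : Uq.comulHom r x = x ⊗ₜ x) :
    pair (y * z) x = pair y x * pair z x := by
  rw [pair_mul, h]
  simp only [TensorProduct.map_tmul, LinearMap.mul'_apply]
  rfl

end Actions

/-! ### Weights and local nilpotency -/

section Weights

variable {K : Type u} [Field K] {r : Kˣ}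

/-- The weight space `{y | k ▷ y = q ^ n y}` of `O_q`. -/
def weight (r : Kˣ) (n : ℤ) : Submodule K (Oq r) :=
  Module.End.eigenspace (actLHom r (Uq.gen r .k)) (q r ^ n)

lemma mem_weight {n : ℤ} {y : Oq r} : y ∈ weight r n ↔ actL (Uq.gen r .k) y = q r ^ n • y :=
  Module.End.mem_eigenspace_iff

lemma actL_kinv_of_mem_weight {n : ℤ} {y : Oq r} (h : y ∈ weight r n) :
    actL (Uq.gen r .kinv) y = q r ^ (-n) • y := by
  have h1 : y = q r ^ (-n) • actL (Uq.gen r .k) y := by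
    rw [mem_weight.1 h, smul_smul, zpow_neg, inv_mul_cancel₀ (zpow_ne_zero _ (q_ne_zero r)),
      one_smul]
  conv_lhs => rw [h1]
  rw [actL_smul, actL_kinv_k]

lemma mul_mem_weight {m n : ℤ} {y z : Oq r} (hy : y ∈ weight r m) (hz : z ∈ weight r n) :
    y * z ∈ weight r (m + n) := by
  rw [mem_weight] at *
  rw [actL_k_mul, hy, hz, smul_mul_smul_comm, zpow_add₀ (q_ne_zero r)]

lemma one_mem_weight : (1 : Oq r) ∈ weight r 0 := by
  rw [mem_weight, actL_on_one]; simp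

lemma actL_E_mem_weight {n : ℤ} {y : Oq r} (hy : y ∈ weight r n) :
    actL (Uq.gen r .E) y ∈ weight r (n + 2) := by
  rw [mem_weight] at *
  rw [actL_k_E, hy, actL_smul, smul_smul, zpow_add₀ (q_ne_zero r), zpow_ofNat, mul_comm]

lemma actL_F_mem_weight {n : ℤ} {y : Oq r} (hy : y ∈ weight r n) :
    actL (Uq.gen r .F) y ∈ weight r (n - 2) := by
  rw [mem_weight] at *
  have h := actL_F_k y
  rw [hy, actL_smul] at h
  have hq := q_ne_zero r
  rw [zpow_sub₀ hq, div_eq_inv_mul, mul_smul, h, smul_smul]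
  rw [zpow_ofNat, inv_mul_cancel₀ (pow_ne_zero 2 hq), one_smul]

lemma actL_E_pow_mem_weight {n : ℤ} {y : Oq r} (hy : y ∈ weight r n) (i : ℕ) :
    actL (Uq.gen r .E ^ i) y ∈ weight r (n + 2 * i) := by
  induction i with
  | zero => simpa using hy
  | succ i ih =>
    rw [actL_pow_succ]
    convert actL_E_mem_weight ih using 1
    push_cast; ring_nf

lemma actL_F_pow_mem_weight {n : ℤ} {y : Oq r} (hy : y ∈ weight r n) (i : ℕ) :
    actL (Uq.gen r .F ^ i) y ∈ weight r (n - 2 * i) := by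
  induction i with
  | zero => simpa using hy
  | succ i ih =>
    rw [actL_pow_succ]
    convert actL_F_mem_weight ih using 1
    push_cast; ring_nf

/-- The matrix coefficients `x ↦ ξ (ρ x v)` for a fixed `ξ`, as a map in `v`. -/
def coeffMap {V : Type u} [AddCommGroup V] [Module K V] [FiniteDimensional K V]
    (ρ : Uq r →ₐ[K] Module.End K V) (hρ : IsTypeOne r ρ) (ξ : Module.Dual K V) :
    V →ₗ[K] Oq r where
  toFun v := Oq.of (ξ ∘ₗ (LinearMap.applyₗ v) ∘ₗ ρ.toLinearMap)
    ⟨V, _, _, inferInstance, ρ, hρ, ξ, v, fun _ => rfl⟩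
  map_add' v w := Oq_ext fun x => by
    change ξ (ρ x (v + w)) = ξ (ρ x v) + ξ (ρ x w)
    simp
  map_smul' c v := Oq_ext fun x => by
    change ξ (ρ x (c • v)) = c * ξ (ρ x v)
    simp

lemma actL_coeffMap {V : Type u} [AddCommGroup V] [Module K V] [FiniteDimensional K V]
    (ρ : Uq r →ₐ[K] Module.End K V) (hρ : IsTypeOne r ρ) (ξ : Module.Dual K V) (x : Uq r) (v : V) :
    actL x (coeffMap ρ hρ ξ v) = coeffMap ρ hρ ξ (ρ x v) := Oq_ext fun w => by
  change ξ (ρ (w * x) v) = ξ (ρ w (ρ x v))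
  rw [map_mul]; rfl

/-- The maps `coeffMap ρ hρ ξ` are equivariant, and their images cover `O_q`, so that properties of
the left action can be read off from finite dimensional representations of type 1. -/
lemma exists_coeffMap_eq (y : Oq r) : ∃ (V : Type u) (_ : AddCommGroup V) (_ : Module K V)
    (_ : FiniteDimensional K V) (ρ : Uq r →ₐ[K] Module.End K V) (hρ : IsTypeOne r ρ)
    (ξ : Module.Dual K V) (v : V), coeffMap ρ hρ ξ v = y := by
  obtain ⟨V, _, _, _, ρ, hρ, ξ, v, h⟩ := y.isMatrixCoeff
  exact ⟨V, _, _, inferInstance, ρ, hρ, ξ, v, Oq_ext fun x => (h x).symm⟩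

/-- `O_q` is the sum of its weight spaces. -/
lemma iSup_weight : ⨆ n, weight r n = ⊤ := by
  rw [eq_top_iff]
  intro y _
  obtain ⟨V, _, _, _, ρ, hρ, ξ, v, rfl⟩ := exists_coeffMap_eq y
  have hv : v ∈ ⨆ n : ℤ, Module.End.eigenspace (ρ (Uq.gen r .k)) (q r ^ n) := by
    rw [hρ]; trivial
  have : ⨆ n : ℤ, Module.End.eigenspace (ρ (Uq.gen r .k)) (q r ^ n)
      ≤ (⨆ n, weight r n).comap (coeffMap ρ hρ ξ) := by
    refine iSup_le fun n w hw => Submodule.mem_iSup_of_mem n ?_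
    rw [mem_weight, actL_coeffMap, Module.End.mem_eigenspace_iff.1 hw, map_smul]
  exact this hv

/-- An operator that moves the eigenspaces of `k` along an injective sequence of eigenvalues is
locally nilpotent on a finite dimensional representation of type 1. -/
lemma locally_nilpotent_of_shift (hq : ∀ n : ℕ, 0 < n → q r ^ n ≠ 1)
    {V : Type u} [AddCommGroup V] [Module K V] [FiniteDimensional K V]
    (ρ : Uq r →ₐ[K] Module.End K V) (hρ : IsTypeOne r ρ) (x : Uq r) (s : ℤ) (hs : s ≠ 0)
    (hx : Uq.gen r .k * x = q r ^ s • (x * Uq.gen r .k)) (v : V) :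
    ∃ N, ∀ i, N ≤ i → ρ (x ^ i) v = 0 := by
  have hv : v ∈ ⨆ n : ℤ, Module.End.eigenspace (ρ (Uq.gen r .k)) (q r ^ n) := by
    rw [hρ]; trivial
  induction hv using Submodule.iSup_induction' with
  | zero => exact ⟨0, by simp⟩
  | add v w _ _ hv hw =>
    obtain ⟨N, hN⟩ := hv
    obtain ⟨M, hM⟩ := hw
    refine ⟨max N M, fun i hi => ?_⟩
    rw [map_add, hN i (le_of_max_le_left hi), hM i (le_of_max_le_right hi), add_zero]
  | mem n v hv =>
    have hw : ∀ i : ℕ, ρ (x ^ i) v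
        ∈ Module.End.eigenspace (ρ (Uq.gen r .k)) (q r ^ (n + s * i)) := by
      intro i
      induction i with
      | zero => simpa using hv
      | succ i ih =>
        rw [Module.End.mem_eigenspace_iff] at ih ⊢
        have h1 : ρ (Uq.gen r .k * x) = q r ^ s • (ρ x * ρ (Uq.gen r .k)) := by
          rw [hx, map_smul, map_mul]
        rw [map_mul] at h1
        rw [pow_succ', map_mul, Module.End.mul_apply, ← Module.End.mul_apply, h1,
          LinearMap.smul_apply, Module.End.mul_apply, ih, map_smul, smul_smul,
          ← zpow_add₀ (q_ne_zero r)]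
        congr 2
        push_cast; ring
    have hex : ∃ i : ℕ, ρ (x ^ i) v = 0 := by
      by_contra! hne
      have hinj : Function.Injective fun i : ℕ => q r ^ (n + s * i) := by
        intro i j hij
        have := q_zpow_injective hq hij
        simpa [hs] using this
      have hfin := (ρ (Uq.gen r .k)).finite_hasEigenvalue
      refine Set.infinite_range_of_injective hinj (hfin.subset ?_)
      rintro _ ⟨i, rfl⟩
      exact Module.End.hasEigenvalue_of_hasEigenvector ⟨hw i, hne i⟩
    obtain ⟨N, hN⟩ := hex
    refine ⟨N, fun i hi => ?_⟩
    obtain ⟨j, rfl⟩ := Nat.exists_eq_add_of_le' hi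
    rw [pow_add, map_mul, Module.End.mul_apply, hN, map_zero]

lemma exists_E_pow_eq_zero (hq : ∀ n : ℕ, 0 < n → q r ^ n ≠ 1) (y : Oq r) :
    ∃ N, ∀ i, N ≤ i → actL (Uq.gen r .E ^ i) y = 0 := by
  obtain ⟨V, _, _, _, ρ, hρ, ξ, v, rfl⟩ := exists_coeffMap_eq y
  obtain ⟨N, hN⟩ := locally_nilpotent_of_shift hq ρ hρ (Uq.gen r .E) 2 two_ne_zero
    (by rw [Uq.k_E, zpow_ofNat]) v
  exact ⟨N, fun i hi => by rw [actL_coeffMap, hN i hi, map_zero]⟩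

lemma exists_F_pow_eq_zero (hq : ∀ n : ℕ, 0 < n → q r ^ n ≠ 1) (y : Oq r) :
    ∃ N, ∀ i, N ≤ i → actL (Uq.gen r .F ^ i) y = 0 := by
  obtain ⟨V, _, _, _, ρ, hρ, ξ, v, rfl⟩ := exists_coeffMap_eq y
  obtain ⟨N, hN⟩ := locally_nilpotent_of_shift hq ρ hρ (Uq.gen r .F) (-2) (by norm_num) (by
    have h := Uq.k_F r
    rw [← h, smul_smul, zpow_neg, zpow_ofNat, inv_mul_cancel₀ (pow_ne_zero 2 (q_ne_zero r)),
      one_smul]) v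
  exact ⟨N, fun i hi => by rw [actL_coeffMap, hN i hi, map_zero]⟩

/-- Weight vectors of distinct weights are independent. -/
lemma iSupIndep_weight (hq : ∀ n : ℕ, 0 < n → q r ^ n ≠ 1) : iSupIndep (weight r) :=
  (Module.End.eigenspaces_iSupIndep (actLHom r (Uq.gen r .k))).comp (q_zpow_injective hq)

end Weights

/-! ### The elements `X`, `Y`, `Z` under the left action -/

section VectorRepresentation

variable {K : Type u} [Field K] {r : Kˣ}

lemma uEntry_actL (x : Uq r) (i j : Fin 2) :
    actL x (uEntry r i j) = vecRep r x 0 j • uEntry r i 0 + vecRep r x 1 j • uEntry r i 1 := by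
  ext w
  change vecRep r (w * x) i j = vecRep r x 0 j * vecRep r w i 0 + vecRep r x 1 j * vecRep r w i 1
  rw [map_mul, Matrix.mul_apply, Fin.sum_univ_two]
  ring

lemma vecRep_E : vecRep r (Uq.gen r .E) = !![0, (r : K); 0, 0] := by
  simp [vecRep, Uq.lift_gen, vecGen]

lemma vecRep_F : vecRep r (Uq.gen r .F) = !![0, 0; (r : K)⁻¹, 0] := by
  simp [vecRep, Uq.lift_gen, vecGen]

lemma vecRep_kinv : vecRep r (Uq.gen r .kinv) = !![(q r)⁻¹, 0; 0, q r] := by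
  simp [vecRep, Uq.lift_gen, vecGen]

lemma pair_uEntry (i j : Fin 2) (x : Uq r) : pair (uEntry r i j) x = vecRep r x i j := rfl

lemma X₀_eq : X₀ r = uEntry r 0 0 * uEntry r 0 0 + q r • (uEntry r 1 0 * uEntry r 1 0) := by
  simp [X₀, uJu_eq]

lemma Y₀_eq : Y₀ r = uEntry r 1 1 * uEntry r 1 1 + (q r)⁻¹ • (uEntry r 0 1 * uEntry r 0 1) := by
  simp [Y₀, uJu_eq]
  abel

lemma X₀_mem_weight : X₀ r ∈ weight r 2 := by
  rw [mem_weight, X₀_eq]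
  simp only [actL_add, actL_smul, actL_k_mul, uEntry_actL, vecRep_k, zpow_ofNat]
  simp
  match_scalars <;> ring

lemma Y₀_mem_weight : Y₀ r ∈ weight r (-2) := by
  rw [mem_weight, Y₀_eq]
  simp only [actL_add, actL_smul, actL_k_mul, uEntry_actL, vecRep_k, zpow_neg, zpow_ofNat]
  simp
  match_scalars <;> ring

lemma actL_E_X₀ : actL (Uq.gen r .E) (X₀ r) = 0 := by
  rw [X₀_eq]
  simp only [actL_add, actL_smul, actL_E_mul, uEntry_actL, vecRep_k, vecRep_E]
  simp

lemma actL_F_Y₀ : actL (Uq.gen r .F) (Y₀ r) = 0 := by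
  rw [Y₀_eq]
  simp only [actL_add, actL_smul, actL_F_mul, uEntry_actL, vecRep_kinv, vecRep_F]
  simp

lemma pair_X₀_one : pair (X₀ r) 1 = 1 := by
  rw [X₀_eq]
  simp [pair_mul_one, pair_uEntry]

lemma pair_Y₀_one : pair (Y₀ r) 1 = 1 := by
  rw [Y₀_eq]
  simp [pair_mul_one, pair_uEntry]

lemma pair_Y₀_E : pair (Y₀ r) (Uq.gen r .E) = 0 := by
  rw [pair_eq_actL_one, Y₀_eq]
  simp only [actL_add, actL_smul, actL_E_mul, uEntry_actL, vecRep_k, vecRep_E]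
  simp [pair_mul_one, pair_uEntry]

end VectorRepresentation

section XYZ

variable {K : Type u} [Field K] [Algebra ℂ K] {r : Kˣ}

lemma imag_mul_imag : imag K * imag K = -1 := by
  rw [imag, ← map_mul, Complex.I_mul_I, map_neg, map_one]

lemma imag_ne_zero : imag K ≠ 0 := fun h => by
  have := imag_mul_imag (K := K)
  simp [h] at this

lemma Z₀_eq : Z₀ r
    = imag K • (q r • (uEntry r 1 1 * uEntry r 1 0) + uEntry r 0 1 * uEntry r 0 0) := by
  have hq := q_ne_zero r
  have hi := imag_ne_zero (K := K)
  have h2 : (imag K * (q r)⁻¹)⁻¹ = -(imag K * q r) := by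
    field_simp
    linear_combination (imag_mul_imag (K := K))
  simp only [Z₀, uJu_eq, h2, Matrix.of_apply, Matrix.cons_val_zero, Matrix.cons_val']
  match_scalars <;> field_simp

lemma Z₀_mem_weight : Z₀ r ∈ weight r 0 := by
  have hq := q_ne_zero r
  rw [mem_weight, Z₀_eq]
  simp only [actL_add, actL_smul, actL_k_mul, uEntry_actL, vecRep_k, zpow_zero]
  simp [hq, smul_smul]

lemma actL_E_Z₀ : actL (Uq.gen r .E) (Z₀ r) = (imag K * r) • X₀ r := by
  rw [X₀_eq, Z₀_eq]
  simp only [actL_add, actL_smul, actL_E_mul, uEntry_actL, vecRep_k, vecRep_E]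
  simp
  match_scalars <;> ring

lemma actL_F_Z₀ : actL (Uq.gen r .F) (Z₀ r) = (imag K * r) • Y₀ r := by
  rw [Y₀_eq, Z₀_eq]
  simp only [actL_add, actL_smul, actL_F_mul, uEntry_actL, vecRep_kinv, vecRep_F]
  simp
  match_scalars <;> simp only [q] <;> field_simp

lemma pair_Z₀_one : pair (Z₀ r) 1 = 0 := by
  rw [Z₀_eq]
  simp [pair_mul_one, pair_uEntry]

lemma imag_mul_ne_zero : imag K * (r : K) ≠ 0 := mul_ne_zero imag_ne_zero r.ne_zero

/-! ### The Iwasawa decomposition, dually -/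

lemma mem_OKU {y : Oq r} : y ∈ OKU r ↔ actR y (theta r) = 0 := Iff.rfl

lemma actL_mem_OKU {y : Oq r} (hy : y ∈ OKU r) (x : Uq r) : actL x y ∈ OKU r := by
  rw [mem_OKU] at *
  rw [← actL_actR, hy, actL_zero]

/-- On elements killed by `θ`, evaluation at `F` and at `E` agree up to a power of `q`. -/
lemma pair_F_eq {n : ℤ} {y : Oq r} (hy : y ∈ OKU r) (hn : y ∈ weight r n) :
    pair y (Uq.gen r .F) = q r ^ (-n) * pair y (Uq.gen r .E) := by
  have h1 : pair y (theta r * Uq.gen r .kinv) = 0 := by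
    rw [← pair_actR, mem_OKU.1 hy, pair_zero]
  have h2 : theta r * Uq.gen r .kinv
      = (imag K * (r : K)⁻¹) • (Uq.gen r .E * Uq.gen r .kinv - Uq.gen r .F) := by
    rw [theta, smul_mul_assoc, sub_mul, mul_assoc (Uq.gen r .F), Uq.k_kinv, mul_one]
  have hc : imag K * (r : K)⁻¹ ≠ 0 := mul_ne_zero imag_ne_zero (inv_ne_zero r.ne_zero)
  rw [h2, pair_map_smul, pair_map_sub, ← pair_actL, actL_kinv_of_mem_weight hn, pair_smul] at h1
  exact (sub_eq_zero.1 ((mul_eq_zero.1 h1).resolve_left hc)).symm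

/-- The `q`-integer `[n] = (q ^ n - q ^ (-n)) / (q - q⁻¹)`. -/
def qint (r : Kˣ) (n : ℤ) : K := (q r ^ n - q r ^ (-n)) / (q r - (q r)⁻¹)

omit [Algebra ℂ K]

lemma q_sub_inv_ne_zero (hq : ∀ n : ℕ, 0 < n → q r ^ n ≠ 1) : q r - (q r)⁻¹ ≠ 0 := by
  intro h
  refine hq 2 two_pos ?_
  have h0 := q_ne_zero r
  field_simp at h
  linear_combination h

lemma qint_ne_zero (hq : ∀ n : ℕ, 0 < n → q r ^ n ≠ 1) {n : ℤ} (hn : n ≠ 0) : qint r n ≠ 0 := by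
  refine div_ne_zero ?_ (q_sub_inv_ne_zero hq)
  intro h
  have := q_zpow_injective hq (sub_eq_zero.1 h)
  omega

/-- The relation between `E` and `F`, on a vector of weight `n`. -/
lemma actL_E_F (hq : ∀ n : ℕ, 0 < n → q r ^ n ≠ 1) {n : ℤ} {y : Oq r} (hy : y ∈ weight r n) :
    actL (Uq.gen r .E) (actL (Uq.gen r .F) y)
      = actL (Uq.gen r .F) (actL (Uq.gen r .E) y) + qint r n • y := by
  have h := congrArg (fun x => actL x y) (Uq.E_F r)
  simp only [actL_smul_left, actL_sub_left, actL_mul, mem_weight.1 hy,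
    actL_kinv_of_mem_weight hy] at h
  have h0 := q_sub_inv_ne_zero hq
  rw [← sub_smul] at h
  have h2 := congrArg (fun y => (q r - (q r)⁻¹)⁻¹ • y) h
  simp only [smul_smul, inv_mul_cancel₀ h0, one_smul] at h2
  rw [qint, div_eq_inv_mul, ← h2]
  abel

lemma exists_actL_E_pow_F (hq : ∀ n : ℕ, 0 < n → q r ^ n ≠ 1) {n : ℤ} {y : Oq r}
    (hy : y ∈ weight r n) (i : ℕ) : ∃ c : K,
    actL (Uq.gen r .E ^ (i + 1)) (actL (Uq.gen r .F) y)
      = actL (Uq.gen r .F) (actL (Uq.gen r .E ^ (i + 1)) y) + c • actL (Uq.gen r .E ^ i) y := by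
  induction i with
  | zero => exact ⟨_, by simpa using actL_E_F hq hy⟩
  | succ i ih =>
    obtain ⟨c, hc⟩ := ih
    refine ⟨qint r (n + 2 * (i + 1 : ℕ)) + c, ?_⟩
    rw [actL_pow_succ, hc, actL_add, actL_E_F hq (actL_E_pow_mem_weight hy (i + 1)), actL_smul,
      ← actL_pow_succ, ← actL_pow_succ, add_smul, add_assoc]

lemma exists_actL_F_pow_E (hq : ∀ n : ℕ, 0 < n → q r ^ n ≠ 1) {n : ℤ} {y : Oq r}
    (hy : y ∈ weight r n) (i : ℕ) : ∃ c : K,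
    actL (Uq.gen r .F ^ (i + 1)) (actL (Uq.gen r .E) y)
      = actL (Uq.gen r .E) (actL (Uq.gen r .F ^ (i + 1)) y) + c • actL (Uq.gen r .F ^ i) y := by
  have key : ∀ {n : ℤ} {y : Oq r}, y ∈ weight r n →
      actL (Uq.gen r .F) (actL (Uq.gen r .E) y)
        = actL (Uq.gen r .E) (actL (Uq.gen r .F) y) + (-qint r n) • y := by
    intro n y hy
    rw [actL_E_F hq hy, add_assoc, ← add_smul, add_neg_cancel, zero_smul, add_zero]
  induction i with
  | zero => exact ⟨-qint r n, by rw [zero_add, pow_one, pow_zero, actL_one]; exact key hy⟩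
  | succ i ih =>
    obtain ⟨c, hc⟩ := ih
    refine ⟨-qint r (n - 2 * (i + 1 : ℕ)) + c, ?_⟩
    rw [actL_pow_succ, hc, actL_add, key (actL_F_pow_mem_weight hy (i + 1)), actL_smul,
      ← actL_pow_succ, ← actL_pow_succ, add_smul, add_assoc]

/-- A subalgebra of `U_q(sl₂)` that contains the generators is everything. -/
lemma Uq.mem_of_gen_mem (T : Subalgebra K (Uq r)) (hT : ∀ g, Uq.gen r g ∈ T) (x : Uq r) :
    x ∈ T := by
  let f : Uq r →ₐ[K] T := Uq.lift r (fun g => ⟨Uq.gen r g, hT g⟩)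
    (Subtype.ext (Uq.k_kinv r)) (Subtype.ext (Uq.kinv_k r)) (Subtype.ext (Uq.k_E r))
    (Subtype.ext (Uq.k_F r)) (Subtype.ext (Uq.E_F r))
  have hf : T.val.comp f = AlgHom.id K (Uq r) := Uq.algHom_ext fun g => by
    simp [f, Uq.lift_gen]
  have hx : T.val (f x) = x := congrArg (fun g => g x) hf
  rw [← hx]
  exact (f x).2

/-- A subspace of `O_q` that is stable under the generators and on which the counit vanishes is
zero, since the values of its elements are values at `1` of other elements. -/
lemma eq_bot_of_stable (S : Submodule K (Oq r)) (hS : ∀ g, ∀ y ∈ S, actL (Uq.gen r g) y ∈ S)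
    (h1 : ∀ y ∈ S, pair y 1 = 0) {y : Oq r} (hy : y ∈ S) : y = 0 := by
  let T : Subalgebra K (Uq r) :=
    { carrier := {x | ∀ y ∈ S, actL x y ∈ S}
      mul_mem' := fun ha hb y hy => by rw [actL_mul]; exact ha _ (hb y hy)
      add_mem' := fun ha hb y hy => by rw [actL_add_left]; exact S.add_mem (ha y hy) (hb y hy)
      algebraMap_mem' := fun c y hy => by
        rw [Algebra.algebraMap_eq_smul_one, actL_smul_left, actL_one]; exact S.smul_mem c hy }
  ext x
  rw [pair_eq_actL_one, h1 _ (Uq.mem_of_gen_mem T hS x y hy), pair_zero]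

/-- The graded form of `eq_bot_of_stable`, for a family of subspaces of the weight spaces. -/
lemma eq_zero_of_graded_stable (S : ℤ → Submodule K (Oq r)) (hw : ∀ n, ∀ y ∈ S n, y ∈ weight r n)
    (hE : ∀ n, ∀ y ∈ S n, actL (Uq.gen r .E) y ∈ S (n + 2))
    (hF : ∀ n, ∀ y ∈ S n, actL (Uq.gen r .F) y ∈ S (n - 2))
    (h1 : ∀ n, ∀ y ∈ S n, pair y 1 = 0) {n : ℤ} {y : Oq r} (hy : y ∈ S n) : y = 0 := by
  refine eq_bot_of_stable (⨆ n, S n) (fun g y hy => ?_) (fun y hy => ?_)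
    (Submodule.mem_iSup_of_mem n hy)
  · induction hy using Submodule.iSup_induction' with
    | zero => simp
    | add x y _ _ hx hy => rw [actL_add]; exact add_mem hx hy
    | mem m y hy =>
      cases g with
      | E => exact Submodule.mem_iSup_of_mem _ (hE m y hy)
      | F => exact Submodule.mem_iSup_of_mem _ (hF m y hy)
      | k =>
        rw [mem_weight.1 (hw m y hy)]
        exact Submodule.smul_mem _ _ (Submodule.mem_iSup_of_mem m hy)
      | kinv =>
        rw [actL_kinv_of_mem_weight (hw m y hy)]
        exact Submodule.smul_mem _ _ (Submodule.mem_iSup_of_mem m hy)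
  · induction hy using Submodule.iSup_induction' with
    | zero => simp
    | add x y _ _ hx hy => rw [pair_add, hx, hy, add_zero]
    | mem m y hy => exact h1 m y hy

variable [Algebra ℂ K]

/-- A weight vector of `O_q(K\U)` is determined by its values on the powers of `E`: the dual form
of the decomposition `U_q(sl₂) = U_q(𝔨) K[k, k⁻¹] K[E]`. -/
lemma eq_zero_of_pair_E (hq : ∀ n : ℕ, 0 < n → q r ^ n ≠ 1) {n : ℤ} {y : Oq r}
    (hy : y ∈ OKU r) (hn : y ∈ weight r n) (h : ∀ i, pair y (Uq.gen r .E ^ i) = 0) : y = 0 := by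
  let S : ℤ → Submodule K (Oq r) := fun n =>
    { carrier := {y | y ∈ OKU r ∧ y ∈ weight r n ∧ ∀ i, pair y (Uq.gen r .E ^ i) = 0}
      add_mem' := fun ha hb => ⟨add_mem ha.1 hb.1, add_mem ha.2.1 hb.2.1, fun i => by
        rw [pair_add, ha.2.2, hb.2.2, add_zero]⟩
      zero_mem' := ⟨zero_mem _, zero_mem _, fun _ => rfl⟩
      smul_mem' := fun c y hy => ⟨Subalgebra.smul_mem _ hy.1 c, Submodule.smul_mem _ c hy.2.1,
        fun i => by rw [pair_smul, hy.2.2, mul_zero]⟩ }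
  have hE : ∀ n, ∀ y ∈ S n, actL (Uq.gen r .E) y ∈ S (n + 2) := fun n y hy =>
    ⟨actL_mem_OKU hy.1 _, actL_E_mem_weight hy.2.1, fun i => by
      rw [pair_actL, ← pow_succ, hy.2.2]⟩
  -- Stability under `F`: move `F` to the left of `E ^ i`, where it can be traded for `E`.
  have hF : ∀ n, ∀ y ∈ S n, actL (Uq.gen r .F) y ∈ S (n - 2) := by
    rintro n y ⟨h1, h2, h3⟩
    refine ⟨actL_mem_OKU h1 _, actL_F_mem_weight h2, fun i => ?_⟩
    have key : ∀ i, pair (actL (Uq.gen r .F) (actL (Uq.gen r .E ^ i) y)) 1 = 0 := by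
      intro i
      rw [← pair_eq_actL_one, pair_F_eq (actL_mem_OKU h1 _) (actL_E_pow_mem_weight h2 i),
        pair_actL, ← pow_succ', h3, mul_zero]
    rw [pair_eq_actL_one]
    cases i with
    | zero => simpa using key 0
    | succ i =>
      obtain ⟨c, hc⟩ := exists_actL_E_pow_F hq h2 i
      rw [hc, pair_add, pair_smul, ← pair_eq_actL_one y, h3, key, mul_zero, add_zero]
  exact eq_zero_of_graded_stable S (fun n y hy => hy.2.1) hE hF
    (fun n y hy => by simpa using hy.2.2 0) (n := n) ⟨hy, hn, h⟩

/-- A weight vector of `O_q(K\U)` is determined by its values on the powers of `F`. -/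
lemma eq_zero_of_pair_F (hq : ∀ n : ℕ, 0 < n → q r ^ n ≠ 1) {n : ℤ} {y : Oq r}
    (hy : y ∈ OKU r) (hn : y ∈ weight r n) (h : ∀ i, pair y (Uq.gen r .F ^ i) = 0) : y = 0 := by
  let S : ℤ → Submodule K (Oq r) := fun n =>
    { carrier := {y | y ∈ OKU r ∧ y ∈ weight r n ∧ ∀ i, pair y (Uq.gen r .F ^ i) = 0}
      add_mem' := fun ha hb => ⟨add_mem ha.1 hb.1, add_mem ha.2.1 hb.2.1, fun i => by
        rw [pair_add, ha.2.2, hb.2.2, add_zero]⟩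
      zero_mem' := ⟨zero_mem _, zero_mem _, fun _ => rfl⟩
      smul_mem' := fun c y hy => ⟨Subalgebra.smul_mem _ hy.1 c, Submodule.smul_mem _ c hy.2.1,
        fun i => by rw [pair_smul, hy.2.2, mul_zero]⟩ }
  have hF : ∀ n, ∀ y ∈ S n, actL (Uq.gen r .F) y ∈ S (n - 2) := fun n y hy =>
    ⟨actL_mem_OKU hy.1 _, actL_F_mem_weight hy.2.1, fun i => by
      rw [pair_actL, ← pow_succ, hy.2.2]⟩
  have hE : ∀ n, ∀ y ∈ S n, actL (Uq.gen r .E) y ∈ S (n + 2) := by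
    rintro n y ⟨h1, h2, h3⟩
    refine ⟨actL_mem_OKU h1 _, actL_E_mem_weight h2, fun i => ?_⟩
    have key : ∀ i, pair (actL (Uq.gen r .E) (actL (Uq.gen r .F ^ i) y)) 1 = 0 := by
      intro i
      have h4 := pair_F_eq (actL_mem_OKU h1 (Uq.gen r .F ^ i)) (actL_F_pow_mem_weight h2 i)
      rw [pair_actL, ← pow_succ', h3] at h4
      rw [← pair_eq_actL_one]
      exact (mul_eq_zero.1 h4.symm).resolve_left (zpow_ne_zero _ (q_ne_zero r))
    rw [pair_eq_actL_one]
    cases i with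
    | zero => simpa using key 0
    | succ i =>
      obtain ⟨c, hc⟩ := exists_actL_F_pow_E hq h2 i
      rw [hc, pair_add, pair_smul, ← pair_eq_actL_one y, h3, key, mul_zero, add_zero]
  exact eq_zero_of_graded_stable S (fun n y hy => hy.2.1) hE hF
    (fun n y hy => by simpa using hy.2.2 0) (n := n) ⟨hy, hn, h⟩

end XYZ

/-! ### The structure of `O_q(K\U)` -/

section Structure

variable {K : Type u} [Field K] {r : Kˣ}

/-- The `q²`-integer `1 + q² + ⋯ + q ^ (2 (n - 1))`. -/
def gauss (r : Kˣ) (n : ℕ) : K := ∑ i ∈ Finset.range n, (q r ^ 2) ^ i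

lemma gauss_succ (n : ℕ) : gauss r (n + 1) = q r ^ 2 * gauss r n + 1 := geom_sum_succ

lemma gauss_succ' (n : ℕ) : gauss r (n + 1) = gauss r n + (q r ^ 2) ^ n := by
  rw [gauss, Finset.sum_range_succ]; rfl

lemma gauss_succ_ne_zero (hq : ∀ n : ℕ, 0 < n → q r ^ n ≠ 1) (n : ℕ) : gauss r (n + 1) ≠ 0 := by
  intro h
  have h1 := geom_sum_mul (q r ^ 2) (n + 1)
  rw [show ∑ i ∈ Finset.range (n + 1), (q r ^ 2) ^ i = 0 from h, zero_mul, ← pow_mul] at h1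
  exact hq (2 * (n + 1)) (by positivity) (sub_eq_zero.1 h1.symm)

lemma pair_pow_succ (y : Oq r) (x : Uq r) (i : ℕ) :
    pair y (x ^ (i + 1)) = pair (actL x y) (x ^ i) := by
  rw [pair_actL, pow_succ]

lemma actL_E_pow_mul_X₀ (y : Oq r) (i : ℕ) :
    actL (Uq.gen r .E ^ i) (y * X₀ r) = actL (Uq.gen r .E ^ i) y * X₀ r := by
  induction i with
  | zero => simp
  | succ i ih => rw [actL_pow_succ, ih, actL_E_mul, actL_E_X₀, mul_zero, add_zero, actL_pow_succ]

lemma pair_mul_X₀_E (y : Oq r) (i : ℕ) :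
    pair (y * X₀ r) (Uq.gen r .E ^ i) = pair y (Uq.gen r .E ^ i) := by
  rw [pair_eq_actL_one, actL_E_pow_mul_X₀, pair_mul_one, pair_X₀_one, mul_one, ← pair_eq_actL_one]

lemma actL_E_pow_X₀_mul (y : Oq r) (i : ℕ) :
    actL (Uq.gen r .E ^ i) (X₀ r * y) = (q r ^ 2) ^ i • (X₀ r * actL (Uq.gen r .E ^ i) y) := by
  induction i with
  | zero => simp
  | succ i ih =>
    rw [actL_pow_succ, ih, actL_smul, actL_E_mul, actL_E_X₀, zero_mul, zero_add,
      mem_weight.1 X₀_mem_weight, actL_pow_succ, smul_mul_assoc, smul_smul,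
      zpow_ofNat, ← pow_succ]

lemma pair_X₀_mul_E (y : Oq r) (i : ℕ) :
    pair (X₀ r * y) (Uq.gen r .E ^ i) = (q r ^ 2) ^ i * pair y (Uq.gen r .E ^ i) := by
  rw [pair_eq_actL_one, actL_E_pow_X₀_mul, pair_smul, pair_mul_one, pair_X₀_one, one_mul,
    ← pair_eq_actL_one]

lemma actL_F_pow_mul_Y₀ (y : Oq r) (i : ℕ) :
    actL (Uq.gen r .F ^ i) (y * Y₀ r) = (q r ^ 2) ^ i • (actL (Uq.gen r .F ^ i) y * Y₀ r) := by
  induction i with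
  | zero => simp
  | succ i ih =>
    rw [actL_pow_succ, ih, actL_smul, actL_F_mul, actL_F_Y₀, mul_zero, add_zero,
      actL_kinv_of_mem_weight Y₀_mem_weight, actL_pow_succ, mul_smul_comm, smul_smul,
      neg_neg, zpow_ofNat, ← pow_succ]

lemma pair_mul_Y₀_F (y : Oq r) (i : ℕ) :
    pair (y * Y₀ r) (Uq.gen r .F ^ i) = (q r ^ 2) ^ i * pair y (Uq.gen r .F ^ i) := by
  rw [pair_eq_actL_one, actL_F_pow_mul_Y₀, pair_smul, pair_mul_one, pair_Y₀_one, mul_one,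
    ← pair_eq_actL_one]

/-- `E ▷ F ^ (i + 1) ▷ y = [i + 1] [n - i] F ^ i ▷ y` for a highest weight vector `y` of
weight `n`. -/
lemma actL_E_F_pow (hq : ∀ n : ℕ, 0 < n → q r ^ n ≠ 1) {n : ℤ} {y : Oq r} (hy : y ∈ weight r n)
    (hE : actL (Uq.gen r .E) y = 0) (i : ℕ) :
    actL (Uq.gen r .E) (actL (Uq.gen r .F ^ (i + 1)) y)
      = (qint r (i + 1) * qint r (n - i)) • actL (Uq.gen r .F ^ i) y := by
  have h0 := q_ne_zero r
  have h1 := q_sub_inv_ne_zero hq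
  have h2 : q r ^ 2 - 1 ≠ 0 := fun h => hq 2 two_pos (sub_eq_zero.1 h)
  induction i with
  | zero =>
    have h3 : qint r 1 = 1 := by
      rw [qint, zpow_one, zpow_neg_one, div_self h1]
    rw [actL_pow_succ, pow_zero, actL_one, actL_E_F hq hy, hE]
    simp [h3]
  | succ i ih =>
    rw [actL_pow_succ, actL_E_F hq (actL_F_pow_mem_weight hy (i + 1)), ih, actL_smul,
      ← actL_pow_succ, ← add_smul]
    congr 1
    have hn := zpow_ne_zero n h0
    have hi := pow_ne_zero i h0
    simp only [qint, Nat.cast_add, Nat.cast_one, neg_sub, neg_add, zpow_sub₀ h0, zpow_add₀ h0,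
      zpow_neg, zpow_natCast, mul_comm (2 : ℤ), zpow_mul, zpow_ofNat]
    field_simp
    ring

lemma pow_mem_weight {n : ℤ} {y : Oq r} (hy : y ∈ weight r n) (m : ℕ) :
    y ^ m ∈ weight r (m * n) := by
  induction m with
  | zero => simpa using one_mem_weight
  | succ m ih =>
    rw [pow_succ]
    convert mul_mem_weight ih hy using 1
    push_cast; ring_nf

lemma pair_mul_X₀_pow_E (y : Oq r) (i m : ℕ) :
    pair (y * X₀ r ^ m) (Uq.gen r .E ^ i) = pair y (Uq.gen r .E ^ i) := by
  induction m with
  | zero => simp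
  | succ m ih => rw [pow_succ, ← mul_assoc, pair_mul_X₀_E, ih]

lemma pair_mul_Y₀_pow_F (y : Oq r) (i m : ℕ) :
    pair (y * Y₀ r ^ m) (Uq.gen r .F ^ i)
      = ((q r ^ 2) ^ i) ^ m * pair y (Uq.gen r .F ^ i) := by
  induction m with
  | zero => simp
  | succ m ih => rw [pow_succ, ← mul_assoc, pair_mul_Y₀_F, ih]; ring

lemma qint_two (hq : ∀ n : ℕ, 0 < n → q r ^ n ≠ 1) : qint r 2 = q r + (q r)⁻¹ := by
  have h0 := q_ne_zero r
  rw [qint, div_eq_iff (q_sub_inv_ne_zero hq), zpow_neg, zpow_ofNat]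
  field_simp
  ring

lemma qint_neg (n : ℤ) : qint r (-n) = -qint r n := by
  rw [qint, qint, neg_neg, ← neg_div, neg_sub]

variable [Algebra ℂ K]

lemma actL_E_pow_mul_Z₀ {n : ℤ} {y : Oq r} (hy : y ∈ weight r n) (i : ℕ) :
    actL (Uq.gen r .E ^ (i + 1)) (y * Z₀ r) = actL (Uq.gen r .E ^ (i + 1)) y * Z₀ r
      + (q r ^ n * (imag K * r) * gauss r (i + 1)) • (actL (Uq.gen r .E ^ i) y * X₀ r) := by
  induction i with
  | zero =>
    simp only [zero_add, pow_one, pow_zero, actL_one, actL_E_mul, actL_E_Z₀, mem_weight.1 hy]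
    simp [gauss, smul_smul, mul_comm]
  | succ i ih =>
    rw [actL_pow_succ, ih, actL_add, actL_smul, actL_E_mul, actL_E_mul, actL_E_X₀, actL_E_Z₀,
      mem_weight.1 (actL_E_pow_mem_weight hy (i + 1)), mul_zero, add_zero,
      ← actL_pow_succ, ← actL_pow_succ, smul_mul_smul_comm, add_assoc, ← add_smul,
      gauss_succ' (i + 1)]
    congr 2
    rw [zpow_add₀ (q_ne_zero r), zpow_mul, zpow_natCast, zpow_ofNat]
    ring

/-- Right multiplication by `Z` is a weighted shift on the values at the powers of `E`. -/
lemma pair_mul_Z₀_E {n : ℤ} {y : Oq r} (hy : y ∈ weight r n) (i : ℕ) :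
    pair (y * Z₀ r) (Uq.gen r .E ^ (i + 1))
      = q r ^ n * (imag K * r) * gauss r (i + 1) * pair y (Uq.gen r .E ^ i) := by
  rw [pair_eq_actL_one, actL_E_pow_mul_Z₀ hy, pair_add, pair_smul, pair_mul_one, pair_mul_one,
    pair_X₀_one, pair_Z₀_one, mul_zero, zero_add, mul_one, ← pair_eq_actL_one y]

lemma actL_E_pow_Z₀_mul (y : Oq r) (i : ℕ) :
    actL (Uq.gen r .E ^ (i + 1)) (Z₀ r * y) = Z₀ r * actL (Uq.gen r .E ^ (i + 1)) y
      + ((imag K * r) * gauss r (i + 1)) • (X₀ r * actL (Uq.gen r .E ^ i) y) := by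
  induction i with
  | zero =>
    simp only [zero_add, pow_one, pow_zero, actL_one, actL_E_mul, actL_E_Z₀,
      mem_weight.1 Z₀_mem_weight]
    simp [gauss, add_comm]
  | succ i ih =>
    rw [actL_pow_succ, ih, actL_add, actL_smul, actL_E_mul, actL_E_mul, actL_E_X₀, actL_E_Z₀,
      mem_weight.1 X₀_mem_weight, mem_weight.1 Z₀_mem_weight, zero_mul, zero_add, zpow_zero,
      one_smul, ← actL_pow_succ, ← actL_pow_succ, gauss_succ (i + 1), zpow_ofNat]
    simp only [smul_mul_assoc]
    module

/-- Left multiplication by `Z` is a weighted shift on the values at the powers of `E`. -/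
lemma pair_Z₀_mul_E (y : Oq r) (i : ℕ) :
    pair (Z₀ r * y) (Uq.gen r .E ^ (i + 1))
      = (imag K * r) * gauss r (i + 1) * pair y (Uq.gen r .E ^ i) := by
  rw [pair_eq_actL_one, actL_E_pow_Z₀_mul, pair_add, pair_smul, pair_mul_one, pair_mul_one,
    pair_X₀_one, pair_Z₀_one, zero_mul, zero_add, one_mul, ← pair_eq_actL_one y]

lemma actL_F_pow_mul_Z₀ (y : Oq r) (i : ℕ) :
    actL (Uq.gen r .F ^ (i + 1)) (y * Z₀ r) = actL (Uq.gen r .F ^ (i + 1)) y * Z₀ r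
      + ((imag K * r) * gauss r (i + 1)) • (actL (Uq.gen r .F ^ i) y * Y₀ r) := by
  induction i with
  | zero =>
    simp only [zero_add, pow_one, pow_zero, actL_one, actL_F_mul, actL_F_Z₀,
      actL_kinv_of_mem_weight Z₀_mem_weight]
    simp [gauss]
  | succ i ih =>
    rw [actL_pow_succ, ih, actL_add, actL_smul, actL_F_mul, actL_F_mul, actL_F_Y₀, actL_F_Z₀,
      actL_kinv_of_mem_weight Y₀_mem_weight, actL_kinv_of_mem_weight Z₀_mem_weight, mul_zero,
      add_zero, neg_zero, zpow_zero, one_smul, ← actL_pow_succ, ← actL_pow_succ,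
      gauss_succ (i + 1), neg_neg, zpow_ofNat]
    simp only [mul_smul_comm]
    module

lemma pair_mul_Z₀_F (y : Oq r) (i : ℕ) :
    pair (y * Z₀ r) (Uq.gen r .F ^ (i + 1))
      = (imag K * r) * gauss r (i + 1) * pair y (Uq.gen r .F ^ i) := by
  rw [pair_eq_actL_one, actL_F_pow_mul_Z₀, pair_add, pair_smul, pair_mul_one, pair_mul_one,
    pair_Y₀_one, pair_Z₀_one, mul_zero, zero_add, mul_one, ← pair_eq_actL_one y]

/-- `Z` is normal in `O_q(K\U)`: conjugation by it is the action of `k`. -/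
lemma mul_Z₀_comm (hq : ∀ n : ℕ, 0 < n → q r ^ n ≠ 1) {n : ℤ} {y : Oq r} (hy : y ∈ OKU r)
    (hn : y ∈ weight r n) : y * Z₀ r = q r ^ n • (Z₀ r * y) := by
  rw [← sub_eq_zero]
  have hz := Z₀_mem r
  refine eq_zero_of_pair_E hq (n := n) (sub_mem (mul_mem hy hz)
    (Subalgebra.smul_mem _ (mul_mem hz hy) _)) (sub_mem ?_ (Submodule.smul_mem _ _ ?_)) fun i => ?_
  · simpa using mul_mem_weight hn Z₀_mem_weight
  · simpa using mul_mem_weight Z₀_mem_weight hn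
  · cases i with
    | zero => simp [pair_mul_one, pair_Z₀_one]
    | succ i => rw [pair_sub, pair_smul, pair_mul_Z₀_E hn, pair_Z₀_mul_E]; ring

/-- The values of `Z ^ N` at the powers of `E` form a multiple of the `N`-th unit vector. -/
lemma pair_Z₀_pow_E (hq : ∀ n : ℕ, 0 < n → q r ^ n ≠ 1) (N i : ℕ) :
    pair (Z₀ r ^ N) (Uq.gen r .E ^ i) = 0 ↔ i ≠ N := by
  induction N generalizing i with
  | zero =>
    rw [pow_zero, pair_one, map_pow, counit_E]
    cases i <;> simp
  | succ N ih =>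
    rw [pow_succ']
    cases i with
    | zero => simp [pair_mul_one, pair_Z₀_one]
    | succ i =>
      rw [pair_Z₀_mul_E, mul_eq_zero, ih]
      simp [imag_ne_zero, gauss_succ_ne_zero hq]

lemma pair_Z₀_pow_F (hq : ∀ n : ℕ, 0 < n → q r ^ n ≠ 1) (N i : ℕ) :
    pair (Z₀ r ^ N) (Uq.gen r .F ^ i) = 0 ↔ i ≠ N := by
  induction N generalizing i with
  | zero =>
    rw [pow_zero, pair_one, map_pow, counit_F]
    cases i <;> simp
  | succ N ih =>
    rw [pow_succ]
    cases i with
    | zero => simp [pair_mul_one, pair_Z₀_one]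
    | succ i =>
      rw [pair_mul_Z₀_F, mul_eq_zero, ih]
      simp [imag_ne_zero, gauss_succ_ne_zero hq]

lemma Z₀_pow_mem_weight (m : ℕ) : Z₀ r ^ m ∈ weight r 0 := by
  simpa using pow_mem_weight Z₀_mem_weight m

/-- A weight vector of `O_q(K\U)` lies in a subalgebra as soon as the latter has weight vectors
realizing all the unit vectors as sequences of values at powers of `x`, where `x` is locally
nilpotent and the values determine the vector. -/
lemma mem_of_unit_vectors (B : Subalgebra K (Oq r)) (hB : B ≤ OKU r) (n : ℤ) (x : Uq r)
    (hx : ∀ y ∈ OKU r, y ∈ weight r n → (∀ i, pair y (x ^ i) = 0) → y = 0)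
    (w : ℕ → Oq r) (hwB : ∀ N, w N ∈ B) (hwn : ∀ N, w N ∈ weight r n)
    (hw : ∀ N i, pair (w N) (x ^ i) = 0 ↔ i ≠ N) (N : ℕ) (y : Oq r) (hy : y ∈ OKU r)
    (hn : y ∈ weight r n) (hN : ∀ i, N ≤ i → pair y (x ^ i) = 0) : y ∈ B := by
  induction N generalizing y with
  | zero => rw [hx y hy hn fun i => hN i i.zero_le]; exact zero_mem _
  | succ N ih =>
    have hne : pair (w N) (x ^ N) ≠ 0 := fun h => (hw N N).1 h rfl
    set c := pair y (x ^ N) / pair (w N) (x ^ N) with hc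
    have h := ih (y - c • w N) (sub_mem hy (Subalgebra.smul_mem _ (hB (hwB N)) c))
      (sub_mem hn (Submodule.smul_mem _ c (hwn N))) fun i hi => by
        rcases hi.eq_or_lt with rfl | hi
        · rw [pair_sub, pair_smul, hc, div_mul_cancel₀ _ hne, sub_self]
        · rw [pair_sub, pair_smul, hN i hi, (hw N i).2 hi.ne', mul_zero, sub_zero]
    have := add_mem h (Subalgebra.smul_mem _ (hwB N) c)
    rwa [sub_add_cancel] at this

/-- There are no weight vectors of odd weight in `O_q(K\U)`: for a highest weight vector `y` the
values at `F ^ (2 j)` obey a two-step recursion which does not terminate. -/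
lemma eq_zero_of_odd_weight (hq : ∀ n : ℕ, 0 < n → q r ^ n ≠ 1) {n : ℤ} (hodd : Odd n) {y : Oq r}
    (hy : y ∈ OKU r) (hn : y ∈ weight r n) : y = 0 := by
  by_contra hne
  -- `E ^ M ▷ y` is a highest weight vector.
  obtain ⟨M, hM0, hM1⟩ : ∃ M, actL (Uq.gen r .E ^ M) y ≠ 0 ∧
      actL (Uq.gen r .E ^ (M + 1)) y = 0 := by
    by_contra! h
    obtain ⟨N, hN⟩ := exists_E_pow_eq_zero hq y
    have : ∀ M, actL (Uq.gen r .E ^ M) y ≠ 0 := fun M => by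
      induction M with
      | zero => simpa using hne
      | succ M ih => exact h M ih
    exact this N (hN N le_rfl)
  rw [actL_pow_succ] at hM1
  have hA := actL_mem_OKU hy (Uq.gen r .E ^ M)
  have hw := actL_E_pow_mem_weight hn M
  have hodd' : Odd (n + 2 * M) := hodd.add_even (even_two_mul _)
  generalize actL (Uq.gen r .E ^ M) y = v at *
  generalize n + 2 * M = m at *
  have hv1 : pair v 1 ≠ 0 := fun h => hM0 <| eq_zero_of_pair_E hq hA hw fun i => by
    cases i with
    | zero => simpa using h
    | succ i => rw [pair_pow_succ, hM1, pair_zero]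
  have hrec : ∀ j, pair v (Uq.gen r .F ^ (2 * j)) ≠ 0 := fun j => by
    induction j with
    | zero => simpa using hv1
    | succ j ih =>
      rw [show 2 * (j + 1) = (2 * j + 1) + 1 by ring, pow_succ', ← pair_actL,
        pair_F_eq (actL_mem_OKU hA _) (actL_F_pow_mem_weight hw _), pair_eq_actL_one,
        actL_E_F_pow hq hw hM1, pair_smul, ← pair_eq_actL_one]
      refine mul_ne_zero (zpow_ne_zero _ (q_ne_zero r)) (mul_ne_zero (mul_ne_zero ?_ ?_) ih)
      · exact qint_ne_zero hq (by omega)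
      · refine qint_ne_zero hq fun h => ?_
        rw [sub_eq_zero.1 h] at hodd'
        exact (Int.not_odd_iff_even.2 ⟨(j : ℤ), by push_cast; ring⟩) hodd'
  obtain ⟨N, hN⟩ := exists_F_pow_eq_zero hq v
  refine hrec N ?_
  rw [pair_eq_actL_one, hN (2 * N) (by omega), pair_zero]

/-- `O_q(K\U)` is the sum of its weight spaces. -/
lemma exists_weight_decomposition (hq : ∀ n : ℕ, 0 < n → q r ^ n ≠ 1) {y : Oq r} (hy : y ∈ OKU r) :
    ∃ f : ℤ →₀ Oq r, (∀ n ∈ f.support, f n ∈ OKU r) ∧ (∀ n, f n ∈ weight r n) ∧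
      ∑ n ∈ f.support, f n = y := by
  have htop : y ∈ ⨆ n, weight r n := by rw [iSup_weight]; trivial
  obtain ⟨f, hf, rfl⟩ := (Submodule.mem_iSup_iff_exists_finsupp _ _).1 htop
  refine ⟨f, ?_, hf, rfl⟩
  refine (iSupIndep_iff_finsetSum_eq_zero_imp_eq_zero _).1 (iSupIndep_weight hq) f.support
    (fun n => actR (f n) (theta r)) (fun n _ => ?_) ?_
  · rw [mem_weight, actL_actR, mem_weight.1 (hf n), actR_smul]
  · have h := mem_OKU.1 hy
    rw [← actRLin_apply, Finsupp.sum, map_sum] at h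
    exact h

/-- A property of elements of `O_q(K\U)` that is additive has to be checked on weight
vectors only. -/
lemma OKU_induction (hq : ∀ n : ℕ, 0 < n → q r ^ n ≠ 1) {P : Oq r → Prop} (h0 : P 0)
    (hadd : ∀ y z, P y → P z → P (y + z))
    (hw : ∀ n : ℤ, ∀ y ∈ OKU r, y ∈ weight r n → P y) {y : Oq r} (hy : y ∈ OKU r) : P y := by
  obtain ⟨f, hfA, hf, rfl⟩ := exists_weight_decomposition hq hy
  exact Finset.sum_induction f P hadd h0 fun n hn => hw n _ (hfA n hn) (hf n)

/-- `O_q(K\U)` is generated by `X`, `Y` and `Z`. -/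
lemma OKU_le_adjoin (hq : ∀ n : ℕ, 0 < n → q r ^ n ≠ 1) :
    OKU r ≤ Algebra.adjoin K {X₀ r, Y₀ r, Z₀ r} := by
  set B := Algebra.adjoin K {X₀ r, Y₀ r, Z₀ r} with hB
  have hX : X₀ r ∈ B := Algebra.subset_adjoin (by simp)
  have hY : Y₀ r ∈ B := Algebra.subset_adjoin (by simp)
  have hZ : Z₀ r ∈ B := Algebra.subset_adjoin (by simp)
  have hBA : B ≤ OKU r := Algebra.adjoin_le (by
    rintro _ (rfl | rfl | rfl)
    exacts [X₀_mem r, Y₀_mem r, Z₀_mem r])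
  intro y hy
  refine OKU_induction hq (P := (· ∈ B)) (zero_mem _) (fun _ _ => add_mem) (fun n y hy hn => ?_) hy
  -- In the weights `2 m ≥ 0` use `Z ^ N X ^ m` and the powers of `E`, in the weights `2 m ≤ 0` use
  -- `Z ^ N Y ^ (-m)` and the powers of `F`.
  rcases Int.even_or_odd' n with ⟨m, rfl | rfl⟩
  · rcases Int.le_total 0 m with hm | hm
    · obtain ⟨m, rfl⟩ := Int.eq_ofNat_of_zero_le hm
      obtain ⟨N, hN⟩ := exists_E_pow_eq_zero hq y
      refine mem_of_unit_vectors B hBA _ (Uq.gen r .E) (fun y => eq_zero_of_pair_E hq)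
        (fun N => Z₀ r ^ N * X₀ r ^ m) (fun N => mul_mem (pow_mem hZ N) (pow_mem hX m))
        (fun N => ?_) (fun N i => ?_) N y hy hn fun i hi => ?_
      · convert mul_mem_weight (Z₀_pow_mem_weight N) (pow_mem_weight X₀_mem_weight m) using 1
        ring_nf
      · rw [pair_mul_X₀_pow_E, pair_Z₀_pow_E hq]
      · rw [pair_eq_actL_one, hN i hi, pair_zero]
    · obtain ⟨m, rfl⟩ := Int.exists_eq_neg_ofNat hm
      obtain ⟨N, hN⟩ := exists_F_pow_eq_zero hq y
      refine mem_of_unit_vectors B hBA _ (Uq.gen r .F) (fun y => eq_zero_of_pair_F hq)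
        (fun N => Z₀ r ^ N * Y₀ r ^ m) (fun N => mul_mem (pow_mem hZ N) (pow_mem hY m))
        (fun N => ?_) (fun N i => ?_) N y hy hn fun i hi => ?_
      · convert mul_mem_weight (Z₀_pow_mem_weight N) (pow_mem_weight Y₀_mem_weight m) using 1
        ring_nf
      · rw [pair_mul_Y₀_pow_F, mul_eq_zero, pair_Z₀_pow_F hq]
        simp [q_ne_zero]
      · rw [pair_eq_actL_one, hN i hi, pair_zero]
  · rw [eq_zero_of_odd_weight hq ⟨m, rfl⟩ hy hn]
    exact zero_mem _

/-- `Z` is not a zero divisor in `O_q(K\U)`. -/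
lemma eq_zero_of_Z₀_mul (hq : ∀ n : ℕ, 0 < n → q r ^ n ≠ 1) {y : Oq r} (hy : y ∈ OKU r)
    (h : Z₀ r * y = 0) : y = 0 := by
  obtain ⟨f, hfA, hf, rfl⟩ := exists_weight_decomposition hq hy
  rw [Finset.mul_sum] at h
  have h0 := (iSupIndep_iff_finsetSum_eq_zero_imp_eq_zero _).1 (iSupIndep_weight hq) f.support
    (fun n => Z₀ r * f n) (fun n _ => by simpa using mul_mem_weight Z₀_mem_weight (hf n)) h
  refine Finset.sum_eq_zero fun n hn => eq_zero_of_pair_E hq (hfA n hn) (hf n) fun i => ?_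
  have h1 := pair_Z₀_mul_E (f n) i
  rw [h0 n hn, pair_zero] at h1
  exact (mul_eq_zero.1 h1.symm).resolve_left
    (mul_ne_zero imag_mul_ne_zero (gauss_succ_ne_zero hq i))

/-- The elements of `O_q(K\U)` that commute with `Z`, and commute with `X` up to the same scalar
as `Z ^ n` does, are the multiples of `Z ^ n`. -/
lemma eq_smul_Z₀_pow (hq : ∀ n : ℕ, 0 < n → q r ^ n ≠ 1) (n : ℕ) {a : Oq r} (ha : a ∈ OKU r)
    (hZ : a * Z₀ r = Z₀ r * a) (hX : a * X₀ r = ((q r ^ 2)⁻¹ ^ n) • (X₀ r * a)) :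
    ∃ c : K, a = c • Z₀ r ^ n := by
  have hmul : a * Z₀ r = Z₀ r * actL (Uq.gen r .k) a :=
    OKU_induction hq (P := fun a => a * Z₀ r = Z₀ r * actL (Uq.gen r .k) a) (by simp)
      (fun y z hy hz => by rw [add_mul, hy, hz, actL_add, mul_add])
      (fun n y hy hn => by rw [mul_Z₀_comm hq hy hn, mem_weight.1 hn, mul_smul_comm]) ha
  have h0 : a ∈ weight r 0 := by
    rw [mem_weight, zpow_zero, one_smul, ← sub_eq_zero]
    refine eq_zero_of_Z₀_mul hq (sub_mem (actL_mem_OKU ha _) ha) ?_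
    rw [mul_sub, ← hmul, hZ, sub_self]
  -- On the value at `E ^ i`, left multiplication by `X` is right multiplication by `X` times
  -- `q ^ (2 i)`.
  have hpair : ∀ i, i ≠ n → pair a (Uq.gen r .E ^ i) = 0 := fun i hi => by
    have h1 := congrArg (fun y => pair y (Uq.gen r .E ^ i)) hX
    simp only [pair_smul, pair_mul_X₀_E, pair_X₀_mul_E] at h1
    have h2 : (q r ^ 2)⁻¹ ^ n * (q r ^ 2) ^ i ≠ 1 := fun h => by
      rw [inv_pow, inv_mul_eq_one₀ (pow_ne_zero _ (pow_ne_zero _ (q_ne_zero r))), ← pow_mul,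
        ← pow_mul, ← zpow_natCast, ← zpow_natCast] at h
      have := q_zpow_injective hq h
      omega
    have h3 : ((q r ^ 2)⁻¹ ^ n * (q r ^ 2) ^ i - 1) * pair a (Uq.gen r .E ^ i) = 0 := by
      linear_combination -h1
    exact (mul_eq_zero.1 h3).resolve_left (sub_ne_zero.2 h2)
  refine ⟨pair a (Uq.gen r .E ^ n) / pair (Z₀ r ^ n) (Uq.gen r .E ^ n), ?_⟩
  rw [← sub_eq_zero]
  refine eq_zero_of_pair_E hq (sub_mem ha (Subalgebra.smul_mem _ (pow_mem (Z₀_mem r) n) _))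
    (sub_mem h0 (Submodule.smul_mem _ _ (Z₀_pow_mem_weight n))) fun i => ?_
  rw [pair_sub, pair_smul]
  by_cases hi : i = n
  · subst hi
    rw [div_mul_cancel₀ _ fun h => (pair_Z₀_pow_E hq i i).1 h rfl, sub_self]
  · rw [hpair i hi, (pair_Z₀_pow_E hq n i).2 hi, mul_zero, sub_zero]

/-- `E ▷ Y` is compared with a multiple of `Z` through their values at the powers of `F`. -/
lemma actL_E_Y₀ (hq : ∀ n : ℕ, 0 < n → q r ^ n ≠ 1) :
    actL (Uq.gen r .E) (Y₀ r) = (-(imag K * (r : K)⁻¹) * (q r + (q r)⁻¹)) • Z₀ r := by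
  rw [← sub_eq_zero]
  have hr := r.ne_zero
  refine eq_zero_of_pair_F hq (n := 0) (sub_mem (actL_mem_OKU (Y₀_mem r) _)
    (Subalgebra.smul_mem _ (Z₀_mem r) _))
    (sub_mem (by simpa using actL_E_mem_weight Y₀_mem_weight)
      (Submodule.smul_mem _ _ Z₀_mem_weight)) fun i => ?_
  cases i with
  | zero => simp [pair_Z₀_one, pair_Y₀_E]
  | succ i =>
    have h1 := actL_E_F hq (Y₀_mem_weight (r := r))
    rw [actL_F_Y₀, actL_zero, qint_neg, qint_two hq, neg_smul, eq_comm, add_neg_eq_zero] at h1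
    rw [pair_pow_succ, actL_sub, actL_smul, actL_F_Z₀, h1, smul_smul, ← sub_smul]
    have h2 : q r + (q r)⁻¹
        - -(imag K * (r : K)⁻¹) * (q r + (q r)⁻¹) * (imag K * r) = 0 := by
      have hq0 := q_ne_zero r
      field_simp
      linear_combination (q r ^ 2 + 1) * imag_mul_imag (K := K)
    rw [h2, zero_smul, pair_zero]

/-- `F ▷ X` is compared with a multiple of `Z` through their values at the powers of `E`. -/
lemma actL_F_X₀ (hq : ∀ n : ℕ, 0 < n → q r ^ n ≠ 1) :
    actL (Uq.gen r .F) (X₀ r) = (-(imag K * (r : K)⁻¹) * (q r + (q r)⁻¹)) • Z₀ r := by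
  rw [← sub_eq_zero]
  have hr := r.ne_zero
  refine eq_zero_of_pair_E hq (n := 0) (sub_mem (actL_mem_OKU (X₀_mem r) _)
    (Subalgebra.smul_mem _ (Z₀_mem r) _))
    (sub_mem (by simpa using actL_F_mem_weight X₀_mem_weight)
      (Submodule.smul_mem _ _ Z₀_mem_weight)) fun i => ?_
  cases i with
  | zero =>
    rw [pow_zero, pair_sub, pair_smul, pair_Z₀_one, mul_zero, sub_zero, pair_actL, one_mul,
      pair_F_eq (X₀_mem r) X₀_mem_weight, pair_eq_actL_one, actL_E_X₀, pair_zero, mul_zero]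
  | succ i =>
    rw [pair_pow_succ, actL_sub, actL_smul, actL_E_Z₀, actL_E_F hq X₀_mem_weight, actL_E_X₀,
      actL_zero, zero_add, qint_two hq, smul_smul, ← sub_smul]
    have h2 : q r + (q r)⁻¹
        - -(imag K * (r : K)⁻¹) * (q r + (q r)⁻¹) * (imag K * r) = 0 := by
      have hq0 := q_ne_zero r
      field_simp
      linear_combination (q r ^ 2 + 1) * imag_mul_imag (K := K)
    rw [h2, zero_smul, pair_zero]

/-- The commutator of `X` and `Y`, obtained by applying `E ▷` to `Y Z = q⁻² Z Y`. -/
lemma Y₀_mul_X₀_sub (hq : ∀ n : ℕ, 0 < n → q r ^ n ≠ 1) :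
    Y₀ r * X₀ r - X₀ r * Y₀ r = (q r ^ 2 - (q r ^ 2)⁻¹) • (Z₀ r * Z₀ r) := by
  have hr := r.ne_zero
  have hi := imag_ne_zero (K := K)
  have h := congrArg (actL (Uq.gen r .E)) (mul_Z₀_comm hq (Y₀_mem r) Y₀_mem_weight)
  rw [actL_smul, actL_E_mul, actL_E_mul, actL_E_Z₀, actL_E_Y₀ hq, mem_weight.1 Z₀_mem_weight,
    mem_weight.1 Y₀_mem_weight, zpow_zero, one_smul, zpow_neg, zpow_ofNat] at h
  simp only [smul_mul_assoc, mul_smul_comm, smul_add, smul_smul] at h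
  have h2 : ((q r ^ 2)⁻¹ * (imag K * r)) • (Y₀ r * X₀ r - X₀ r * Y₀ r)
      = ((q r ^ 2)⁻¹ * (imag K * r)) • ((q r ^ 2 - (q r ^ 2)⁻¹) • (Z₀ r * Z₀ r)) := by
    have e1 : (q r ^ 2)⁻¹ * (imag K * r) * (q r ^ 2 - (q r ^ 2)⁻¹)
        = ((q r ^ 2)⁻¹ - 1) * (-(imag K * (r : K)⁻¹) * (q r + (q r)⁻¹)) := by
      simp only [q]
      field_simp
      ring
    rw [smul_smul, e1, smul_sub, ← sub_eq_zero, ← sub_eq_zero.2 h]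
    module
  exact smul_right_injective _ (mul_ne_zero (inv_ne_zero (pow_ne_zero 2 (q_ne_zero r)))
    imag_mul_ne_zero) h2

lemma actL_theta (y : Oq r) : actL (theta r) y = (imag K * (r : K)⁻¹) •
    (actL (Uq.gen r .E) y - actL (Uq.gen r .F) (actL (Uq.gen r .k) y)) := by
  rw [theta, actL_smul_left, actL_sub_left, actL_mul]

lemma actL_theta_X₀ (hq : ∀ n : ℕ, 0 < n → q r ^ n ≠ 1) :
    actL (theta r) (X₀ r) = (-(1 + q r ^ 2)) • Z₀ r := by
  have hr := r.ne_zero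
  rw [actL_theta, actL_E_X₀, mem_weight.1 X₀_mem_weight, actL_smul, actL_F_X₀ hq, zero_sub,
    smul_neg, smul_smul, smul_smul, ← neg_smul]
  congr 1
  rw [zpow_ofNat]
  simp only [q]
  field_simp
  linear_combination (1 + (r : K) ^ 4) * imag_mul_imag (K := K)

lemma actL_theta_Y₀ (hq : ∀ n : ℕ, 0 < n → q r ^ n ≠ 1) :
    actL (theta r) (Y₀ r) = (1 + (q r ^ 2)⁻¹) • Z₀ r := by
  have hr := r.ne_zero
  rw [actL_theta, actL_E_Y₀ hq, mem_weight.1 Y₀_mem_weight, actL_smul, actL_F_Y₀, smul_zero,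
    sub_zero, smul_smul]
  congr 1
  simp only [q]
  field_simp
  linear_combination (-(1 + (r : K) ^ 4)) * imag_mul_imag (K := K)

lemma actL_theta_Z₀ : actL (theta r) (Z₀ r) = Y₀ r - X₀ r := by
  have hr := r.ne_zero
  have h : imag K * (r : K)⁻¹ * (imag K * r) = -1 := by
    field_simp
    linear_combination imag_mul_imag (K := K)
  rw [actL_theta, actL_E_Z₀, mem_weight.1 Z₀_mem_weight, zpow_zero, one_smul, actL_F_Z₀,
    ← smul_sub, smul_smul, h, neg_one_smul, neg_sub]

end Structure

/-! ### Representations of the Drinfeld double -/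

section Double

variable {K : Type u} [Field K] {r : Kˣ}

section Exchange

variable {B : Type*} [Ring B] [Algebra K B] (f : Uq r →ₐ[K] B) (g : Oq r →ₐ[K] B)

/-- The linear map `a ⊗ b ↦ f a * g (y ◁ b)`: one side of the exchange relation. -/
def exchL (y : Oq r) : Uq r ⊗[K] Uq r →ₗ[K] B :=
  TensorProduct.lift ((LinearMap.mul K B).compl₁₂ f.toLinearMap
    (g.toLinearMap ∘ₗ (actRLin r).flip y))

/-- The linear map `a ⊗ b ↦ g (a ▷ y) * f b`: the other side of the exchange relation. -/
def exchR (y : Oq r) : Uq r ⊗[K] Uq r →ₗ[K] B :=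
  TensorProduct.lift ((LinearMap.mul K B).compl₁₂
    (g.toLinearMap ∘ₗ (actLHom r).toLinearMap.flip y) f.toLinearMap)

@[simp] lemma exchL_tmul (y : Oq r) (a b : Uq r) :
    exchL f g y (a ⊗ₜ b) = f a * g (actR y b) := rfl

@[simp] lemma exchR_tmul (y : Oq r) (a b : Uq r) :
    exchR f g y (a ⊗ₜ b) = g (actL a y) * f b := rfl

lemma exchL_tmul_mul (y : Oq r) (a b : Uq r) (t : Uq r ⊗[K] Uq r) :
    exchL f g y (a ⊗ₜ b * t) = f a * exchL f g (actR y b) t := by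
  induction t using TensorProduct.induction_on with
  | zero => simp
  | add s t hs ht => rw [mul_add, map_add, map_add, hs, ht, mul_add]
  | tmul s t => simp [actR_mul, mul_assoc]

lemma exchR_mul_tmul (y : Oq r) (a b : Uq r) (t : Uq r ⊗[K] Uq r) :
    exchR f g y (t * a ⊗ₜ b) = exchR f g (actL a y) t * f b := by
  induction t using TensorProduct.induction_on with
  | zero => simp
  | add s t hs ht => rw [add_mul, map_add, map_add, hs, ht, add_mul]
  | tmul s t => simp [actL_mul, mul_assoc]

/-- The exchange relation is inherited by products: both sides for `s * t` equal
`∑ f (s₁) * g (t₁ ▷ y ◁ s₂) * f (t₂)`. -/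
lemma exch_mul {s t : Uq r ⊗[K] Uq r} (hs : ∀ y, exchL f g y s = exchR f g y s)
    (ht : ∀ y, exchL f g y t = exchR f g y t) (y : Oq r) :
    exchL f g y (s * t) = exchR f g y (s * t) := by
  obtain ⟨S, hS⟩ := TensorProduct.exists_finset s
  obtain ⟨T, hT⟩ := TensorProduct.exists_finset t
  have h1 : exchL f g y (s * t)
      = ∑ i ∈ S, ∑ j ∈ T, f i.1 * (g (actR (actL j.1 y) i.2) * f j.2) := by
    conv_lhs => rw [hS, Finset.sum_mul, map_sum]
    refine Finset.sum_congr rfl fun i _ => ?_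
    rw [exchL_tmul_mul, ht, hT, map_sum, Finset.mul_sum]
    simp [actL_actR]
  have h2 : exchR f g y (s * t)
      = ∑ j ∈ T, ∑ i ∈ S, f i.1 * (g (actR (actL j.1 y) i.2) * f j.2) := by
    conv_lhs => rw [hT, Finset.mul_sum, map_sum]
    refine Finset.sum_congr rfl fun j _ => ?_
    rw [exchR_mul_tmul, ← hs, hS, map_sum, Finset.sum_mul]
    simp [mul_assoc]
  rw [h1, h2, Finset.sum_comm]

/-- It suffices to check the exchange relation on the generators of `U_q(sl₂)`. -/
lemma exch_of_gen (h : ∀ x y, exchL f g y (Uq.comulHom r (Uq.gen r x))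
      = exchR f g y (Uq.comulHom r (Uq.gen r x))) (x : Uq r) (y : Oq r) :
    exchL f g y (Uq.comulHom r x) = exchR f g y (Uq.comulHom r x) := by
  let T : Subalgebra K (Uq r) :=
    { carrier := {x | ∀ y, exchL f g y (Uq.comulHom r x) = exchR f g y (Uq.comulHom r x)}
      mul_mem' := fun ha hb y => by rw [map_mul]; exact exch_mul f g ha hb y
      add_mem' := fun ha hb y => by rw [map_add, map_add, map_add, ha, hb]
      algebraMap_mem' := fun c y => by
        rw [AlgHom.commutes, Algebra.algebraMap_eq_smul_one, map_smul, map_smul,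
          Algebra.TensorProduct.one_def]
        simp }
  exact Uq.mem_of_gen_mem T h x y

/-- The universal property of the Drinfeld double, with the exchange relation imposed on the
generators of `U_q(sl₂)` only. -/
def Double.lift (h : ∀ x y, exchL f g y (Uq.comulHom r (Uq.gen r x))
    = exchR f g y (Uq.comulHom r (Uq.gen r x))) : Double r →ₐ[K] B :=
  RingQuot.liftAlgHom K ⟨FreeAlgebra.lift K (Sum.elim f g), by
    intro a b hab
    cases hab with
    | exchange x y s =>
      have hs : Uq.comulHom r x = ∑ n ∈ s.index, s.left n ⊗ₜ[K] s.right n := s.eq.symm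
      have h' := exch_of_gen f g h x y
      rw [hs, map_sum, map_sum] at h'
      simpa using h'
    | _ => simp⟩

lemma Double.lift_ofU (h) (x : Uq r) : Double.lift f g h (Double.ofU r x) = f x := by
  change Double.lift f g h (Double.mk r (frU x)) = f x
  unfold Double.lift Double.mk
  erw [RingQuot.liftAlgHom_mkAlgHom_apply]
  simp

lemma Double.lift_ofO (h) (y : Oq r) : Double.lift f g h (Double.ofO r y) = g y := by
  change Double.lift f g h (Double.mk r (frO y)) = g y
  unfold Double.lift Double.mk
  erw [RingQuot.liftAlgHom_mkAlgHom_apply]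
  simp

end Exchange

/-- The exchange relation for an element whose coproduct has two terms. -/
lemma Double.exchange_of_comul {x a b c d : Uq r} (h : Uq.comulHom r x = a ⊗ₜ b + c ⊗ₜ d)
    (y : Oq r) :
    Double.ofU r a * Double.ofO r (actR y b) + Double.ofU r c * Double.ofO r (actR y d)
      = Double.ofO r (actL a y) * Double.ofU r b + Double.ofO r (actL c y) * Double.ofU r d := by
  let s : Coalgebra.Repr K x ℕ :=
    { index := {0, 1}
      left := fun n => if n = 0 then a else c
      right := fun n => if n = 0 then b else d
      eq := by
        rw [Uq.comul_apply, h, Finset.sum_pair zero_ne_one]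
        simp }
  have := Double.mk_rel (DoubleRel.exchange x y s)
  simp only [s, Finset.sum_pair (zero_ne_one (α := ℕ)), map_add, map_mul, if_true, one_ne_zero,
    if_false] at this
  exact this

/-! ### A representation of the double with independent powers of `θ` -/

lemma Uq.k_F_E : Uq.gen r .k * (Uq.gen r .F * Uq.gen r .E)
    = Uq.gen r .F * Uq.gen r .E * Uq.gen r .k := by
  refine smul_right_injective _ (pow_ne_zero 2 (q_ne_zero r)) ?_
  change q r ^ 2 • _ = q r ^ 2 • _
  rw [← mul_assoc, ← smul_mul_assoc, Uq.k_F, mul_assoc, Uq.k_E, mul_smul_comm, mul_assoc]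

/-- The inverse of the antipode. -/
def antipodeInv (r : Kˣ) : Uq r →ₐ[K] (Uq r)ᵐᵒᵖ :=
  Uq.lift r (fun
    | .E => MulOpposite.op (-(Uq.gen r .E * Uq.gen r .kinv))
    | .F => MulOpposite.op (-(Uq.gen r .k * Uq.gen r .F))
    | .k => MulOpposite.op (Uq.gen r .kinv)
    | .kinv => MulOpposite.op (Uq.gen r .k))
    (by rw [← MulOpposite.op_mul, Uq.k_kinv]; rfl)
    (by rw [← MulOpposite.op_mul, Uq.kinv_k]; rfl)
    (by
      rw [← MulOpposite.op_mul, ← MulOpposite.op_mul, ← MulOpposite.op_smul, Uq.E_kinv]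
      simp only [neg_mul, mul_neg, smul_mul_assoc, mul_smul_comm, smul_neg, Uq.E_kinv, mul_assoc])
    (by
      rw [← MulOpposite.op_mul, ← MulOpposite.op_mul, ← MulOpposite.op_smul]
      congr 1
      rw [neg_mul, mul_neg, smul_neg, ← mul_assoc (Uq.gen r .kinv), Uq.kinv_k, one_mul,
        ← smul_mul_assoc, Uq.k_F, mul_assoc, Uq.k_kinv, mul_one])
    (by
      rw [← MulOpposite.op_mul, ← MulOpposite.op_mul, ← MulOpposite.op_sub, ← MulOpposite.op_sub,
        ← MulOpposite.op_smul]
      congr 1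
      have h1 : Uq.gen r .k * Uq.gen r .F * (Uq.gen r .E * Uq.gen r .kinv)
          = Uq.gen r .F * Uq.gen r .E := by
        rw [← mul_assoc, mul_assoc (Uq.gen r .k), Uq.k_F_E, mul_assoc, Uq.k_kinv, mul_one]
      have h2 : Uq.gen r .E * Uq.gen r .kinv * (Uq.gen r .k * Uq.gen r .F)
          = Uq.gen r .E * Uq.gen r .F := by
        rw [mul_assoc, ← mul_assoc (Uq.gen r .kinv), Uq.kinv_k, one_mul]
      rw [neg_mul_neg, neg_mul_neg, h1, h2,
        ← neg_sub (Uq.gen r .E * Uq.gen r .F), smul_neg, Uq.E_F, neg_sub])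

/-- The representation `x ↦ (y ↦ y ◁ S⁻¹(x))` of `U_q(sl₂)` on `O_q`. -/
def actSHom (r : Kˣ) : Uq r →ₐ[K] Module.End K (Oq r) where
  toFun x := actRLin r (antipodeInv r x).unop
  map_one' := by
    refine LinearMap.ext fun y => ?_
    rw [map_one, MulOpposite.unop_one, actRLin_apply, actR_one]; rfl
  map_mul' x x' := by
    refine LinearMap.ext fun y => ?_
    rw [map_mul, MulOpposite.unop_mul, actRLin_apply, actR_mul]; rfl
  map_zero' := by rw [map_zero, MulOpposite.unop_zero, map_zero]
  map_add' x x' := by rw [map_add, MulOpposite.unop_add, map_add]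
  commutes' c := by
    refine LinearMap.ext fun y => ?_
    rw [AlgHom.commutes, MulOpposite.algebraMap_apply, MulOpposite.unop_op, actRLin_apply,
      Algebra.algebraMap_eq_smul_one, actR_smul_right, actR_one]
    rfl

lemma actSHom_E (y : Oq r) : actSHom r (Uq.gen r .E) y
    = -actR (actR y (Uq.gen r .E)) (Uq.gen r .kinv) := by
  change actR y (antipodeInv r _).unop = _
  rw [antipodeInv, Uq.lift_gen, MulOpposite.unop_op, actR_neg_right, actR_mul]

lemma actSHom_F (y : Oq r) : actSHom r (Uq.gen r .F) y
    = -actR (actR y (Uq.gen r .k)) (Uq.gen r .F) := by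
  change actR y (antipodeInv r _).unop = _
  rw [antipodeInv, Uq.lift_gen, MulOpposite.unop_op, actR_neg_right, actR_mul]

lemma actSHom_k (y : Oq r) : actSHom r (Uq.gen r .k) y = actR y (Uq.gen r .kinv) := by
  change actR y (antipodeInv r _).unop = _
  rw [antipodeInv, Uq.lift_gen, MulOpposite.unop_op]

lemma actSHom_kinv (y : Oq r) : actSHom r (Uq.gen r .kinv) y = actR y (Uq.gen r .k) := by
  change actR y (antipodeInv r _).unop = _
  rw [antipodeInv, Uq.lift_gen, MulOpposite.unop_op]

/-- Left multiplication by elements of `O_q`. -/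
def mulO (r : Kˣ) : Oq r →ₐ[K] Module.End K (Oq r) := Algebra.lmul K (Oq r)

lemma mulO_apply (y z : Oq r) : mulO r y z = y * z := rfl

lemma actL_mulO_E (y : Oq r) : actLHom r (Uq.gen r .E) * mulO r y
    = mulO r (actL (Uq.gen r .E) y) + mulO r (actL (Uq.gen r .k) y) * actLHom r (Uq.gen r .E) :=
  LinearMap.ext fun z => actL_E_mul y z

lemma actL_mulO_F (y : Oq r) : actLHom r (Uq.gen r .F) * mulO r y
    = mulO r (actL (Uq.gen r .F) y) * actLHom r (Uq.gen r .kinv)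
      + mulO r y * actLHom r (Uq.gen r .F) :=
  LinearMap.ext fun z => actL_F_mul y z

lemma actL_mulO_k (y : Oq r) : actLHom r (Uq.gen r .k) * mulO r y
    = mulO r (actL (Uq.gen r .k) y) * actLHom r (Uq.gen r .k) :=
  LinearMap.ext fun z => actL_k_mul y z

lemma actL_mulO_kinv (y : Oq r) : actLHom r (Uq.gen r .kinv) * mulO r y
    = mulO r (actL (Uq.gen r .kinv) y) * actLHom r (Uq.gen r .kinv) :=
  LinearMap.ext fun z => actL_kinv_mul y z

lemma actR_k_kinv (y : Oq r) : actR (actR y (Uq.gen r .k)) (Uq.gen r .kinv) = y := by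
  rw [← actR_mul, Uq.k_kinv, actR_one]

lemma actR_kinv_k (y : Oq r) : actR (actR y (Uq.gen r .kinv)) (Uq.gen r .k) = y := by
  rw [← actR_mul, Uq.kinv_k, actR_one]

lemma mulO_actS_k (y : Oq r) : mulO r y * actSHom r (Uq.gen r .k)
    = actSHom r (Uq.gen r .k) * mulO r (actR y (Uq.gen r .k)) := by
  refine LinearMap.ext fun z => ?_
  simp only [Module.End.mul_apply, mulO_apply, actSHom_k, mul_actR_kinv, actR_k_kinv]

lemma mulO_actS_kinv (y : Oq r) : mulO r y * actSHom r (Uq.gen r .kinv)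
    = actSHom r (Uq.gen r .kinv) * mulO r (actR y (Uq.gen r .kinv)) := by
  refine LinearMap.ext fun z => ?_
  simp only [Module.End.mul_apply, mulO_apply, actSHom_kinv, mul_actR_k, actR_kinv_k]

lemma mulO_actS_E (y : Oq r) : mulO r y * actSHom r (Uq.gen r .E)
    = actSHom r (Uq.gen r .E) * mulO r y
      + actSHom r (Uq.gen r .k) * mulO r (actR y (Uq.gen r .E)) := by
  refine LinearMap.ext fun z => ?_
  simp only [LinearMap.add_apply, Module.End.mul_apply, mulO_apply, actSHom_k, actSHom_E,
    mul_actR_E, actR_add, mul_actR_kinv, actR_k_kinv, mul_neg]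
  abel

lemma mulO_actS_F (y : Oq r) : mulO r y * actSHom r (Uq.gen r .F)
    = actSHom r (Uq.gen r .F) * mulO r (actR y (Uq.gen r .kinv))
      + mulO r (actR y (Uq.gen r .F)) := by
  refine LinearMap.ext fun z => ?_
  simp only [LinearMap.add_apply, Module.End.mul_apply, mulO_apply, actSHom_F, mul_actR_F,
    mul_actR_k, actR_kinv_k, actR_k_kinv, mul_neg]
  abel

/-- An operator on `O_q`, applied to each component of a sequence. -/
def diag (r : Kˣ) : Module.End K (Oq r) →ₐ[K] Module.End K (ℤ → Oq r) where
  toFun T := T.compLeft ℤ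
  map_one' := rfl
  map_mul' _ _ := rfl
  map_zero' := rfl
  map_add' _ _ := rfl
  commutes' _ := rfl

lemma diag_apply (T : Module.End K (Oq r)) (m : ℤ → Oq r) (n : ℤ) : diag r T m n = T (m n) := rfl

/-- The coefficients of `E` in the dense module `denseRep`, the solution of
`e (n + 1) - e n = (q ^ (-2 n) - q ^ (2 n)) / (q - q⁻¹)`. -/
def denseCoeff (r : Kˣ) (n : ℤ) : K :=
  -(q r ^ (1 - 2 * n) + q r ^ (2 * n - 1)) / (q r - (q r)⁻¹) ^ 2

lemma denseCoeff_succ (hq : ∀ n : ℕ, 0 < n → q r ^ n ≠ 1) (n : ℤ) :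
    (q r - (q r)⁻¹) * (denseCoeff r (n + 1) - denseCoeff r n) = q r ^ (-2 * n) - q r ^ (2 * n) := by
  have h0 := q_ne_zero r
  have h1 := q_sub_inv_ne_zero hq
  have hn := zpow_ne_zero n h0
  have h2 : q r ^ 2 - 1 ≠ 0 := fun h => hq 2 two_pos (sub_eq_zero.1 h)
  simp only [denseCoeff, zpow_sub₀ h0, zpow_add₀ h0, neg_mul, zpow_neg, mul_comm (2 : ℤ),
    zpow_mul, zpow_ofNat]
  field_simp
  ring

/-- The operators of the generators in the dense module: with `δ n` the unit vectors,
`k δ n = q ^ (-2 n) δ n`, `F δ n = δ (n + 1)` and `E δ n = e n δ (n - 1)`. -/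
def denseGen (r : Kˣ) : Gen → Module.End K (ℤ → Oq r)
  | .E =>
    { toFun := fun m n => denseCoeff r (n + 1) • m (n + 1)
      map_add' := fun _ _ => funext fun _ => smul_add _ _ _
      map_smul' := fun c m => funext fun n => smul_comm _ c (m (n + 1)) }
  | .F =>
    { toFun := fun m n => m (n - 1)
      map_add' := fun _ _ => rfl
      map_smul' := fun _ _ => rfl }
  | .k =>
    { toFun := fun m n => q r ^ (-2 * n) • m n
      map_add' := fun _ _ => funext fun _ => smul_add _ _ _
      map_smul' := fun c m => funext fun n => smul_comm _ c (m n) }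
  | .kinv =>
    { toFun := fun m n => q r ^ (2 * n) • m n
      map_add' := fun _ _ => funext fun _ => smul_add _ _ _
      map_smul' := fun c m => funext fun n => smul_comm _ c (m n) }

lemma denseGen_E (m : ℤ → Oq r) (n : ℤ) :
    denseGen r .E m n = denseCoeff r (n + 1) • m (n + 1) := rfl
lemma denseGen_F (m : ℤ → Oq r) (n : ℤ) : denseGen r .F m n = m (n - 1) := rfl
lemma denseGen_k (m : ℤ → Oq r) (n : ℤ) : denseGen r .k m n = q r ^ (-2 * n) • m n := rfl
lemma denseGen_kinv (m : ℤ → Oq r) (n : ℤ) : denseGen r .kinv m n = q r ^ (2 * n) • m n := rfl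

/-- A module of `U_q(sl₂)` on which the powers of `θ` are independent, with coefficients in
`O_q`. -/
def denseRep (hq : ∀ n : ℕ, 0 < n → q r ^ n ≠ 1) : Uq r →ₐ[K] Module.End K (ℤ → Oq r) :=
  have h0 : q r ≠ 0 := q_ne_zero r
  Uq.lift r (denseGen r)
    (by
      refine LinearMap.ext fun m => funext fun n => ?_
      rw [Module.End.mul_apply, denseGen_k, denseGen_kinv, smul_smul, ← zpow_add₀ h0]
      simp)
    (by
      refine LinearMap.ext fun m => funext fun n => ?_
      rw [Module.End.mul_apply, denseGen_kinv, denseGen_k, smul_smul, ← zpow_add₀ h0]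
      simp)
    (by
      refine LinearMap.ext fun m => funext fun n => ?_
      rw [LinearMap.smul_apply, Pi.smul_apply, Module.End.mul_apply, Module.End.mul_apply,
        denseGen_k, denseGen_E, denseGen_E, denseGen_k, smul_smul, smul_smul, smul_smul,
        mul_comm _ (denseCoeff _ _), mul_comm (q r ^ 2), mul_assoc, ← zpow_ofNat,
        ← zpow_add₀ h0]
      congr 3
      ring)
    (by
      refine LinearMap.ext fun m => funext fun n => ?_
      rw [LinearMap.smul_apply, Pi.smul_apply, Module.End.mul_apply, Module.End.mul_apply,
        denseGen_k, denseGen_F, denseGen_F, denseGen_k, smul_smul, ← zpow_ofNat, ← zpow_add₀ h0]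
      congr 2
      ring)
    (by
      refine LinearMap.ext fun m => funext fun n => ?_
      rw [LinearMap.smul_apply, Pi.smul_apply, LinearMap.sub_apply, LinearMap.sub_apply,
        Pi.sub_apply, Pi.sub_apply, Module.End.mul_apply, Module.End.mul_apply, denseGen_E,
        denseGen_F, denseGen_F, denseGen_E, denseGen_k, denseGen_kinv,
        ← sub_smul (q r ^ (-2 * n)), ← denseCoeff_succ hq, add_sub_cancel_right, sub_add_cancel,
        ← sub_smul (denseCoeff r (n + 1)), smul_smul])

lemma denseRep_gen (hq : ∀ n : ℕ, 0 < n → q r ^ n ≠ 1) (x : Gen) :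
    denseRep hq (Uq.gen r x) = denseGen r x := by
  unfold denseRep
  rw [Uq.lift_gen]

lemma commute_denseRep_diag (hq : ∀ n : ℕ, 0 < n → q r ^ n ≠ 1) (x : Uq r)
    (T : Module.End K (Oq r)) : Commute (denseRep hq x) (diag r T) := by
  have h : x ∈ (Subalgebra.centralizer K {diag r T}).comap (denseRep hq) := by
    refine Uq.mem_of_gen_mem _ (fun g => ?_) x
    rw [Subalgebra.mem_comap, Subalgebra.mem_centralizer_iff, denseRep_gen]
    rintro _ rfl
    refine LinearMap.ext fun m => funext fun n => ?_
    rw [Module.End.mul_apply, Module.End.mul_apply]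
    cases g with
    | E => rw [diag_apply, denseGen_E, denseGen_E, diag_apply, map_smul]
    | F => rw [diag_apply, denseGen_F, denseGen_F, diag_apply]
    | k => rw [diag_apply, denseGen_k, denseGen_k, diag_apply, map_smul]
    | kinv => rw [diag_apply, denseGen_kinv, denseGen_kinv, diag_apply, map_smul]
  exact ((Subalgebra.mem_centralizer_iff K).1 h _ rfl).symm

lemma commute_actL_actS (x x' : Uq r) : Commute (actLHom r x) (actSHom r x') :=
  LinearMap.ext fun y => actL_actR x _ y

/-- The tensor product of two commuting representations of `U_q(sl₂)`. -/
def convHom {B : Type*} [Ring B] [Algebra K B] (f g : Uq r →ₐ[K] B)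
    (h : ∀ x y, Commute (f x) (g y)) : Uq r →ₐ[K] B :=
  (Algebra.TensorProduct.lift f g h).comp (Uq.comulHom r)

lemma convHom_of_comul {B : Type*} [Ring B] [Algebra K B] (f g : Uq r →ₐ[K] B) (h)
    {x a b c d : Uq r} (hx : Uq.comulHom r x = a ⊗ₜ b + c ⊗ₜ d) :
    convHom f g h x = f a * g b + f c * g d := by
  rw [convHom, AlgHom.comp_apply, hx, map_add, Algebra.TensorProduct.lift_tmul,
    Algebra.TensorProduct.lift_tmul]

lemma convHom_of_comul_eq {B : Type*} [Ring B] [Algebra K B] (f g : Uq r →ₐ[K] B) (h)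
    {x a b : Uq r} (hx : Uq.comulHom r x = a ⊗ₜ b) : convHom f g h x = f a * g b := by
  rw [convHom, AlgHom.comp_apply, hx, Algebra.TensorProduct.lift_tmul]

lemma commute_convHom {B : Type*} [Ring B] [Algebra K B] (f g : Uq r →ₐ[K] B) (h) {b : B}
    (hf : ∀ x, Commute b (f x)) (hg : ∀ x, Commute b (g x)) (x : Uq r) :
    Commute b (convHom f g h x) := by
  rw [convHom, AlgHom.comp_apply]
  generalize Uq.comulHom r x = t
  induction t using TensorProduct.induction_on with
  | zero => rw [map_zero]; exact Commute.zero_right b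
  | add s t hs ht => rw [map_add]; exact hs.add_right ht
  | tmul s t => rw [Algebra.TensorProduct.lift_tmul]; exact (hf s).mul_right (hg t)

end Double

section DoubleRep

variable {K : Type u} [Field K] {r : Kˣ}

lemma commute_denseRep_actS (hq : ∀ n : ℕ, 0 < n → q r ^ n ≠ 1) (x x' : Uq r) :
    Commute (denseRep hq x) ((diag r).comp (actSHom r) x') :=
  commute_denseRep_diag hq x _

lemma commute_actL_convHom (hq : ∀ n : ℕ, 0 < n → q r ^ n ≠ 1) (x x' : Uq r) :
    Commute ((diag r).comp (actLHom r) x)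
      (convHom (denseRep hq) ((diag r).comp (actSHom r)) (commute_denseRep_actS hq) x') :=
  commute_convHom _ _ _ (fun y => (commute_denseRep_diag hq y _).symm)
    (fun y => (commute_actL_actS x y).map (diag r)) x'

/-- The action `x ↦ λ(x₍₁₎) W(x₍₂₎) R(x₍₃₎)` of `U_q(sl₂)` on sequences in `O_q`, where `λ` is the
left action, `R` the right action through the inverse antipode, and `W` the dense module. -/
def doubleHom (hq : ∀ n : ℕ, 0 < n → q r ^ n ≠ 1) : Uq r →ₐ[K] Module.End K (ℤ → Oq r) :=
  convHom ((diag r).comp (actLHom r))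
    (convHom (denseRep hq) ((diag r).comp (actSHom r)) (commute_denseRep_actS hq))
    (commute_actL_convHom hq)

variable (hq : ∀ n : ℕ, 0 < n → q r ^ n ≠ 1)

lemma doubleHom_E : doubleHom hq (Uq.gen r .E) = diag r (actLHom r (Uq.gen r .E))
    + diag r (actLHom r (Uq.gen r .k)) * (denseRep hq (Uq.gen r .E)
      + denseRep hq (Uq.gen r .k) * diag r (actSHom r (Uq.gen r .E))) := by
  rw [doubleHom, convHom_of_comul _ _ _ comul_E, convHom_of_comul _ _ _ comul_E, map_one, map_one,
    mul_one, mul_one]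
  rfl

lemma doubleHom_k : doubleHom hq (Uq.gen r .k) = diag r (actLHom r (Uq.gen r .k))
    * (denseRep hq (Uq.gen r .k) * diag r (actSHom r (Uq.gen r .k))) := by
  rw [doubleHom, convHom_of_comul_eq _ _ _ comul_k, convHom_of_comul_eq _ _ _ comul_k]
  rfl

lemma doubleHom_kinv : doubleHom hq (Uq.gen r .kinv) = diag r (actLHom r (Uq.gen r .kinv))
    * (denseRep hq (Uq.gen r .kinv) * diag r (actSHom r (Uq.gen r .kinv))) := by
  rw [doubleHom, convHom_of_comul_eq _ _ _ comul_kinv, convHom_of_comul_eq _ _ _ comul_kinv]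
  rfl

lemma doubleHom_F : doubleHom hq (Uq.gen r .F) = diag r (actLHom r (Uq.gen r .F))
    * (denseRep hq (Uq.gen r .kinv) * diag r (actSHom r (Uq.gen r .kinv)))
    + (denseRep hq (Uq.gen r .F) * diag r (actSHom r (Uq.gen r .kinv))
      + diag r (actSHom r (Uq.gen r .F))) := by
  rw [doubleHom, convHom_of_comul _ _ _ comul_F, convHom_of_comul _ _ _ comul_F,
    convHom_of_comul_eq _ _ _ comul_kinv, map_one, map_one, one_mul, one_mul]
  rfl

/-- The action `doubleHom` of `U_q(sl₂)` and left multiplication by `O_q` satisfy the exchange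
relation: `λ` contributes the right hand side, `R` the left hand side, and `W` commutes with
multiplication. -/
lemma doubleHom_exch (x : Gen) (y : Oq r) :
    exchL (doubleHom hq) ((diag r).comp (mulO r)) y (Uq.comulHom r (Uq.gen r x))
      = exchR (doubleHom hq) ((diag r).comp (mulO r)) y (Uq.comulHom r (Uq.gen r x)) := by
  cases x with
  | E =>
    rw [comul_E, map_add, map_add, exchL_tmul, exchL_tmul, exchR_tmul, exchR_tmul, actR_one,
      map_one, mul_one, doubleHom_E, doubleHom_k]
    have e1 := congrArg (diag r) (mulO_actS_E y)
    have e2 := congrArg (diag r) (actL_mulO_E y)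
    have e3 := congrArg (diag r) (actL_mulO_k y)
    have e4 := (commute_denseRep_diag hq (Uq.gen r .E) (mulO r y)).eq
    have e5 := (commute_denseRep_diag hq (Uq.gen r .k) (mulO r y)).eq
    simp only [map_mul, map_add] at e1 e2 e3
    simp only [AlgHom.comp_apply]
    simp only [add_mul, mul_add, mul_assoc, e2, e4, add_assoc]
    rw [← mul_add, ← mul_add, ← mul_add, ← e1, ← mul_assoc (denseRep hq _), e5,
      mul_assoc (diag r (mulO r y)), ← mul_add, ← mul_assoc _ (diag r (mulO r y)), e3, mul_add,
      mul_assoc, mul_assoc]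
  | F =>
    rw [comul_F, map_add, map_add, exchL_tmul, exchL_tmul, exchR_tmul, exchR_tmul, actL_one,
      map_one, one_mul, doubleHom_F, doubleHom_kinv]
    have e1 := congrArg (diag r) (mulO_actS_F y)
    have e2 := congrArg (diag r) (actL_mulO_F y)
    have e3 := congrArg (diag r) (mulO_actS_kinv y)
    have e4 := (commute_denseRep_diag hq (Uq.gen r .F) (mulO r y)).eq
    have e5 := (commute_denseRep_diag hq (Uq.gen r .kinv) (mulO r y)).eq
    simp only [map_mul, map_add] at e1 e2 e3
    simp only [AlgHom.comp_apply]
    simp only [add_mul, mul_add, mul_assoc, ← e3, add_assoc]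
    rw [← e1, ← mul_assoc (denseRep hq _), ← mul_assoc (denseRep hq _), e4, e5, mul_assoc,
      mul_assoc, ← mul_assoc _ (diag r (mulO r y)), e2, add_mul, mul_assoc, mul_assoc, add_assoc]
  | k =>
    rw [comul_k, exchL_tmul, exchR_tmul, doubleHom_k]
    have e1 := congrArg (diag r) (mulO_actS_k y)
    have e3 := congrArg (diag r) (actL_mulO_k y)
    have e5 := (commute_denseRep_diag hq (Uq.gen r .k) (mulO r y)).eq
    simp only [map_mul] at e1 e3
    simp only [AlgHom.comp_apply]
    rw [mul_assoc, mul_assoc, ← e1, ← mul_assoc (denseRep hq _), e5, mul_assoc, ← mul_assoc, e3,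
      mul_assoc]
  | kinv =>
    rw [comul_kinv, exchL_tmul, exchR_tmul, doubleHom_kinv]
    have e1 := congrArg (diag r) (mulO_actS_kinv y)
    have e3 := congrArg (diag r) (actL_mulO_kinv y)
    have e5 := (commute_denseRep_diag hq (Uq.gen r .kinv) (mulO r y)).eq
    simp only [map_mul] at e1 e3
    simp only [AlgHom.comp_apply]
    rw [mul_assoc, mul_assoc, ← e1, ← mul_assoc (denseRep hq _), e5, mul_assoc, ← mul_assoc, e3,
      mul_assoc]

/-- A representation of the Drinfeld double on sequences in `O_q`, in which `O_q` acts by left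
multiplication. -/
def doubleRep : Double r →ₐ[K] Module.End K (ℤ → Oq r) :=
  Double.lift (doubleHom hq) ((diag r).comp (mulO r)) (doubleHom_exch hq)

variable [Algebra ℂ K]

/-- On sequences of scalars, `θ` acts through the dense module only. -/
lemma doubleHom_theta (c : ℤ → K) (n : ℤ) :
    doubleHom hq (theta r) (fun n => c n • 1) n
      = (imag K * (r : K)⁻¹ * (denseCoeff r (n + 1) * c (n + 1) - q r ^ (-2 * (n - 1)) * c (n - 1)))
        • (1 : Oq r) := by
  have hh : doubleHom hq (theta r) = diag r (actLHom r (theta r))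
      + diag r (actLHom r (Uq.gen r .k)) * (denseRep hq (theta r)
        + denseRep hq (Uq.gen r .k) * diag r (actSHom r (theta r))) := by
    rw [doubleHom, convHom_of_comul _ _ _ (comul_theta r), convHom_of_comul _ _ _ (comul_theta r),
      map_one, map_one, mul_one, mul_one]
    rfl
  have h1 : diag r (actLHom r (theta r)) (fun n => c n • 1) = 0 := by
    refine funext fun n => ?_
    rw [diag_apply, map_smul, actLHom_apply, actL_on_one]
    simp [theta]
  have h2 : diag r (actSHom r (theta r)) (fun n => c n • 1) = 0 := by
    refine funext fun n => ?_
    rw [diag_apply, map_smul, theta, map_smul, map_sub, map_mul]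
    simp [actSHom_E, actSHom_F, actSHom_k, actR_on_one]
  rw [hh, LinearMap.add_apply, h1, zero_add, Module.End.mul_apply, LinearMap.add_apply,
    Module.End.mul_apply, h2, map_zero, add_zero, diag_apply, theta, map_smul, map_sub, map_mul,
    denseRep_gen, denseRep_gen, denseRep_gen, LinearMap.smul_apply, LinearMap.sub_apply,
    Module.End.mul_apply, Pi.smul_apply, Pi.sub_apply, denseGen_E, denseGen_F, denseGen_k]
  simp only [map_smul, actLHom_apply, actL_on_one, counit_k, one_smul, smul_smul,
    ← sub_smul]

/-- `θ ^ i` maps the unit vector at `0` to a sequence of scalars with last nonzero entry at `i`. -/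
lemma exists_doubleHom_theta_pow (i : ℕ) : ∃ c : ℤ → K,
    doubleHom hq (theta r ^ i) (fun n => (if n = 0 then (1 : K) else 0) • 1) = (fun n => c n • 1) ∧
      (∀ n : ℤ, (i : ℤ) < n → c n = 0) ∧ c i ≠ 0 := by
  induction i with
  | zero =>
    refine ⟨fun n => if n = 0 then 1 else 0, by rw [pow_zero, map_one]; rfl, fun n hn => ?_, ?_⟩
    · exact if_neg (by push_cast at hn; omega)
    · simp
  | succ i ih =>
    obtain ⟨c, h1, h2, h3⟩ := ih
    refine ⟨fun n => imag K * (r : K)⁻¹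
        * (denseCoeff r (n + 1) * c (n + 1) - q r ^ (-2 * (n - 1)) * c (n - 1)),
      funext fun n => ?_, fun n hn => ?_, ?_⟩
    · rw [pow_succ', map_mul, Module.End.mul_apply, h1, doubleHom_theta]
    · push_cast at hn
      beta_reduce
      rw [h2 (n + 1) (by omega), h2 (n - 1) (by omega)]
      ring
    · beta_reduce
      rw [h2 _ (by push_cast; omega), mul_zero, zero_sub]
      push_cast
      rw [add_sub_cancel_right]
      exact mul_ne_zero (mul_ne_zero imag_ne_zero (inv_ne_zero r.ne_zero))
        (neg_ne_zero.2 (mul_ne_zero (zpow_ne_zero _ (q_ne_zero r)) h3))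

include hq in
/-- In the double, the powers of `θ` are independent over `O_q`. -/
lemma double_theta_free (n : ℕ) (a : ℕ → Oq r)
    (h : ∑ i ∈ Finset.range (n + 1), Double.ofO r (a i) * Double.ofU r (theta r) ^ i = 0) :
    a n = 0 := by
  have h1 := congrArg (fun w => doubleRep hq w (fun n => (if n = 0 then (1 : K) else 0) • 1) n) h
  simp only [map_sum, map_mul, map_zero, ← map_pow] at h1
  rw [LinearMap.sum_apply, Finset.sum_apply, Finset.sum_range_succ, Finset.sum_eq_zero,
    zero_add] at h1
  · obtain ⟨c, hc, -, hc0⟩ := exists_doubleHom_theta_pow hq n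
    rw [doubleRep, Double.lift_ofO, Double.lift_ofU, Module.End.mul_apply, hc, AlgHom.comp_apply,
      diag_apply, mulO_apply, mul_smul_comm, mul_one] at h1
    exact (smul_eq_zero.1 h1).resolve_left hc0
  · intro i hi
    obtain ⟨c, hc, hc1, -⟩ := exists_doubleHom_theta_pow hq i
    rw [doubleRep, Double.lift_ofO, Double.lift_ofU, Module.End.mul_apply, hc, AlgHom.comp_apply,
      diag_apply, mulO_apply, hc1 n (by have := Finset.mem_range.1 hi; omega), zero_smul, mul_zero]

end DoubleRep

/-! ### The filtration of `U_q(𝔤)` by the degree in `θ` -/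

section Filtration

variable {K : Type u} [Field K] [Algebra ℂ K] {r : Kˣ}

/-- The element `θ` of the double. -/
def dTheta (r : Kˣ) : Double r := Double.ofU r (theta r)

/-- The exchange relation between `θ` and `O_q(K\U)`. -/
lemma dTheta_mul {y : Oq r} (hy : y ∈ OKU r) : dTheta r * Double.ofO r y
    = Double.ofO r (actL (theta r) y) + Double.ofO r (actL (Uq.gen r .k) y) * dTheta r := by
  have h := Double.exchange_of_comul (comul_theta r) y
  rw [actR_one, mem_OKU.1 hy, map_zero, mul_zero, add_zero, map_one, mul_one] at h
  exact h

lemma mul_dTheta {y : Oq r} (hy : y ∈ OKU r) : Double.ofO r y * dTheta r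
    = dTheta r * Double.ofO r (actL (Uq.gen r .kinv) y)
      - Double.ofO r (actL (theta r) (actL (Uq.gen r .kinv) y)) := by
  rw [dTheta_mul (actL_mem_OKU hy _), actL_k_kinv]
  abel

/-- The elements `∑ θ ^ i aᵢ` of the double with `aᵢ ∈ O_q(K\U)` and `i < n`. -/
def filt (r : Kˣ) (n : ℕ) : Submodule K (Double r) where
  carrier := {w | ∃ a : ℕ → OKU r,
    w = ∑ i ∈ Finset.range n, dTheta r ^ i * Double.ofO r (a i)}
  add_mem' := by
    rintro _ _ ⟨a, rfl⟩ ⟨b, rfl⟩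
    exact ⟨a + b, by simp [mul_add, Finset.sum_add_distrib]⟩
  zero_mem' := ⟨0, by simp⟩
  smul_mem' := by
    rintro c _ ⟨a, rfl⟩
    exact ⟨c • a, by simp [Finset.smul_sum]⟩

lemma dTheta_pow_mul_mem_filt {i n : ℕ} (hi : i < n) {a : Oq r} (ha : a ∈ OKU r) :
    dTheta r ^ i * Double.ofO r a ∈ filt r n := by
  refine ⟨Pi.single i ⟨a, ha⟩, ?_⟩
  rw [Finset.sum_eq_single_of_mem i (Finset.mem_range.2 hi)]
  · simp
  · intro j _ hj
    rw [Pi.single_eq_of_ne hj, ZeroMemClass.coe_zero, map_zero, mul_zero]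

lemma filt_induction {n : ℕ} {S : Submodule K (Double r)}
    (h : ∀ i < n, ∀ a ∈ OKU r, dTheta r ^ i * Double.ofO r a ∈ S) : filt r n ≤ S := by
  rintro _ ⟨a, rfl⟩
  exact sum_mem fun i hi => h i (Finset.mem_range.1 hi) _ (a i).2

lemma filt_mono {m n : ℕ} (h : m ≤ n) : filt r m ≤ filt r n :=
  filt_induction fun _ hi _ ha => dTheta_pow_mul_mem_filt (hi.trans_le h) ha

lemma dTheta_mul_mem_filt {n : ℕ} {w : Double r} (hw : w ∈ filt r n) :
    dTheta r * w ∈ filt r (n + 1) := by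
  refine (filt_induction (S := (filt r (n + 1)).comap (LinearMap.mulLeft K (dTheta r)))
    fun i hi a ha => ?_) hw
  rw [Submodule.mem_comap, LinearMap.mulLeft_apply, ← mul_assoc, ← pow_succ']
  exact dTheta_pow_mul_mem_filt (by omega) ha

lemma filt_mul_ofO_mem {n : ℕ} {w : Double r} (hw : w ∈ filt r n) {b : Oq r} (hb : b ∈ OKU r) :
    w * Double.ofO r b ∈ filt r n := by
  refine (filt_induction (S := (filt r n).comap (LinearMap.mulRight K (Double.ofO r b)))
    fun i hi a ha => ?_) hw
  rw [Submodule.mem_comap, LinearMap.mulRight_apply, mul_assoc, ← map_mul]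
  exact dTheta_pow_mul_mem_filt hi (mul_mem ha hb)

omit [Algebra ℂ K] in
lemma actL_pow_kinv_succ (n : ℕ) (a : Oq r) : actL (Uq.gen r .kinv ^ (n + 1)) a
    = actL (Uq.gen r .kinv ^ n) (actL (Uq.gen r .kinv) a) := by
  rw [pow_succ, actL_mul]

/-- Moving an element of `O_q(K\U)` to the right of `θ ^ n` twists it by `k⁻ⁿ`, modulo lower
terms. -/
lemma ofO_mul_dTheta_pow (n : ℕ) {a : Oq r} (ha : a ∈ OKU r) :
    Double.ofO r a * dTheta r ^ n - dTheta r ^ n * Double.ofO r (actL (Uq.gen r .kinv ^ n) a)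
      ∈ filt r n := by
  induction n generalizing a with
  | zero => simp
  | succ n ih =>
    have h1 := actL_mem_OKU ha (Uq.gen r .kinv)
    have h2 := actL_mem_OKU h1 (theta r)
    have e : Double.ofO r a * dTheta r ^ (n + 1)
        - dTheta r ^ (n + 1) * Double.ofO r (actL (Uq.gen r .kinv ^ (n + 1)) a)
      = dTheta r * (Double.ofO r (actL (Uq.gen r .kinv) a) * dTheta r ^ n
          - dTheta r ^ n * Double.ofO r (actL (Uq.gen r .kinv ^ n) (actL (Uq.gen r .kinv) a)))
        - (Double.ofO r (actL (theta r) (actL (Uq.gen r .kinv) a)) * dTheta r ^ n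
          - dTheta r ^ n * Double.ofO r (actL (Uq.gen r .kinv ^ n)
              (actL (theta r) (actL (Uq.gen r .kinv) a))))
        - dTheta r ^ n * Double.ofO r (actL (Uq.gen r .kinv ^ n)
              (actL (theta r) (actL (Uq.gen r .kinv) a))) := by
      rw [pow_succ' (dTheta r), ← mul_assoc, mul_dTheta ha, actL_pow_kinv_succ]
      noncomm_ring
    rw [e]
    exact sub_mem (sub_mem (dTheta_mul_mem_filt (ih h1)) (filt_mono n.le_succ (ih h2)))
      (dTheta_pow_mul_mem_filt n.lt_succ_self (actL_mem_OKU h2 _))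

lemma ofO_mul_mem_filt {n : ℕ} {w : Double r} (hw : w ∈ filt r n) {a : Oq r} (ha : a ∈ OKU r) :
    Double.ofO r a * w ∈ filt r n := by
  refine (filt_induction (S := (filt r n).comap (LinearMap.mulLeft K (Double.ofO r a)))
    fun i hi b hb => ?_) hw
  have e : Double.ofO r a * (dTheta r ^ i * Double.ofO r b)
      = (Double.ofO r a * dTheta r ^ i
          - dTheta r ^ i * Double.ofO r (actL (Uq.gen r .kinv ^ i) a)) * Double.ofO r b
        + dTheta r ^ i * Double.ofO r (actL (Uq.gen r .kinv ^ i) a * b) := by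
    rw [map_mul]; noncomm_ring
  rw [Submodule.mem_comap, LinearMap.mulLeft_apply, e]
  exact add_mem (filt_mono hi.le (filt_mul_ofO_mem (ofO_mul_dTheta_pow i ha) hb))
    (dTheta_pow_mul_mem_filt hi (mul_mem (actL_mem_OKU ha _) hb))

/-- Every element of `U_q(𝔤)` has the form `∑ θ ^ i aᵢ` with `aᵢ ∈ O_q(K\U)`. -/
lemma exists_mem_filt {w : Double r} (hw : w ∈ Ug r) : ∃ n, w ∈ filt r n := by
  -- The elements whose left multiplication preserves the union of the filtration form a subalgebra.
  let S : Subalgebra K (Double r) :=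
    { carrier := {x | ∀ n, ∀ w ∈ filt r n, ∃ m, x * w ∈ filt r m}
      mul_mem' := fun {x y} hx hy n w hw => by
        obtain ⟨m, hm⟩ := hy n w hw
        rw [mul_assoc]
        exact hx m _ hm
      add_mem' := fun {x y} hx hy n w hw => by
        obtain ⟨m, hm⟩ := hx n w hw
        obtain ⟨l, hl⟩ := hy n w hw
        refine ⟨max m l, ?_⟩
        rw [add_mul]
        exact add_mem (filt_mono (le_max_left _ _) hm) (filt_mono (le_max_right _ _) hl)
      algebraMap_mem' := fun c n w hw => ⟨n, by
        rw [← Algebra.smul_def]; exact Submodule.smul_mem _ c hw⟩ }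
  have hS : Ug r ≤ S := by
    refine sup_le ?_ ?_
    · rw [Uk, AlgHom.map_adjoin, Set.image_singleton]
      refine Algebra.adjoin_le ?_
      rintro _ rfl
      exact fun n w hw => ⟨n + 1, dTheta_mul_mem_filt hw⟩
    · rintro _ ⟨a, ha, rfl⟩
      exact fun n w hw => ⟨n, ofO_mul_mem_filt hw ha⟩
  have h1 : (1 : Double r) ∈ filt r 1 := by
    simpa using dTheta_pow_mul_mem_filt one_pos (one_mem (OKU r))
  simpa using hS hw 1 1 h1

/-- The elements `∑ aᵢ θ ^ i` of the double with `aᵢ ∈ O_q` and `i < n`. -/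
def leftFilt (r : Kˣ) (n : ℕ) : Submodule K (Double r) where
  carrier := {w | ∃ a : ℕ → Oq r,
    w = ∑ i ∈ Finset.range n, Double.ofO r (a i) * dTheta r ^ i}
  add_mem' := by
    rintro _ _ ⟨a, rfl⟩ ⟨b, rfl⟩
    exact ⟨a + b, by simp [add_mul, Finset.sum_add_distrib]⟩
  zero_mem' := ⟨0, by simp⟩
  smul_mem' := by
    rintro c _ ⟨a, rfl⟩
    exact ⟨c • a, by simp [Finset.smul_sum]⟩

lemma mul_dTheta_pow_mem_leftFilt {i n : ℕ} (hi : i < n) (a : Oq r) :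
    Double.ofO r a * dTheta r ^ i ∈ leftFilt r n := by
  refine ⟨Pi.single i a, ?_⟩
  rw [Finset.sum_eq_single_of_mem i (Finset.mem_range.2 hi)]
  · simp
  · intro j _ hj
    rw [Pi.single_eq_of_ne hj, map_zero, zero_mul]

lemma leftFilt_mono {m n : ℕ} (h : m ≤ n) : leftFilt r m ≤ leftFilt r n := by
  rintro _ ⟨a, rfl⟩
  exact sum_mem fun i hi =>
    mul_dTheta_pow_mem_leftFilt ((Finset.mem_range.1 hi).trans_le h) (a i)

/-- Moving an element of `O_q(K\U)` to the left of `θ ^ n` twists it by `k ^ n`, modulo lower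
terms. -/
lemma dTheta_pow_mul_ofO (n : ℕ) {a : Oq r} (ha : a ∈ OKU r) :
    dTheta r ^ n * Double.ofO r a - Double.ofO r (actL (Uq.gen r .k ^ n) a) * dTheta r ^ n
      ∈ leftFilt r n := by
  induction n generalizing a with
  | zero => simp
  | succ n ih =>
    have h1 := actL_mem_OKU ha (Uq.gen r .k)
    have h2 := actL_mem_OKU ha (theta r)
    have hmul : ∀ w ∈ leftFilt r n, w * dTheta r ∈ leftFilt r (n + 1) := by
      rintro _ ⟨b, rfl⟩
      rw [Finset.sum_mul]
      refine sum_mem fun i hi => ?_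
      rw [mul_assoc, ← pow_succ]
      exact mul_dTheta_pow_mem_leftFilt (by have := Finset.mem_range.1 hi; omega) _
    have e : dTheta r ^ (n + 1) * Double.ofO r a
        - Double.ofO r (actL (Uq.gen r .k ^ (n + 1)) a) * dTheta r ^ (n + 1)
      = (dTheta r ^ n * Double.ofO r (actL (Uq.gen r .k) a)
          - Double.ofO r (actL (Uq.gen r .k ^ n) (actL (Uq.gen r .k) a)) * dTheta r ^ n) * dTheta r
        + (dTheta r ^ n * Double.ofO r (actL (theta r) a)
          - Double.ofO r (actL (Uq.gen r .k ^ n) (actL (theta r) a)) * dTheta r ^ n)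
        + Double.ofO r (actL (Uq.gen r .k ^ n) (actL (theta r) a)) * dTheta r ^ n := by
      rw [pow_succ (dTheta r), mul_assoc, dTheta_mul ha, pow_succ (Uq.gen r .k), actL_mul]
      noncomm_ring
    rw [e]
    exact add_mem (add_mem (hmul _ (ih h1)) (leftFilt_mono n.le_succ (ih h2)))
      (mul_dTheta_pow_mem_leftFilt n.lt_succ_self _)

lemma filt_le_leftFilt (n : ℕ) : filt r n ≤ leftFilt r n :=
  filt_induction fun i hi a ha => by
    have h := add_mem (leftFilt_mono hi.le (dTheta_pow_mul_ofO i ha))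
      (mul_dTheta_pow_mem_leftFilt hi (actL (Uq.gen r .k ^ i) a))
    rwa [sub_add_cancel] at h

omit [Algebra ℂ K] in
lemma actL_kinv_pow_k_pow (n : ℕ) (y : Oq r) :
    actL (Uq.gen r .kinv ^ n) (actL (Uq.gen r .k ^ n) y) = y := by
  induction n generalizing y with
  | zero => simp
  | succ n ih => rw [pow_succ, actL_mul, pow_succ' (Uq.gen r .k), actL_mul, actL_kinv_k, ih]

/-- The powers of `θ` are independent over `O_q(K\U)`, also with coefficients on the right. -/
lemma eq_zero_of_dTheta_pow_mul_mem (hq : ∀ n : ℕ, 0 < n → q r ^ n ≠ 1) (n : ℕ) {a : Oq r}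
    (ha : a ∈ OKU r) (h : dTheta r ^ n * Double.ofO r a ∈ filt r n) : a = 0 := by
  have h1 := sub_mem (filt_le_leftFilt n h) (dTheta_pow_mul_ofO n ha)
  rw [sub_sub_cancel] at h1
  obtain ⟨b, hb⟩ := h1
  have h2 : ∑ i ∈ Finset.range (n + 1),
      Double.ofO r (if i = n then -actL (Uq.gen r .k ^ n) a else b i) * dTheta r ^ i = 0 := by
    rw [Finset.sum_range_succ, if_pos rfl, map_neg, neg_mul, hb, ← sub_eq_add_neg, sub_eq_zero]
    refine Finset.sum_congr rfl fun i hi => ?_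
    rw [if_neg (Finset.mem_range.1 hi).ne]
  have h3 := double_theta_free hq n _ h2
  rw [if_pos rfl, neg_eq_zero] at h3
  rw [← actL_kinv_pow_k_pow n a, h3, actL_zero]

/-! ### The leading terms of the powers of the Casimir element -/

/-- The Casimir element `(q - q⁻¹) θ Z + q X + q⁻¹ Y`, in the double. -/
def dCasimir (r : Kˣ) : Double r := (q r - (q r)⁻¹) • (dTheta r * Double.ofO r (Z₀ r))
  + Double.ofO r (q r • X₀ r + (q r)⁻¹ • Y₀ r)

omit [Algebra ℂ K] in
lemma actL_kinv_pow_of_mem_weight {m : ℤ} {y : Oq r} (hy : y ∈ weight r m) (n : ℕ) :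
    actL (Uq.gen r .kinv ^ n) y = (q r ^ (-m)) ^ n • y := by
  induction n with
  | zero => simp
  | succ n ih =>
    rw [actL_pow_kinv_succ, actL_kinv_of_mem_weight hy, actL_smul, ih, smul_smul, ← pow_succ']

/-- `Ωⁿ` has the leading term `(q - q⁻¹)ⁿ θⁿ Zⁿ`. -/
lemma dCasimir_pow (n : ℕ) : dCasimir r ^ n
    - (q r - (q r)⁻¹) ^ n • (dTheta r ^ n * Double.ofO r (Z₀ r ^ n)) ∈ filt r n := by
  induction n with
  | zero => simp
  | succ n ih =>
    have hC : q r • X₀ r + (q r)⁻¹ • Y₀ r ∈ OKU r :=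
      add_mem (Subalgebra.smul_mem _ (X₀_mem r) _) (Subalgebra.smul_mem _ (Y₀_mem r) _)
    have hZ := Z₀_mem r
    have hθZ : Double.ofO r (Z₀ r) * dTheta r ^ n - dTheta r ^ n * Double.ofO r (Z₀ r)
        ∈ filt r n := by
      have := ofO_mul_dTheta_pow n hZ
      rwa [actL_kinv_pow_of_mem_weight Z₀_mem_weight, neg_zero, zpow_zero, one_pow,
        one_smul] at this
    have hstep : ∀ w ∈ filt r n, dCasimir r * w ∈ filt r (n + 1) := fun w hw => by
      rw [dCasimir, add_mul, smul_mul_assoc, mul_assoc]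
      exact add_mem (Submodule.smul_mem _ _ (dTheta_mul_mem_filt (ofO_mul_mem_filt hw hZ)))
        (filt_mono n.le_succ (ofO_mul_mem_filt hw hC))
    have hlead := dTheta_pow_mul_mem_filt n.lt_succ_self (pow_mem hZ n)
    have e : dCasimir r ^ (n + 1)
        - (q r - (q r)⁻¹) ^ (n + 1) • (dTheta r ^ (n + 1) * Double.ofO r (Z₀ r ^ (n + 1)))
      = dCasimir r * (dCasimir r ^ n
          - (q r - (q r)⁻¹) ^ n • (dTheta r ^ n * Double.ofO r (Z₀ r ^ n)))
        + (q r - (q r)⁻¹) ^ n • ((q r - (q r)⁻¹) • (dTheta r * ((Double.ofO r (Z₀ r) * dTheta r ^ n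
            - dTheta r ^ n * Double.ofO r (Z₀ r)) * Double.ofO r (Z₀ r ^ n)))
          + Double.ofO r (q r • X₀ r + (q r)⁻¹ • Y₀ r)
            * (dTheta r ^ n * Double.ofO r (Z₀ r ^ n))) := by
      rw [pow_succ' (dCasimir r), pow_succ' (dTheta r), pow_succ' (Z₀ r), map_mul, pow_succ,
        mul_smul, mul_sub, sub_add, sub_right_inj, mul_smul_comm, ← smul_sub]
      congr 1
      rw [dCasimir, add_mul, smul_mul_assoc, add_sub_add_right_eq_sub, ← smul_sub]
      congr 1
      noncomm_ring
    rw [e]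
    exact add_mem (hstep _ ih) (Submodule.smul_mem _ _ (add_mem (Submodule.smul_mem _ _
      (dTheta_mul_mem_filt (filt_mul_ofO_mem hθZ (pow_mem hZ n)))) (ofO_mul_mem_filt hlead hC)))

end Filtration

/-! ### The Casimir element and the center -/

section Center

variable {K : Type u} [Field K]

/-- The relations of `U_q(𝔤)` imply that `(p - p⁻¹) t z + p x + p⁻¹ y` is central. -/
lemma casimir_commute {B : Type*} [Ring B] [Algebra K B] {p : K} (hp : p ≠ 0) {t x y z : B}
    (hxt : x * t = (p ^ 2)⁻¹ • (t * x) + (1 + (p ^ 2)⁻¹) • z)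
    (hyt : y * t = p ^ 2 • (t * y) - (1 + p ^ 2) • z)
    (hzt : z * t = t * z - y + x)
    (hxz : x * z = p ^ 2 • (z * x)) (hyz : y * z = (p ^ 2)⁻¹ • (z * y))
    (hyx : y * x = x * y + (p ^ 2 - (p ^ 2)⁻¹) • (z * z)) :
    ∀ w, w = t ∨ w = x ∨ w = y ∨ w = z →
      Commute w ((p - p⁻¹) • (t * z) + (p • x + p⁻¹ • y)) := by
  have a1 : ∀ w, x * (t * w) = (p ^ 2)⁻¹ • (t * (x * w)) + (1 + (p ^ 2)⁻¹) • (z * w) := fun w => by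
    rw [← mul_assoc, hxt, add_mul, smul_mul_assoc, smul_mul_assoc, mul_assoc]
  have a2 : ∀ w, y * (t * w) = p ^ 2 • (t * (y * w)) - (1 + p ^ 2) • (z * w) := fun w => by
    rw [← mul_assoc, hyt, sub_mul, smul_mul_assoc, smul_mul_assoc, mul_assoc]
  have a3 : ∀ w, z * (t * w) = t * (z * w) - y * w + x * w := fun w => by
    rw [← mul_assoc, hzt, add_mul, sub_mul, mul_assoc]
  rintro w (rfl | rfl | rfl | rfl) <;> rw [Commute, SemiconjBy] <;>
    simp only [mul_add, add_mul, mul_smul_comm, smul_mul_assoc, mul_assoc, hxt, hyt, hzt, hxz, hyz,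
      hyx, a1, a2, a3, mul_sub] <;>
    match_scalars <;> field_simp <;> ring

variable [Algebra ℂ K] {r : Kˣ}

lemma ofO_mem_Ug {y : Oq r} (hy : y ∈ OKU r) : Double.ofO r y ∈ Ug r :=
  (le_sup_right : _ ≤ Ug r) ⟨y, hy, rfl⟩

/-- The Casimir element is central in `U_q(𝔤)`. -/
lemma commute_dCasimir (hq : ∀ n : ℕ, 0 < n → q r ^ n ≠ 1) {w : Double r} (hw : w ∈ Ug r) :
    Commute w (dCasimir r) := by
  have hX := X₀_mem r
  have hY := Y₀_mem r
  have hZ := Z₀_mem r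
  have h0 := q_ne_zero r
  have key := casimir_commute (K := K) (B := Double r) h0 (t := dTheta r) (x := Double.ofO r (X₀ r))
    (y := Double.ofO r (Y₀ r)) (z := Double.ofO r (Z₀ r))
    (by
      rw [mul_dTheta hX, actL_kinv_of_mem_weight X₀_mem_weight, actL_smul, actL_theta_X₀ hq,
        zpow_neg, zpow_ofNat, map_smul, map_smul, map_smul, mul_smul_comm]
      match_scalars <;> field_simp
      ring)
    (by
      rw [mul_dTheta hY, actL_kinv_of_mem_weight Y₀_mem_weight, actL_smul, actL_theta_Y₀ hq,
        neg_neg, zpow_ofNat, map_smul, map_smul, map_smul, mul_smul_comm]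
      match_scalars <;> field_simp
      ring)
    (by
      rw [mul_dTheta hZ, actL_kinv_of_mem_weight Z₀_mem_weight, neg_zero, zpow_zero, one_smul,
        actL_theta_Z₀, map_sub]
      abel)
    (by
      rw [← map_mul, mul_Z₀_comm hq hX X₀_mem_weight, zpow_ofNat, map_smul, map_mul])
    (by
      rw [← map_mul, mul_Z₀_comm hq hY Y₀_mem_weight, zpow_neg, zpow_ofNat, map_smul, map_mul])
    (by
      rw [← map_mul, ← map_mul, ← map_mul, ← map_smul, ← map_add, ← Y₀_mul_X₀_sub hq,
        add_sub_cancel])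
  rw [← map_smul, ← map_smul, ← map_add, ← dCasimir] at key
  have hle : Ug r ≤ Subalgebra.centralizer K {dCasimir r} := by
    refine sup_le ?_ (Subalgebra.map_le.2 ((OKU_le_adjoin hq).trans (Algebra.adjoin_le ?_)))
    · rw [Uk, AlgHom.map_adjoin, Set.image_singleton, Algebra.adjoin_le_iff,
        Set.singleton_subset_iff]
      exact (Subalgebra.mem_centralizer_iff K).2 fun _ h =>
        (Set.mem_singleton_iff.1 h) ▸ (key _ (.inl rfl)).eq.symm
    · rintro _ h
      refine (Subalgebra.mem_centralizer_iff K).2 fun _ h' => (Set.mem_singleton_iff.1 h') ▸ ?_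
      obtain rfl | rfl | rfl := h
      · exact (key _ (.inr (.inl rfl))).eq.symm
      · exact (key _ (.inr (.inr (.inl rfl)))).eq.symm
      · exact (key _ (.inr (.inr (.inr rfl)))).eq.symm
  exact ((Subalgebra.mem_centralizer_iff K).1 (hle hw) _ rfl).symm

/-- The leading coefficient of an element of `U_q(𝔤)` that commutes with `b ∈ O_q(K\U)` commutes
with `b` up to a twist. -/
lemma mul_leading_coeff (hq : ∀ n : ℕ, 0 < n → q r ^ n ≠ 1) {n : ℕ} {a b : Oq r} {w : Double r}
    (ha : a ∈ OKU r) (hb : b ∈ OKU r) (hw : w ∈ filt r n)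
    (h : Commute (Double.ofO r b) (dTheta r ^ n * Double.ofO r a + w)) :
    a * b = actL (Uq.gen r .kinv ^ n) b * a := by
  rw [← sub_eq_zero]
  refine eq_zero_of_dTheta_pow_mul_mem hq n
    (sub_mem (mul_mem ha hb) (mul_mem (actL_mem_OKU hb _) ha)) ?_
  have e : dTheta r ^ n * Double.ofO r (a * b - actL (Uq.gen r .kinv ^ n) b * a)
      = (Double.ofO r b * dTheta r ^ n
          - dTheta r ^ n * Double.ofO r (actL (Uq.gen r .kinv ^ n) b)) * Double.ofO r a
        + Double.ofO r b * w - w * Double.ofO r b := by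
    have h' := h.eq
    rw [mul_add, add_mul, ← sub_eq_zero] at h'
    rw [← sub_eq_zero, ← neg_eq_zero, ← h', map_sub, map_mul, map_mul]
    noncomm_ring
  rw [e]
  exact sub_mem (add_mem (filt_mul_ofO_mem (ofO_mul_dTheta_pow n hb) ha) (ofO_mul_mem_filt hw hb))
    (filt_mul_ofO_mem hw hb)

/-- The leading term of a central element is a multiple of that of a power of the Casimir element,
so that central elements are polynomials in the Casimir element. -/
lemma exists_aeval_dCasimir (hq : ∀ n : ℕ, 0 < n → q r ^ n ≠ 1) (n : ℕ) {w : Double r}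
    (hw : w ∈ filt r n) (hX : Commute (Double.ofO r (X₀ r)) w)
    (hZ : Commute (Double.ofO r (Z₀ r)) w) :
    ∃ p : Polynomial K, w = Polynomial.aeval (dCasimir r) p := by
  induction n generalizing w with
  | zero =>
    obtain ⟨a, rfl⟩ := hw
    exact ⟨0, by simp⟩
  | succ n ih =>
    obtain ⟨a, ha⟩ := hw
    rw [Finset.sum_range_succ, add_comm] at ha
    have hv : ∑ i ∈ Finset.range n, dTheta r ^ i * Double.ofO r (a i) ∈ filt r n := ⟨a, rfl⟩
    have h1 := mul_leading_coeff hq (a n).2 (Z₀_mem r) hv (ha ▸ hZ)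
    have h2 := mul_leading_coeff hq (a n).2 (X₀_mem r) hv (ha ▸ hX)
    rw [actL_kinv_pow_of_mem_weight Z₀_mem_weight, neg_zero, zpow_zero, one_pow, one_smul] at h1
    rw [actL_kinv_pow_of_mem_weight X₀_mem_weight, zpow_neg, zpow_ofNat, smul_mul_assoc] at h2
    obtain ⟨c, hc⟩ := eq_smul_Z₀_pow hq n (a n).2 h1 h2
    have hd := pow_ne_zero n (q_sub_inv_ne_zero hq)
    have hcomm : ∀ y ∈ OKU r, Commute (Double.ofO r y) w →
        Commute (Double.ofO r y) (w - (c * ((q r - (q r)⁻¹) ^ n)⁻¹) • dCasimir r ^ n) :=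
      fun y hy h => h.sub_right (((commute_dCasimir hq (ofO_mem_Ug hy)).pow_right n).smul_right _)
    obtain ⟨p, hp⟩ := ih (w := w - (c * ((q r - (q r)⁻¹) ^ n)⁻¹) • dCasimir r ^ n) (by
      have h3 := Submodule.smul_mem _ (c * ((q r - (q r)⁻¹) ^ n)⁻¹) (dCasimir_pow (r := r) n)
      rw [smul_sub, smul_smul, mul_assoc, inv_mul_cancel₀ hd, mul_one] at h3
      have h4 := sub_mem hv h3
      rw [ha, hc, map_smul, mul_smul_comm]
      convert h4 using 1
      abel) (hcomm _ (X₀_mem r) hX) (hcomm _ (Z₀_mem r) hZ)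
    refine ⟨p + Polynomial.C (c * ((q r - (q r)⁻¹) ^ n)⁻¹) * Polynomial.X ^ n, ?_⟩
    rw [map_add, ← hp, map_mul, Polynomial.aeval_C, map_pow, Polynomial.aeval_X, ← Algebra.smul_def,
      sub_add_cancel]

/-- The Casimir element, as an element of the center of `U_q(𝔤)`. -/
def casimir (r : Kˣ) (hq : ∀ n : ℕ, 0 < n → q r ^ n ≠ 1) : Zg r :=
  ⟨(q r - (q r)⁻¹) • (inclK r (thetaK r) * inclO r (Z r)) + inclO r (q r • X r + (q r)⁻¹ • Y r),
    Subalgebra.mem_center_iff.2 fun w => Subtype.ext (commute_dCasimir hq w.2).eq⟩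

/-- The center of `U_q(𝔤)` is generated by the Casimir element. -/
lemma aeval_casimir_surjective (hq : ∀ n : ℕ, 0 < n → q r ^ n ≠ 1) :
    Function.Surjective (Polynomial.aeval (R := K) (casimir r hq)) := by
  intro z
  obtain ⟨n, hn⟩ := exists_mem_filt z.1.2
  have hz : ∀ y : OKU r, Commute (Double.ofO r y) (z.1 : Double r) := fun y =>
    congrArg Subtype.val (Subalgebra.mem_center_iff.1 z.2 (inclO r y))
  obtain ⟨p, hp⟩ := exists_aeval_dCasimir hq n hn (hz (X r)) (hz (Z r))
  refine ⟨p, Subtype.ext (Subtype.ext ?_)⟩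
  rw [hp]
  exact (Polynomial.aeval_algHom_apply ((Ug r).val.comp (Zg r).val) (casimir r hq) p).symm

end Center

/-! ### Laurent polynomials -/

section Laurent

variable {K : Type u} [Field K]

open LaurentPolynomial

/-- Algebra morphisms from `K[t, t⁻¹]` are determined by the image of `t`. -/
lemma laurent_algHom_ext {B : Type*} [Ring B] [Algebra K B] {f g : K[T;T⁻¹] →ₐ[K] B}
    (h : f (T 1) = g (T 1)) : f = g := by
  have h' : f (T (-1)) = g (T (-1)) := by
    have e (f : K[T;T⁻¹] →ₐ[K] B) : f (T (-1)) * f (T 1) = 1 := by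
      rw [← map_mul, ← T_add, neg_add_cancel, T_zero, map_one]
    have e' : g (T 1) * g (T (-1)) = 1 := by
      rw [← map_mul, ← T_add, add_neg_cancel, T_zero, map_one]
    exact left_inv_eq_right_inv (e f) (h ▸ e')
  refine AlgHom.ext fun p => ?_
  induction p using LaurentPolynomial.induction_on with
  | h_C a => rw [C_eq_algebraMap, AlgHom.commutes, AlgHom.commutes]
  | h_add hp hq => rw [map_add, map_add, hp, hq]
  | h_C_mul_T n a ih => rw [T_add, ← mul_assoc, map_mul, map_mul g, ih, h]
  | h_C_mul_T_Z n a ih => rw [T_sub, ← mul_assoc, map_mul, map_mul g, ih, h']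

/-- The substitution `t ↦ c t`, as an algebra morphism. -/
def scaleHom (c : Kˣ) : K[T;T⁻¹] →ₐ[K] K[T;T⁻¹] :=
  AddMonoidAlgebra.lift K K[T;T⁻¹] ℤ
    { toFun := fun n => (c ^ n.toAdd : Kˣ).1 • T n.toAdd
      map_one' := by simp
      map_mul' := fun m n => by
        rw [toAdd_mul, zpow_add, T_add, smul_mul_smul_comm, Units.val_mul] }

lemma scaleHom_T (c : Kˣ) : scaleHom c (T 1) = (c : K) • T 1 := by
  rw [scaleHom, T, AddMonoidAlgebra.lift_single, one_smul]
  change (c ^ (1 : ℤ) : Kˣ).1 • T 1 = _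
  rw [zpow_one]
  rfl

/-- The substitution `t ↦ c t`, as an automorphism. -/
def scaleEquiv (c : Kˣ) : K[T;T⁻¹] ≃ₐ[K] K[T;T⁻¹] :=
  AlgEquiv.ofAlgHom (scaleHom c) (scaleHom c⁻¹)
    (laurent_algHom_ext (by simp [scaleHom_T, smul_smul]))
    (laurent_algHom_ext (by simp [scaleHom_T, smul_smul]))

/-- The Chebyshev recursion shows that `tⁿ + t⁻ⁿ` is a polynomial in `t + t⁻¹`. -/
lemma T_add_T_neg_mem (n : ℕ) :
    (T n + T (-n) : K[T;T⁻¹]) ∈ Algebra.adjoin K {(T 1 + T (-1) : K[T;T⁻¹])} := by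
  induction n using Nat.twoStepInduction with
  | zero => simpa using add_mem (one_mem _) (one_mem _)
  | one => exact Algebra.subset_adjoin rfl
  | more n h0 h1 =>
    have e : (T (n + 2 : ℕ) + T (-(n + 2 : ℕ)) : K[T;T⁻¹])
        = (T 1 + T (-1)) * (T (n + 1 : ℕ) + T (-(n + 1 : ℕ))) - (T n + T (-n)) := by
      rw [add_mul, mul_add, mul_add, ← T_add, ← T_add, ← T_add, ← T_add]
      push_cast
      ring_nf
    rw [e]
    exact sub_mem (mul_mem (Algebra.subset_adjoin rfl) h1) h0

lemma invert_C_mul_T (a : K) (n : ℤ) : invert (C a * T n : K[T;T⁻¹]) = C a * T (-n) := by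
  rw [map_mul, invert_C]
  exact congrArg _ (invert_T n)

/-- The invariants under `t ↦ t⁻¹` are the polynomials in `t + t⁻¹`: an invariant `p` is half of
`p + p(t⁻¹)`. -/
lemma invariants_le_adjoin [CharZero K] :
    invariants K ≤ Algebra.adjoin K {(T 1 + T (-1) : K[T;T⁻¹])} := by
  intro p hp
  have hp : invert p = p := hp
  have h (p : K[T;T⁻¹]) : p + invert p ∈ Algebra.adjoin K {(T 1 + T (-1) : K[T;T⁻¹])} := by
    induction p using LaurentPolynomial.induction_on' with
    | add p q hp hq =>
      rw [map_add, add_add_add_comm]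
      exact add_mem hp hq
    | C_mul_T n a =>
      rw [invert_C_mul_T, ← mul_add, ← smul_eq_C_mul]
      refine Subalgebra.smul_mem _ ?_ a
      obtain ⟨m, h | h⟩ := n.eq_nat_or_neg
      · rw [h]
        exact T_add_T_neg_mem m
      · rw [h, neg_neg, add_comm _ (T (m : ℤ))]
        exact T_add_T_neg_mem m
  have h2 := Subalgebra.smul_mem _ (h p) (2⁻¹ : K)
  rwa [hp, ← two_smul K p, smul_smul, inv_mul_cancel₀ two_ne_zero, one_smul] at h2

lemma coeff_T_add_T_neg_mul (p : K[T;T⁻¹]) (m : ℤ) :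
    ((T 1 + T (-1)) * p).coeff m = p.coeff (m - 1) + p.coeff (m + 1) := by
  have h (k : ℤ) : (T k * p).coeff m = p.coeff (m - k) := by
    rw [T, AddMonoidAlgebra.coeff_single_mul_apply]
    rw [one_mul, neg_add_eq_sub]
  rw [add_mul, AddMonoidAlgebra.coeff_add, Finsupp.add_apply, h, h, sub_neg_eq_add]

/-- `(t + t⁻¹)ⁿ` is monic of degree `n` in `t`. -/
lemma coeff_T_add_T_neg_pow (n : ℕ) :
    (∀ m : ℤ, n < m → ((T 1 + T (-1) : K[T;T⁻¹]) ^ n).coeff m = 0)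
    ∧ ((T 1 + T (-1) : K[T;T⁻¹]) ^ n).coeff n = 1 := by
  induction n with
  | zero =>
    rw [pow_zero, ← T_zero]
    exact ⟨fun m hm => by rw [T_apply, if_neg (by push_cast at hm; omega)], by simp⟩
  | succ n ih =>
    constructor
    · intro m hm
      rw [pow_succ', coeff_T_add_T_neg_mul, ih.1 _ (by push_cast at hm; omega),
        ih.1 _ (by push_cast at hm; omega), add_zero]
    · rw [pow_succ', coeff_T_add_T_neg_mul, ih.1 (_ + 1) (by push_cast; omega), add_zero,
        Nat.cast_succ, add_sub_cancel_right, ih.2]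

/-- `t + t⁻¹` is transcendental. -/
lemma aeval_T_add_T_neg_injective : Function.Injective
    (Polynomial.aeval (R := K) (T 1 + T (-1) : K[T;T⁻¹])) := by
  rw [injective_iff_map_eq_zero]
  intro p hp
  rw [← Polynomial.leadingCoeff_eq_zero]
  have h := congrArg (fun f : K[T;T⁻¹] => f.coeff p.natDegree) hp
  simp only [Polynomial.aeval_eq_sum_range, Finset.sum_range_succ] at h
  rw [AddMonoidAlgebra.coeff_add, Finsupp.add_apply, AddMonoidAlgebra.coeff_sum,
    Finsupp.finsetSum_apply, Finset.sum_eq_zero, zero_add, AddMonoidAlgebra.coeff_smul,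
    Finsupp.smul_apply, (coeff_T_add_T_neg_pow _).2, smul_eq_mul, mul_one] at h
  · exact h
  · intro i hi
    rw [AddMonoidAlgebra.coeff_smul, Finsupp.smul_apply, (coeff_T_add_T_neg_pow i).1 _
      (by exact_mod_cast Finset.mem_range.1 hi), smul_zero]

lemma T_add_T_neg_mem_invariants : (T 1 + T (-1) : K[T;T⁻¹]) ∈ invariants K := by
  change invert (T 1 + T (-1) : K[T;T⁻¹]) = T 1 + T (-1)
  rw [map_add, invert_T, invert_T, neg_neg, add_comm]

end Laurent

/-! ### The characters -/

section Characters

variable {K : Type u} [Field K] {r : Kˣ}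

open LaurentPolynomial

/-- The values of Laurent polynomials at the points `q ^ (2 j)`, `j ∈ ℕ`. -/
def evalHom (r : Kˣ) : K[T;T⁻¹] →ₐ[K] (ℕ → K) :=
  AddMonoidAlgebra.lift K (ℕ → K) ℤ
    { toFun := fun n j => (q r ^ (2 * n.toAdd)) ^ j
      map_one' := by ext; simp
      map_mul' := fun m n => by
        ext j
        rw [toAdd_mul, mul_add, zpow_add₀ (q_ne_zero r), mul_pow]
        rfl }

lemma evalHom_single (n : ℤ) (c : K) (j : ℕ) :
    evalHom r (.single n c) j = c * (q r ^ (2 * n)) ^ j := by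
  rw [evalHom, AddMonoidAlgebra.lift_single]
  rfl

/-- A Laurent polynomial that vanishes at all powers of `q²` is zero, since the characters
`j ↦ q ^ (2 n j)` of `ℕ` are distinct, hence independent. -/
lemma evalHom_injective (hq : ∀ n : ℕ, 0 < n → q r ^ n ≠ 1) :
    Function.Injective (evalHom r) := by
  have hinj : Function.Injective (fun n : ℤ => powersHom K (q r ^ (2 * n))) := fun m n h => by
    have := q_zpow_injective hq ((powersHom K).injective h)
    omega
  have hlin := (linearIndependent_monoidHom (Multiplicative ℕ) K).comp _ hinj
  rw [injective_iff_map_eq_zero]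
  intro p hp
  refine AddMonoidAlgebra.coeff_injective (linearIndependent_iff.1 hlin p.coeff ?_)
  refine (funext fun j => ?_ : _ = evalHom r p).trans hp
  rw [Finsupp.linearCombination_apply, evalHom, AddMonoidAlgebra.lift_apply]
  simp only [Finsupp.sum, Finset.sum_apply]
  exact Finset.sum_apply (Multiplicative.ofAdd j) _ _

variable [Algebra ℂ K]

/-- The values of `y ∈ O_q(K\U)` at the powers of `k`, an algebra morphism as these are
group-like. -/
def torusHom (r : Kˣ) : OKU r →ₐ[K] (ℕ → K) where
  toFun y j := pair y.1 (Uq.gen r .k ^ j)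
  map_one' := by ext j; simp [pair_one]
  map_mul' y z := by
    ext j
    exact pair_mul_of_grouplike _ _ _ (by
      rw [map_pow, comul_k, Algebra.TensorProduct.tmul_pow])
  map_zero' := rfl
  map_add' _ _ := rfl
  commutes' c := by
    ext j
    rw [Algebra.algebraMap_eq_smul_one]
    change pair (c • (1 : Oq r)) _ = c
    simp [pair_one]

lemma torusHom_apply_of_mem_weight {n : ℤ} {y : OKU r} (hy : y.1 ∈ weight r n) (j : ℕ) :
    torusHom r y j = (q r ^ n) ^ j * pair y.1 1 := by
  change pair y.1 (Uq.gen r .k ^ j) = _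
  induction j with
  | zero => simp
  | succ j ih => rw [pair_pow_succ, mem_weight.1 hy, pair_smul, ih, pow_succ', mul_assoc]

lemma torusHom_X : torusHom r (X r) = evalHom r (T 1) := by
  ext j
  rw [torusHom_apply_of_mem_weight (n := 2) X₀_mem_weight]
  refine (congrArg _ pair_X₀_one).trans ?_
  rw [T, evalHom_single, mul_one, one_mul, mul_one]

lemma torusHom_Y : torusHom r (Y r) = evalHom r (T (-1)) := by
  ext j
  rw [torusHom_apply_of_mem_weight (n := -2) Y₀_mem_weight]
  refine (congrArg _ pair_Y₀_one).trans ?_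
  rw [T, evalHom_single, mul_one, one_mul, mul_neg_one]

lemma torusHom_Z : torusHom r (Z r) = evalHom r 0 := by
  ext j
  rw [torusHom_apply_of_mem_weight (n := 0) Z₀_mem_weight]
  refine (congrArg _ pair_Z₀_one).trans ?_
  rw [mul_zero, map_zero, Pi.zero_apply]

/-- `O_q(K\U)` is generated by `X`, `Y` and `Z`. -/
lemma adjoin_XYZ (hq : ∀ n : ℕ, 0 < n → q r ^ n ≠ 1) :
    Algebra.adjoin K {X r, Y r, Z r} = ⊤ := by
  refine Subalgebra.map_injective (f := (OKU r).val) Subtype.val_injective ?_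
  rw [AlgHom.map_adjoin, Algebra.map_top, Subalgebra.range_val]
  refine le_antisymm (Algebra.adjoin_le ?_) ((OKU_le_adjoin hq).trans (Algebra.adjoin_mono ?_))
  · rintro _ ⟨y, -, rfl⟩
    exact y.2
  · rintro _ (rfl | rfl | rfl)
    · exact ⟨X r, by simp, rfl⟩
    · exact ⟨Y r, by simp, rfl⟩
    · exact ⟨Z r, by simp, rfl⟩

/-- The morphism `ab` is restriction to the torus, composed with the inverse of `evalHom`. -/
lemma existsUnique_ab (hq : ∀ n : ℕ, 0 < n → q r ^ n ≠ 1) :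
    ∃! ab : OKU r →ₐ[K] K[T;T⁻¹], ab (X r) = T 1 ∧ ab (Y r) = T (-1) ∧ ab (Z r) = 0 := by
  have hrange : ∀ y, torusHom r y ∈ (evalHom r).range := by
    have h : Algebra.adjoin K {X r, Y r, Z r} ≤ (evalHom r).range.comap (torusHom r) := by
      refine Algebra.adjoin_le ?_
      rintro _ (rfl | rfl | rfl)
      · exact ⟨_, torusHom_X.symm⟩
      · exact ⟨_, torusHom_Y.symm⟩
      · exact ⟨_, torusHom_Z.symm⟩
    rw [adjoin_XYZ hq] at h
    exact fun y => h (Algebra.mem_top (x := y))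
  let e := AlgEquiv.ofInjective (evalHom r) (evalHom_injective hq)
  let ab := e.symm.toAlgHom.comp ((torusHom r).codRestrict _ hrange)
  have hab : ∀ y p, torusHom r y = evalHom r p → ab y = p := fun y p h =>
    (AlgEquiv.symm_apply_eq e).2 (Subtype.ext h)
  refine ⟨ab, ⟨hab _ _ torusHom_X, hab _ _ torusHom_Y, hab _ _ torusHom_Z⟩, ?_⟩
  rintro f ⟨hX, hY, hZ⟩
  refine AlgHom.ext_of_adjoin_eq_top (adjoin_XYZ hq) ?_
  rintro _ (rfl | rfl | rfl)
  · rw [hX, hab _ _ torusHom_X]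
  · rw [hY, hab _ _ torusHom_Y]
  · rw [hZ, hab _ _ torusHom_Z]

lemma aeval_thetaK_surjective (r : Kˣ) :
    Function.Surjective (Polynomial.aeval (R := K) (thetaK r)) := by
  rintro ⟨x, hx⟩
  rw [Uk, Algebra.adjoin_singleton_eq_range_aeval] at hx
  obtain ⟨p, rfl⟩ := hx
  exact ⟨p, Subtype.ext (Polynomial.aeval_algHom_apply (Uk r).val (thetaK r) p).symm⟩

/-- The character `ζ₀` is the restriction of the counit. -/
lemma existsUnique_zeta (r : Kˣ) : ∃! ζ₀ : Uk r →ₐ[K] K, ζ₀ (thetaK r) = 0 := by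
  refine ⟨(Uq.counitHom r).comp (Uk r).val, ?_, fun ζ h => AlgHom.ext fun x => ?_⟩
  · change Uq.counitHom r (theta r) = 0
    simp [theta]
  · obtain ⟨p, rfl⟩ := aeval_thetaK_surjective r x
    have h' : Uq.counitHom r (theta r) = 0 := by simp [theta]
    rw [← Polynomial.aeval_algHom_apply, ← Polynomial.aeval_algHom_apply, h]
    exact congrArg (fun c => Polynomial.aeval c p) h'.symm

omit [Algebra ℂ K] in
lemma existsUnique_sigma (r : Kˣ) :
    ∃! σ : K[T;T⁻¹] ≃ₐ[K] K[T;T⁻¹], σ (T 1) = (q r)⁻¹ • T 1 := by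
  refine ⟨scaleEquiv (Units.mk0 (q r) (q_ne_zero r))⁻¹, ?_, fun σ h => ?_⟩
  · exact (scaleHom_T _).trans (by simp)
  · refine AlgEquiv.ext fun p => DFunLike.congr_fun (?_ : σ.toAlgHom = (scaleEquiv _).toAlgHom) p
    exact laurent_algHom_ext (h.trans ((scaleHom_T _).trans (by simp)).symm)

end Characters

/-! ### The projection `γ` -/

section Projection

variable {K : Type u} [Field K] [Algebra ℂ K] {r : Kˣ}

open LaurentPolynomial

/-- The map `(aᵢ) ↦ ∑ θ ^ i aᵢ` from finite sequences in `O_q(K\U)` to `U_q(𝔤)`. -/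
def thetaSum (r : Kˣ) : (ℕ →₀ OKU r) →ₗ[K] Ug r :=
  Finsupp.lsum K fun i => LinearMap.mulLeft K (inclK r (thetaK r ^ i)) ∘ₗ (inclO r).toLinearMap

lemma thetaSum_single (i : ℕ) (a : OKU r) :
    thetaSum r (Finsupp.single i a) = inclK r (thetaK r ^ i) * inclO r a := by
  rw [thetaSum, Finsupp.lsum_single]
  rfl

lemma coe_thetaSum_single (i : ℕ) (a : OKU r) :
    (thetaSum r (Finsupp.single i a) : Double r) = dTheta r ^ i * Double.ofO r a := by
  rw [thetaSum_single, map_pow]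
  rfl

lemma coe_thetaSum (f : ℕ →₀ OKU r) {n : ℕ} (h : f.support ⊆ Finset.range n) :
    (thetaSum r f : Double r) = ∑ i ∈ Finset.range n, dTheta r ^ i * Double.ofO r (f i) := by
  conv_lhs => rw [← f.sum_single]
  rw [Finsupp.sum, map_sum, AddSubmonoidClass.coe_finsetSum]
  simp only [coe_thetaSum_single]
  refine Finset.sum_subset h fun i _ hi => ?_
  rw [Finsupp.notMem_support_iff.1 hi, ZeroMemClass.coe_zero, map_zero, mul_zero]

/-- The triangular decomposition: every element of `U_q(𝔤)` is `∑ θ ^ i aᵢ` for a unique finite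
sequence of `aᵢ ∈ O_q(K\U)`. -/
lemma thetaSum_bijective (hq : ∀ n : ℕ, 0 < n → q r ^ n ≠ 1) :
    Function.Bijective (thetaSum r) := by
  constructor
  · rw [injective_iff_map_eq_zero]
    intro f hf
    by_contra hne
    have hs := Finsupp.support_nonempty_iff.2 hne
    set n := f.support.max' hs
    refine Finsupp.mem_support_iff.1 (f.support.max'_mem hs) (Subtype.ext ?_)
    have h := coe_thetaSum f (n := n + 1) fun i hi =>
      Finset.mem_range_succ_iff.2 (f.support.le_max' i hi)
    rw [hf, Finset.sum_range_succ, ZeroMemClass.coe_zero] at h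
    refine eq_zero_of_dTheta_pow_mul_mem hq n (f n).2 ?_
    rw [← neg_eq_of_add_eq_zero_right h.symm]
    exact neg_mem ⟨f, rfl⟩
  · intro w
    obtain ⟨n, a, ha⟩ := exists_mem_filt w.2
    refine ⟨∑ i ∈ Finset.range n, Finsupp.single i (a i), Subtype.ext ?_⟩
    rw [map_sum, AddSubmonoidClass.coe_finsetSum, ha]
    exact Finset.sum_congr rfl fun i _ => coe_thetaSum_single i (a i)

/-- The products `x y` with `x ∈ U_q(𝔨)` and `y ∈ O_q(K\U)` span `U_q(𝔤)`. -/
lemma Ug_induction {S : Submodule K (Ug r)} (h : ∀ x y, inclK r x * inclO r y ∈ S) (w : Ug r) :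
    w ∈ S := by
  obtain ⟨n, a, ha⟩ := exists_mem_filt w.2
  have e : w = ∑ i ∈ Finset.range n, inclK r (thetaK r ^ i) * inclO r (a i) := Subtype.ext (by
    rw [AddSubmonoidClass.coe_finsetSum, ha]
    exact Finset.sum_congr rfl fun i _ =>
      (coe_thetaSum_single i (a i)).symm.trans (congrArg Subtype.val (thetaSum_single i (a i))))
  rw [e]
  exact sum_mem fun i _ => h _ _

/-- The map `γ` applies `ab` to the coefficient of `θ ^ 0`; this works as `ζ₀` annihilates `θ`. -/
lemma exists_gamma (hq : ∀ n : ℕ, 0 < n → q r ^ n ≠ 1) {ζ₀ : Uk r →ₐ[K] K}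
    (hζ : ζ₀ (thetaK r) = 0) (ab : OKU r →ₐ[K] K[T;T⁻¹]) :
    ∃ γ : Ug r →ₗ[K] K[T;T⁻¹], ∀ x y, γ (inclK r x * inclO r y) = ζ₀ x • ab y := by
  let e := LinearEquiv.ofBijective (thetaSum r) (thetaSum_bijective hq)
  refine ⟨ab.toLinearMap ∘ₗ Finsupp.lapply 0 ∘ₗ e.symm.toLinearMap, fun x y => ?_⟩
  have hpow (i : ℕ) : e.symm (inclK r (thetaK r ^ i) * inclO r y) = Finsupp.single i y :=
    e.symm_apply_eq.2 (thetaSum_single i y).symm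
  obtain ⟨p, rfl⟩ := aeval_thetaK_surjective r x
  induction p using Polynomial.induction_on' with
  | add p p' hp hp' => rw [map_add, map_add, add_mul, map_add, hp, hp', map_add, add_smul]
  | monomial i c =>
    rw [Polynomial.aeval_monomial, ← Algebra.smul_def, map_smul, map_smul, smul_mul_assoc, map_smul,
      map_pow ζ₀, hζ, smul_assoc]
    congr 1
    change ab (e.symm (inclK r (thetaK r ^ i) * inclO r y) 0) = _
    rw [hpow]
    cases i with
    | zero => simp
    | succ i => simp

section Gamma

variable {ζ₀ : Uk r →ₐ[K] K} {ab : OKU r →ₐ[K] K[T;T⁻¹]} {γ : Ug r →ₗ[K] K[T;T⁻¹]}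
  (hγ : ∀ x y, γ (inclK r x * inclO r y) = ζ₀ x • ab y)

include hγ

lemma gamma_one : γ 1 = 1 := by simpa using hγ 1 1

lemma gamma_mul_inclO (w : Ug r) (y : OKU r) : γ (w * inclO r y) = γ w * ab y :=
  Ug_induction (S := LinearMap.ker (γ ∘ₗ LinearMap.mulRight K (inclO r y)
    - LinearMap.mulRight K (ab y) ∘ₗ γ)) (fun x z => by
      rw [LinearMap.mem_ker, LinearMap.sub_apply, sub_eq_zero]
      change γ (inclK r x * inclO r z * inclO r y) = γ (inclK r x * inclO r z) * ab y
      rw [mul_assoc, ← map_mul, hγ, hγ, map_mul, smul_mul_assoc]) w |> sub_eq_zero.1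

lemma gamma_inclK_mul (x : Uk r) (w : Ug r) : γ (inclK r x * w) = ζ₀ x • γ w :=
  Ug_induction (S := LinearMap.ker (γ ∘ₗ LinearMap.mulLeft K (inclK r x) - ζ₀ x • γ))
    (fun x' y => by
      rw [LinearMap.mem_ker, LinearMap.sub_apply, sub_eq_zero]
      change γ (inclK r x * (inclK r x' * inclO r y)) = ζ₀ x • γ (inclK r x' * inclO r y)
      rw [← mul_assoc, ← map_mul, hγ, hγ, map_mul, mul_smul]) w |> sub_eq_zero.1

/-- For central `z`, the product `x y z = x z y` is mapped to `ζ₀(x) γ(z) ab(y)`. -/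
lemma gamma_mul_of_mem_center (w : Ug r) {z : Ug r} (hz : z ∈ Zg r) : γ (w * z) = γ w * γ z :=
  Ug_induction (S := LinearMap.ker (γ ∘ₗ LinearMap.mulRight K z - LinearMap.mulRight K (γ z) ∘ₗ γ))
    (fun x y => by
      rw [LinearMap.mem_ker, LinearMap.sub_apply, sub_eq_zero]
      change γ (inclK r x * inclO r y * z) = γ (inclK r x * inclO r y) * γ z
      rw [mul_assoc, Subalgebra.mem_center_iff.1 hz, gamma_inclK_mul hγ, gamma_mul_inclO hγ, hγ,
        smul_mul_assoc, mul_comm]) w |> sub_eq_zero.1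

/-- The restriction of `σ ∘ γ` to the center, as an algebra morphism. -/
def harishChandraHom (σ : K[T;T⁻¹] ≃ₐ[K] K[T;T⁻¹]) : Zg r →ₐ[K] K[T;T⁻¹] :=
  σ.toAlgHom.comp (AlgHom.ofLinearMap (γ ∘ₗ (Zg r).val.toLinearMap) (gamma_one hγ)
    fun w z => gamma_mul_of_mem_center hγ w.1 z.2)

/-- The image of the Casimir element; `γ` annihilates its term `θ Z`, and `σ` turns `q t + q⁻¹ t⁻¹`
into `t + t⁻¹`. -/
lemma harishChandraHom_casimir (hq : ∀ n : ℕ, 0 < n → q r ^ n ≠ 1) (hζ : ζ₀ (thetaK r) = 0)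
    (hX : ab (X r) = T 1) (hY : ab (Y r) = T (-1)) {σ : K[T;T⁻¹] ≃ₐ[K] K[T;T⁻¹]}
    (hσ : σ (T 1) = (q r)⁻¹ • T 1) :
    harishChandraHom hγ σ (casimir r hq) = T 1 + T (-1) := by
  have hσ' : σ (T (-1)) = q r • T (-1) := by
    have h1 : σ (T (-1)) * σ (T 1) = 1 := by
      rw [← map_mul, ← T_add, neg_add_cancel, T_zero, map_one]
    have h2 : σ (T 1) * (q r • T (-1)) = 1 := by
      rw [hσ, smul_mul_smul_comm, ← T_add, inv_mul_cancel₀ (q_ne_zero r), add_neg_cancel, T_zero,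
        one_smul]
    exact left_inv_eq_right_inv h1 h2
  have hO (y : OKU r) : γ (inclO r y) = ab y := by simpa using hγ 1 y
  change σ (γ ((q r - (q r)⁻¹) • (inclK r (thetaK r) * inclO r (Z r))
    + inclO r (q r • X r + (q r)⁻¹ • Y r))) = _
  rw [map_add γ, map_smul, hγ, hζ, zero_smul, smul_zero, zero_add, hO, map_add, map_smul, map_smul,
    hX, hY, map_add, map_smul, map_smul, hσ, hσ', smul_smul, smul_smul,
    mul_inv_cancel₀ (q_ne_zero r), inv_mul_cancel₀ (q_ne_zero r), one_smul, one_smul]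

end Gamma

/-- An algebra morphism that maps the Casimir element to `t + t⁻¹` is an isomorphism of the center
onto the invariants. -/
lemma exists_equiv_invariants (hq : ∀ n : ℕ, 0 < n → q r ^ n ≠ 1) (f : Zg r →ₐ[K] K[T;T⁻¹])
    (hf : f (casimir r hq) = T 1 + T (-1)) :
    ∃ e : Zg r ≃ₐ[K] invariants K, ∀ z, (e z : K[T;T⁻¹]) = f z := by
  have : CharZero K := charZero_of_injective_algebraMap (algebraMap ℂ K).injective
  have hf' (p : Polynomial K) : f (Polynomial.aeval (casimir r hq) p)
      = Polynomial.aeval (T 1 + T (-1) : K[T;T⁻¹]) p := by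
    rw [← Polynomial.aeval_algHom_apply, hf]
  have hmem (z : Zg r) : f z ∈ invariants K := by
    obtain ⟨p, rfl⟩ := aeval_casimir_surjective hq z
    rw [hf', ← Polynomial.aeval_subalgebra_coe p (invariants K) ⟨_, T_add_T_neg_mem_invariants⟩]
    exact Subtype.prop _
  refine ⟨AlgEquiv.ofBijective (f.codRestrict _ hmem) ⟨?_, ?_⟩, fun z => rfl⟩
  · intro z w h
    obtain ⟨p, rfl⟩ := aeval_casimir_surjective hq z
    obtain ⟨p', rfl⟩ := aeval_casimir_surjective hq w
    have h' : f _ = f _ := congrArg Subtype.val h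
    rw [hf', hf'] at h'
    rw [aeval_T_add_T_neg_injective h']
  · rintro ⟨y, hy⟩
    have h := invariants_le_adjoin hy
    rw [Algebra.adjoin_singleton_eq_range_aeval] at h
    obtain ⟨p, hp⟩ := h
    exact ⟨Polynomial.aeval (casimir r hq) p, Subtype.ext ((hf' p).trans hp)⟩

end Projection

end QSL2

end

theorem mainTheorem6 {K : Type u} [Field K] [Algebra ℂ K] (r : Kˣ)
    (hq : ∀ n : ℕ, 0 < n → QSL2.q r ^ n ≠ 1) :
    (∃! ζ₀ : QSL2.Uk r →ₐ[K] K, ζ₀ (QSL2.thetaK r) = 0) ∧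
    (∃! ab : QSL2.OKU r →ₐ[K] LaurentPolynomial K,
      ab (QSL2.X r) = LaurentPolynomial.T 1 ∧ ab (QSL2.Y r) = LaurentPolynomial.T (-1) ∧
        ab (QSL2.Z r) = 0) ∧
    (∃! σ : LaurentPolynomial K ≃ₐ[K] LaurentPolynomial K,
      σ (LaurentPolynomial.T 1) = (QSL2.q r)⁻¹ • LaurentPolynomial.T 1) ∧
    ∀ (ζ₀ : QSL2.Uk r →ₐ[K] K) (ab : QSL2.OKU r →ₐ[K] LaurentPolynomial K)
      (σ : LaurentPolynomial K ≃ₐ[K] LaurentPolynomial K),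
      ζ₀ (QSL2.thetaK r) = 0 →
      ab (QSL2.X r) = LaurentPolynomial.T 1 → ab (QSL2.Y r) = LaurentPolynomial.T (-1) →
      ab (QSL2.Z r) = 0 →
      σ (LaurentPolynomial.T 1) = (QSL2.q r)⁻¹ • LaurentPolynomial.T 1 →
      ∃ γ : QSL2.Ug r →ₗ[K] LaurentPolynomial K,
        (∀ (x : QSL2.Uk r) (y : QSL2.OKU r),
          γ (QSL2.inclK r x * QSL2.inclO r y) = ζ₀ x • ab y) ∧
        (∀ γ' : QSL2.Ug r →ₗ[K] LaurentPolynomial K,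
          (∀ (x : QSL2.Uk r) (y : QSL2.OKU r),
            γ' (QSL2.inclK r x * QSL2.inclO r y) = ζ₀ x • ab y) → γ' = γ) ∧
        ∃ e : QSL2.Zg r ≃ₐ[K] QSL2.invariants K,
          ∀ z : QSL2.Zg r, (e z : LaurentPolynomial K) = σ (γ z) := by
  refine ⟨QSL2.existsUnique_zeta r, QSL2.existsUnique_ab hq, QSL2.existsUnique_sigma r,
    fun ζ₀ ab σ hζ hX hY _ hσ => ?_⟩
  obtain ⟨γ, hγ⟩ := QSL2.exists_gamma hq hζ ab
  refine ⟨γ, hγ, fun γ' hγ' => LinearMap.ext fun w => sub_eq_zero.1 ?_,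
    QSL2.exists_equiv_invariants hq (QSL2.harishChandraHom hγ σ)
      (QSL2.harishChandraHom_casimir hγ hq hζ hX hY hσ)⟩
  exact QSL2.Ug_induction (S := LinearMap.ker (γ' - γ)) (fun x y => by
    rw [LinearMap.mem_ker, LinearMap.sub_apply, hγ, hγ', sub_self]) w
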